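/- Let $\Sigma_3$ be a compact oriented smooth 3-manifold, possibly with boundary, and let $(M,\Omega)$ be a holomorphic symplectic manifold. Work in holomorphic Darboux coordinates $x=(x^1,\dots,x^N)$ on an open set $U\subseteq M$, so that the matrix $(\Omega_{ij})$ of $\Omega$ is constant on $U$. Let $\varphi$ be a holomorphic formal exponential map on $U$: formal power series $$\varphi^i(x,y)=x^i+y^i+O(y^2)$$ in $y=(y^1,\dots,y^N)$ whose coefficients are smooth functions of $(x,\bar x)$. Assume that $\varphi$ preserves the symplectic form: $\Omega_{pq}\,\frac{\partial\varphi^p}{\partial y^i}\frac{\partial\varphi^q}{\partial y^j}=\Omega_{ij}$. Let $$R^i_j(x;y)=-\Big[\Big(\frac{\partial\varphi}{\partial y}\Big)^{-1}\Big]^i_p\frac{\partial\varphi^p}{\partial x^j},\qquad R^i_{\bar j}(x;y)=-\Big[\Big(\frac{\partial\varphi}{\partial y}\Big)^{-1}\Big]^i_p\frac{\partial\varphi^p}{\partial x^{\bar j}}$$ be the components of the classical Grothendieck connection $d_M+R$, where $d_M=d_x+d_{\bar x}$ with $d_x=dx^j\frac{\partial}{\partial x^j}$ and $d_{\bar x}=dx^{\bar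 j}\frac{\partial}{\partial x^{\bar j}}$. Let $\hat R^i_j$ and $\hat R^i_{\bar j}$ be obtained from $R^i_j$ and $R^i_{\bar j}$ by multiplying the part that is homogeneous of degree $k$ in $y$ by $\frac1{k+1}$, for every $k\ge 0$. A field is an even superfield $\hat{\mathbf X}=(\hat{\mathbf X}^i)$, a point of the formal neighbourhood of $0$ in the graded space $\Omega^\bullet(\Sigma_3)\otimes T^{1,0}_xM$ (that is, $\hat{\mathbf X}^i$ is an inhomogeneous differential form on $\Sigma_3$ with coefficients in a Grassmann algebra, of even total parity and with zero scalar part in form degree $0$). Let $d$ be the de Rham differential of $\Sigma_3$, $\delta$ the de Rham differential on the space of fields, and $$\omega=\int_{\Sigma_3}\tfrac12\Omega_{ij}\,\delta\hat{\mathbf X}^i\delta\hat{\mathbf X}^j,\qquad \hat{\mathcal S}=\int_{\Sigma_3}\tfrac12\Omega_{ij}\hat{\mathbf X}^id\hat{\mathbf X}^j,$$ $$\mathcal S_R=\int_{\Sigma_3}\hat R^i_j(x;\hat{\mathbf X})\Omega_{il}\hat{\mathbf X}^l\,dx^j,\qquad \mathcal S_{\bar R}=\int_{\Sigma_3}\hat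 R^i_{\bar j}(x;\hat{\mathbf X})\Omega_{il}\hat{\mathbf X}^l\,dx^{\bar j}.$$ The formal global action is $\tilde{\mathcal S}=\hat{\mathcal S}+\mathcal S_R+\mathcal S_{\bar R}$. The differentials $dx^j,dx^{\bar j}$ are odd and anticommute with odd quantities, and integration over $\Sigma_3$ is linear over coefficients on the right. For an even functional $F$ (with values in forms on $M$), its Hamiltonian vector field $Q_F$ is the odd vector field on the space of fields with $\iota_{Q_F}\omega=\delta F$, i.e. $\delta F(\xi)=\int_{\Sigma_3}\Omega_{ij}Q_F^i\xi^j$ for all even $\xi$; the BV bracket is $(F,G)=\iota_{Q_F}\iota_{Q_G}\omega=\int_{\Sigma_3}\Omega_{ij}Q_F^iQ_G^j$. Finally put $\tilde Q=-d+R$, i.e. $$\tilde Q^i=-d\hat{\mathbf X}^i+R^i_j(x;\hat{\mathbf X})\,dx^j+R^i_{\bar j}(x;\hat{\mathbf X})\,dx^{\bar j}.$$ 1. If $\partial\Sigma_3=\emptyset$, then $\hat{\mathcal S}$, $\mathcal S_R$, $\mathcal S_{\bar R}$ have Hamiltonian vector fields, $\tilde Q$ is the Hamiltonian vector field of $\tilde{\mathcal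 S}$, and for every $x\in U$ the differential Classical Master Equation $$d_M\tilde{\mathcal S}+\tfrac12(\tilde{\mathcal S},\tilde{\mathcal S})=0$$ holds. By form degree on $M$ it splits into the following equations, all of which hold: $$(\hat{\mathcal S},\hat{\mathcal S})=0,\qquad d_x\hat{\mathcal S}+(\mathcal S_R,\hat{\mathcal S})=0,\qquad d_{\bar x}\hat{\mathcal S}+(\mathcal S_{\bar R},\hat{\mathcal S})=0,$$ $$d_x\mathcal S_R+\tfrac12(\mathcal S_R,\mathcal S_R)=0,\qquad d_{\bar x}\mathcal S_{\bar R}+\tfrac12(\mathcal S_{\bar R},\mathcal S_{\bar R})=0,$$ $$\Big(d_x\mathcal S_{\bar R}+\tfrac12(\mathcal S_R,\mathcal S_{\bar R})\Big)+\Big(d_{\bar x}\mathcal S_R+\tfrac12(\mathcal S_{\bar R},\mathcal S_R)\Big)=0.$$ 2. If $\Sigma_3$ may have a boundary, then for every $x\in U$ the modified equation $$\iota_{\tilde Q}\,\omega=\delta\tilde{\mathcal S}+\pi^*\alpha^\partial$$ holds, where $\pi$ is the restriction of fields to $\partial\Sigma_3$ and $\alpha^\partial=\int_{\partial\Sigma_3}\tfrac12\Omega_{ij}\hat{\mathbf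 X}^i\delta\hat{\mathbf X}^j$, with $\partial\Sigma_3$ oriented so that an inward normal followed by a positive frame of $\partial\Sigma_3$ is a positive frame of $\Sigma_3$. -/

import Mathlib

open scoped Manifold ContDiff
open Set

noncomputable section

namespace RozanskyWitten

/-! ### Coefficientwise operators -/

/-- A `ℂ`-linear operation `L` on scalar functions (a derivative at a point, an integral), applied
coefficient by coefficient to a function with values in a complex vector space. It is used for
functions with values in a finite-dimensional subspace, where it does not depend on the basis. -/
def coefwise {α W : Type*} [AddCommGroup W] [Module ℂ W] (L : (α → ℂ) → ℂ) (f : α → W) : W :=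
  ∑ᶠ b, L (fun a => (Module.Basis.ofVectorSpace ℂ W).repr (f a) b) •
    Module.Basis.ofVectorSpace ℂ W b

/-! ### The Grassmann algebra of coefficients -/

/-- Odd generators: `θ^μ` (`μ < 3`, the odd fibre coordinates of `T[1]S`), `dx^j`, `dx̄^j`
(`j < N`, the differentials of the coordinates of the target), and a countable supply of auxiliary
odd constants `η_a`, used to describe functions on the graded space of fields by their values on
Grassmann-valued superfields. -/
abbrev Gen (N : ℕ) : Type := Fin 3 ⊕ (Fin N ⊕ (Fin N ⊕ ℕ))

abbrev Grass (N : ℕ) : Type := ExteriorAlgebra ℂ (Gen N →₀ ℂ)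

variable {N : ℕ}

def gen (g : Gen N) : Grass N := ExteriorAlgebra.ι ℂ (Finsupp.single g 1)

def theta (μ : Fin 3) : Grass N := gen (Sum.inl μ)

def dx (j : Fin N) : Grass N := gen (Sum.inr (Sum.inl j))

def dxbar (j : Fin N) : Grass N := gen (Sum.inr (Sum.inr (Sum.inl j)))

/-- The left derivative `∂/∂θ^μ`. -/
def dtheta (μ : Fin 3) : Grass N →ₗ[ℂ] Grass N :=
  CliffordAlgebra.contractLeft (Q := (0 : QuadraticForm ℂ (Gen N →₀ ℂ)))
    (Finsupp.lapply (Sum.inl μ))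

/-- The parity automorphism: the identity on even and minus the identity on odd elements. -/
def parity : Grass N →ₐ[ℂ] Grass N := ExteriorAlgebra.map (-LinearMap.id)

def IsEven (a : Grass N) : Prop := parity a = a

def IsOdd (a : Grass N) : Prop := parity a = -a

/-- `a` does not involve the `θ^μ`. -/
def IsConst (a : Grass N) : Prop := ∀ μ, dtheta μ a = 0

/-- Berezin integration over `θ`: `θ^0 θ^1 θ^2 a ↦ a` when `a` does not involve the `θ^μ`, and
terms of lower degree in `θ` go to `0`. -/
def berezin (a : Grass N) : Grass N := dtheta 2 (dtheta 1 (dtheta 0 a))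

/-- Berezin integration over `θ^1, θ^2`. -/
def berezinBoundary (a : Grass N) : Grass N := dtheta 2 (dtheta 1 a)

/-- The substitution `θ^μ ↦ ∑_ν J^μ_ν θ^ν`. -/
def substTheta (J : Matrix (Fin 3) (Fin 3) ℝ) : Grass N →ₐ[ℂ] Grass N :=
  ExteriorAlgebra.map (Finsupp.linearCombination ℂ (fun g : Gen N =>
    match g with
    | Sum.inl μ => ∑ ν, (J μ ν : ℂ) • Finsupp.single (Sum.inl ν) 1
    | Sum.inr h => Finsupp.single (Sum.inr h) 1))

/-- The substitution `θ^0 ↦ 0`. -/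
def killNormal : Grass N →ₐ[ℂ] Grass N :=
  substTheta (Matrix.diagonal (fun μ => if μ = 0 then 0 else 1))

/-! ### The source: superfunctions on `T[1]S`

`S` is a 3-manifold modelled on the half space `{u^0 ≥ 0}`. Superfunctions on `T[1]S` with
Grassmann coefficients, that is, inhomogeneous differential forms on `S`, are given by their
expressions in all charts of the atlas. -/

/-- The Jacobian matrix `∂u'^μ/∂u^ν` at `p` of the change from the chart `c` (coordinates `u`) to
the chart `c'` (coordinates `u'`). -/
def jac {S : Type*} [TopologicalSpace S]
    (c c' : OpenPartialHomeomorph S (EuclideanHalfSpace 3)) (p : S) :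
    Matrix (Fin 3) (Fin 3) ℝ :=
  fun μ ν => fderivWithin ℝ (c'.extend (𝓡∂ 3) ∘ (c.extend (𝓡∂ 3)).symm) (range (𝓡∂ 3))
    (c.extend (𝓡∂ 3) p) (EuclideanSpace.single ν 1) μ

/-- All coordinate changes of the atlas preserve the orientation. -/
def IsOriented (S : Type*) [TopologicalSpace S] [ChartedSpace (EuclideanHalfSpace 3) S] : Prop :=
  ∀ c ∈ atlas (EuclideanHalfSpace 3) S, ∀ c' ∈ atlas (EuclideanHalfSpace 3) S,
    ∀ p ∈ c.source ∩ c'.source, 0 < (jac c c' p).det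

/-- Families of expressions in charts; `f c p` is the value at `p` of the expression in the chart
`c`. Sums and products are pointwise. -/
abbrev SForm (N : ℕ) (S : Type*) [TopologicalSpace S] [ChartedSpace (EuclideanHalfSpace 3) S] :
    Type _ :=
  atlas (EuclideanHalfSpace 3) S → S → Grass N

section Source

variable {S : Type*} [TopologicalSpace S] [ChartedSpace (EuclideanHalfSpace 3) S]

/-- The expressions in charts are smooth (with finitely many Grassmann coefficients) and transform
as differential forms do. -/
structure IsSForm (f : SForm N S) : Prop where
  compat : ∀ c c' : atlas (EuclideanHalfSpace 3) S, ∀ p ∈ c.1.source ∩ c'.1.source,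
    f c p = substTheta (jac c.1 c'.1 p) (f c' p)
  smooth : ∀ c : atlas (EuclideanHalfSpace 3) S,
    ∃ (B : Finset (Grass N)) (a : Grass N → EuclideanSpace ℝ (Fin 3) → ℂ),
      (∀ b ∈ B, ContDiffOn ℝ ∞ (a b) (c.1.extend (𝓡∂ 3)).target) ∧
      ∀ u ∈ (c.1.extend (𝓡∂ 3)).target,
        f c ((c.1.extend (𝓡∂ 3)).symm u) = ∑ b ∈ B, a b u • b

def IsEvenForm (f : SForm N S) : Prop :=
  ∀ c : atlas (EuclideanHalfSpace 3) S, ∀ p ∈ c.1.source, IsEven (f c p)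

def IsOddForm (f : SForm N S) : Prop :=
  ∀ c : atlas (EuclideanHalfSpace 3) S, ∀ p ∈ c.1.source, IsOdd (f c p)

/-- The de Rham differential of `S` as the odd vector field `D = ∑_μ θ^μ ∂/∂u^μ` on `T[1]S`. -/
def deRham (f : SForm N S) : SForm N S := fun c p =>
  ∑ μ : Fin 3, theta μ *
    coefwise (fun g : EuclideanSpace ℝ (Fin 3) → ℂ =>
      fderivWithin ℝ g (range (𝓡∂ 3)) (c.1.extend (𝓡∂ 3) p) (EuclideanSpace.single μ 1))
      (fun u => f c ((c.1.extend (𝓡∂ 3)).symm u))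

def chartIn (q : S) : atlas (EuclideanHalfSpace 3) S := ⟨chartAt _ q, chart_mem_atlas _ q⟩

/-- Superfunctions on `T[1]∂S`, by their expressions in the charts of `S`; they do not involve the
coordinates `u^0, θ^0`. -/
abbrev BForm (N : ℕ) (S : Type*) [TopologicalSpace S] [ChartedSpace (EuclideanHalfSpace 3) S] :
    Type _ :=
  atlas (EuclideanHalfSpace 3) S → (𝓡∂ 3).boundary S → Grass N

/-- Restriction (pullback) of forms to the boundary. -/
def toBoundary (f : SForm N S) : BForm N S := fun c p => killNormal (f c p)

variable [IsManifold (𝓡∂ 3) ∞ S] [CompactSpace S] [T2Space S]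

/-- A smooth partition of unity subordinate to the preferred charts. -/
def chartPartition (S : Type*) [TopologicalSpace S] [ChartedSpace (EuclideanHalfSpace 3) S]
    [IsManifold (𝓡∂ 3) ∞ S] [CompactSpace S] [T2Space S] :
    SmoothPartitionOfUnity S (𝓡∂ 3) S univ :=
  (SmoothPartitionOfUnity.exists_isSubordinate_chartAt_source (𝓡∂ 3) S).choose

/-- The integral over `T[1]S` against the canonical Berezinian, that is, the integral over the
oriented manifold `S` of the top degree part of a form. -/
def integral (f : SForm N S) : Grass N :=
  ∑ᶠ q : S, coefwise
    (fun g : EuclideanSpace ℝ (Fin 3) → ℂ => ∫ u in (extChartAt (𝓡∂ 3) q).target, g u)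
    (fun u => ((chartPartition S q ((extChartAt (𝓡∂ 3) q).symm u) : ℝ) : ℂ) •
      berezin (f (chartIn q) ((extChartAt (𝓡∂ 3) q).symm u)))

open Classical in
/-- The integral over `T[1]∂S`. The boundary `u^0 = 0` has the coordinates `(u^1, u^2)`, in this
order; that is, `∂S` is oriented by the inward normal, placed first. -/
def boundaryIntegral (f : BForm N S) : Grass N :=
  ∑ᶠ q : S, coefwise
    (fun g : EuclideanSpace ℝ (Fin 2) → ℂ =>
      ∫ v in {v : EuclideanSpace ℝ (Fin 2) | !₂[0, v 0, v 1] ∈ (extChartAt (𝓡∂ 3) q).target}, g v)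
    (fun v => ((chartPartition S q ((extChartAt (𝓡∂ 3) q).symm !₂[0, v 0, v 1]) : ℝ) : ℂ) •
      berezinBoundary
        (if h : (extChartAt (𝓡∂ 3) q).symm !₂[0, v 0, v 1] ∈ (𝓡∂ 3).boundary S then
          f (chartIn q) ⟨_, h⟩ else 0))

/-! ### The space of fields and its odd symplectic geometry -/

/-- Superfields `X = (X^i)`: Grassmann-valued points of `Ω^•(S) ⊗ T_x^{1,0}M`. -/
abbrev SField (N : ℕ) (S : Type*) [TopologicalSpace S] [ChartedSpace (EuclideanHalfSpace 3) S] :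
    Type _ :=
  Fin N → SForm N S

/-- Even tangent vectors to the space of fields: even superfields `ξ^i = δX^i`. -/
def IsTangent (ξ : SField N S) : Prop := ∀ i, IsSForm (ξ i) ∧ IsEvenForm (ξ i)

/-- Points of the formal neighbourhood of `0` in the space of fields: even superfields whose
Grassmann-degree-zero part vanishes (so that they are nilpotent). -/
def IsSuperfield (X : SField N S) : Prop :=
  IsTangent X ∧ ∀ i, ∀ c : atlas (EuclideanHalfSpace 3) S, ∀ p ∈ c.1.source,
    ExteriorAlgebra.algebraMapInv (X i c p) = 0

/-- Functions on the space of fields with values in differential forms on the target at a point. -/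
abbrev Functional (N : ℕ) (S : Type*) [TopologicalSpace S]
    [ChartedSpace (EuclideanHalfSpace 3) S] : Type _ :=
  SField N S → Grass N

/-- The scalar multiple `t ξ` for a Grassmann constant `t`. -/
def scale (t : Grass N) (ξ : SField N S) : SField N S := fun i c p => t * ξ i c p

/-- `d` is the value `(δF)_X(ξ)` of the de Rham differential `δF` at `X` on the even tangent vector
`ξ`: `F(X + t ξ) = F(X) + t d` for all even constants `t` with `t² = 0`. -/
def IsVariation (F : Functional N S) (X ξ : SField N S) (d : Grass N) : Prop :=
  ∀ t : Grass N, IsEven t → IsConst t → t * t = 0 → F (X + scale t ξ) = F X + t * d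

/-- The contraction `ι_ξ ι_Q ω = ∫ Ω_{ij} Q^i ξ^j` of `ω = ∫ ½ Ω_{ij} δX^i δX^j`. -/
def bvForm (Ω : Matrix (Fin N) (Fin N) ℂ) (Q ξ : SField N S) : Grass N :=
  integral (∑ i, ∑ j, Ω i j • (Q i * ξ j))

/-- `Q` is an odd vector field on the space of fields with `ι_Q ω = δF`. -/
structure IsHamiltonian (Ω : Matrix (Fin N) (Fin N) ℂ) (F : Functional N S)
    (Q : SField N S → SField N S) : Prop where
  odd : ∀ X, IsSuperfield X → ∀ i, IsSForm (Q X i) ∧ IsOddForm (Q X i)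
  eq : ∀ X, IsSuperfield X → ∀ ξ, IsTangent ξ → IsVariation F X ξ (bvForm Ω (Q X) ξ)

open Classical in
/-- The BV bracket `(F, G) = ι_{Q_F} ι_{Q_G} ω` of even functionals, where `Q_F`, `Q_G` are the
Hamiltonian vector fields of `F` and `G` (and `0` by convention when they do not exist). -/
def bvBracket (Ω : Matrix (Fin N) (Fin N) ℂ) (F G : Functional N S) : Functional N S := fun X =>
  if h : (∃ Q, IsHamiltonian Ω F Q) ∧ (∃ Q, IsHamiltonian Ω G Q) then
    bvForm Ω (h.1.choose X) (h.2.choose X)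
  else 0

/-- The 1-form `α^∂ = ∫_{∂S} ½ Ω_{ij} Y^i δY^j` on the boundary fields, at `Y`, evaluated on `ζ`. -/
def boundaryPrimitive (Ω : Matrix (Fin N) (Fin N) ℂ) (Y ζ : Fin N → BForm N S) : Grass N :=
  boundaryIntegral ((1 / 2 : ℂ) • ∑ i, ∑ j, Ω i j • (Y i * ζ j))

/-- The projection `π` from the fields on `S` to the fields on `∂S`. -/
def boundaryField (X : SField N S) : Fin N → BForm N S := fun i => toBoundary (X i)

end Source

/-! ### The target -/

/-- The coordinate components of a field of bilinear forms in the chart `e`, at the point with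
coordinates `x`. -/
def formCoord {M : Type*} [TopologicalSpace M] [ChartedSpace (Fin N → ℂ) M]
    (σ : ∀ p : M, LinearMap.BilinForm ℂ (TangentSpace 𝓘(ℂ, Fin N → ℂ) p))
    (e : OpenPartialHomeomorph M (Fin N → ℂ)) (i j : Fin N) (x : Fin N → ℂ) : ℂ :=
  σ (e.symm x)
    (mfderiv 𝓘(ℂ, Fin N → ℂ) 𝓘(ℂ, Fin N → ℂ) e.symm x (Pi.single i 1 : Fin N → ℂ))
    (mfderiv 𝓘(ℂ, Fin N → ℂ) 𝓘(ℂ, Fin N → ℂ) e.symm x (Pi.single j 1 : Fin N → ℂ))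

/-- Holomorphic symplectic forms: closed nondegenerate holomorphic `(2,0)`-forms. -/
structure HolomorphicSymplecticForm (N : ℕ) (M : Type*) [TopologicalSpace M]
    [ChartedSpace (Fin N → ℂ) M] where
  form : ∀ p : M, LinearMap.BilinForm ℂ (TangentSpace 𝓘(ℂ, Fin N → ℂ) p)
  alt : ∀ p, (form p).IsAlt
  nondegenerate : ∀ p, (form p).Nondegenerate
  holomorphic : ∀ e ∈ IsManifold.maximalAtlas 𝓘(ℂ, Fin N → ℂ) ω M, ∀ i j,
    DifferentiableOn ℂ (formCoord form e i j) e.target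
  closed : ∀ e ∈ IsManifold.maximalAtlas 𝓘(ℂ, Fin N → ℂ) ω M, ∀ x ∈ e.target, ∀ i j k,
    fderiv ℂ (formCoord form e i j) x (Pi.single k 1)
      + fderiv ℂ (formCoord form e j k) x (Pi.single i 1)
      + fderiv ℂ (formCoord form e k i) x (Pi.single j 1) = 0

/-- `∂g/∂x^j` at `x`. -/
def partialHol (j : Fin N) (x : Fin N → ℂ) (g : (Fin N → ℂ) → ℂ) : ℂ :=
  (1 / 2) * (fderiv ℝ g x (Pi.single j 1) - Complex.I * fderiv ℝ g x (Pi.single j Complex.I))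

/-- `∂g/∂x̄^j` at `x`. -/
def partialAnti (j : Fin N) (x : Fin N → ℂ) (g : (Fin N → ℂ) → ℂ) : ℂ :=
  (1 / 2) * (fderiv ℝ g x (Pi.single j 1) + Complex.I * fderiv ℝ g x (Pi.single j Complex.I))

/-- The holomorphic Dolbeault differential `d_x = ∑_j dx^j ∂/∂x^j` on differential forms. -/
def dHol (F : (Fin N → ℂ) → Grass N) (x : Fin N → ℂ) : Grass N :=
  ∑ j, dx j * coefwise (partialHol j x) F

/-- The antiholomorphic Dolbeault differential `d_x̄ = ∑_j dx̄^j ∂/∂x̄^j`. -/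
def dAnti (F : (Fin N → ℂ) → Grass N) (x : Fin N → ℂ) : Grass N :=
  ∑ j, dxbar j * coefwise (partialAnti j x) F

/-- `d_M = d_x + d_x̄`. -/
def dM (F : (Fin N → ℂ) → Grass N) (x : Fin N → ℂ) : Grass N := dHol F x + dAnti F x

/-! ### Formal exponential maps and the Grothendieck connection -/

/-- A holomorphic formal exponential map in coordinates on `U`: formal power series
`φ^i(x, y) = x^i + y^i + O(y²)` in `y` whose coefficients are smooth functions of `x ∈ U`. -/
structure IsFormalExp (U : Set (Fin N → ℂ)) (φ : (Fin N → ℂ) → Fin N → MvPowerSeries (Fin N) ℂ) :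
    Prop where
  smooth : ∀ i n, ContDiffOn ℝ ∞ (fun x => MvPowerSeries.coeff n (φ x i)) U
  zeroth : ∀ x ∈ U, ∀ i, MvPowerSeries.constantCoeff (φ x i) = x i
  first : ∀ x ∈ U, ∀ i j,
    MvPowerSeries.coeff (Finsupp.single j 1) (φ x i) = if i = j then 1 else 0

/-- The Jacobian matrix `∂φ^p/∂y^i`. -/
def fibreJac (φ : (Fin N → ℂ) → Fin N → MvPowerSeries (Fin N) ℂ) (x : Fin N → ℂ) :
    Matrix (Fin N) (Fin N) (MvPowerSeries (Fin N) ℂ) :=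
  Matrix.of fun p i => MvPowerSeries.pderiv ℂ i (φ x p)

/-- `φ_x` pulls the constant form `Ω` back to the constant form `Ω`. -/
def PreservesForm (Ω : Matrix (Fin N) (Fin N) ℂ) (U : Set (Fin N → ℂ))
    (φ : (Fin N → ℂ) → Fin N → MvPowerSeries (Fin N) ℂ) : Prop :=
  ∀ x ∈ U, ∀ i j, ∑ p, ∑ q, Ω p q • (fibreJac φ x p i * fibreJac φ x q j)
    = MvPowerSeries.C (Ω i j)

/-- A `ℂ`-linear operation `L` on scalar functions, applied to all coefficients of a family of
formal power series. -/
def coefMap {α : Type*} (L : (α → ℂ) → ℂ) (f : α → MvPowerSeries (Fin N) ℂ) :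
    MvPowerSeries (Fin N) ℂ :=
  fun n => L (fun a => MvPowerSeries.coeff n (f a))

/-- `R^i_j(x; y) = -[(∂φ/∂y)⁻¹]^i_p ∂φ^p/∂x^j`. -/
def connHol (φ : (Fin N → ℂ) → Fin N → MvPowerSeries (Fin N) ℂ) (x : Fin N → ℂ) (j i : Fin N) :
    MvPowerSeries (Fin N) ℂ :=
  -∑ p, (fibreJac φ x)⁻¹ i p *
    coefMap (partialHol j x) (fun x' => φ x' p)

/-- `R^i_j̄(x; y) = -[(∂φ/∂y)⁻¹]^i_p ∂φ^p/∂x̄^j`. -/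
def connAnti (φ : (Fin N → ℂ) → Fin N → MvPowerSeries (Fin N) ℂ) (x : Fin N → ℂ) (j i : Fin N) :
    MvPowerSeries (Fin N) ℂ :=
  -∑ p, (fibreJac φ x)⁻¹ i p *
    coefMap (partialAnti j x) (fun x' => φ x' p)

/-- Multiplication of the homogeneous part of degree `k` by `1/(k+1)`. -/
def hamNormalize (f : MvPowerSeries (Fin N) ℂ) : MvPowerSeries (Fin N) ℂ :=
  fun n => MvPowerSeries.coeff n f / ((∑ i, n i : ℕ) + 1)

/-- The value of a formal power series at a tuple of commuting nilpotent elements. -/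
def evalSeries {A : Type*} [Ring A] [Algebra ℂ A] (f : MvPowerSeries (Fin N) ℂ) (a : Fin N → A) :
    A :=
  ∑ᶠ n : Fin N →₀ ℕ, MvPowerSeries.coeff n f • (List.ofFn fun i => a i ^ n i).prod

section Action

variable {S : Type*} [TopologicalSpace S] [ChartedSpace (EuclideanHalfSpace 3) S]

/-- The value `f(X)` of a formal power series on superfields. -/
def evalField (f : MvPowerSeries (Fin N) ℂ) (X : SField N S) : SForm N S :=
  fun c p => evalSeries f (fun i => X i c p)

/-- A Grassmann constant as a superfunction on `T[1]S`. -/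
def constForm (a : Grass N) : SForm N S := fun _ _ => a

/-- The odd vector field `Q̃ = -D + R̂` on the space of fields, with components
`Q̃^i = -D X^i + R^i_j(x; X) dx^j + R^i_j̄(x; X) dx̄^j`. -/
def globalVF (φ : (Fin N → ℂ) → Fin N → MvPowerSeries (Fin N) ℂ) (x : Fin N → ℂ)
    (X : SField N S) : SField N S :=
  fun i => -deRham (X i) + ∑ j, evalField (connHol φ x j i) X * constForm (dx j)
    + ∑ j, evalField (connAnti φ x j i) X * constForm (dxbar j)

variable [IsManifold (𝓡∂ 3) ∞ S] [CompactSpace S] [T2Space S]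

/-- `Ŝ = ∫ ½ Ω_{ij} X^i D X^j`. -/
def actionKin (Ω : Matrix (Fin N) (Fin N) ℂ) : Functional N S := fun X =>
  integral ((1 / 2 : ℂ) • ∑ i, ∑ j, Ω i j • (X i * deRham (X j)))

/-- `S_R = ∫ R̂^i_j(x; X) Ω_{il} X^l dx^j`, where the part of `R̂^i_j` of degree `k` in `X` is
`1/(k+1)` times the part of degree `k` of the component `R^i_j` of the connection. -/
def actionR (Ω : Matrix (Fin N) (Fin N) ℂ) (φ : (Fin N → ℂ) → Fin N → MvPowerSeries (Fin N) ℂ)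
    (x : Fin N → ℂ) : Functional N S := fun X =>
  integral (∑ j, ∑ i, ∑ l,
    Ω i l • (evalField (hamNormalize (connHol φ x j i)) X * X l * constForm (dx j)))

/-- `S_R̄ = ∫ R̂^i_j̄(x; X) Ω_{il} X^l dx̄^j`, with the same normalization. -/
def actionRbar (Ω : Matrix (Fin N) (Fin N) ℂ) (φ : (Fin N → ℂ) → Fin N → MvPowerSeries (Fin N) ℂ)
    (x : Fin N → ℂ) : Functional N S := fun X =>
  integral (∑ j, ∑ i, ∑ l,
    Ω i l • (evalField (hamNormalize (connAnti φ x j i)) X * X l * constForm (dxbar j)))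

/-- The formal global action `S̃ = Ŝ + S_R + S_R̄`. -/
def globalAction (Ω : Matrix (Fin N) (Fin N) ℂ)
    (φ : (Fin N → ℂ) → Fin N → MvPowerSeries (Fin N) ℂ) (x : Fin N → ℂ) : Functional N S :=
  actionKin Ω + actionR Ω φ x + actionRbar Ω φ x

end Action

end RozanskyWitten

end

open RozanskyWitten

noncomputable section

namespace RozanskyWitten

variable {N : ℕ}

/-! ### The Grassmann algebra -/

/-! Everything reduces to formal Hamiltonians on the fibre. Write `a` for a holomorphic or
antiholomorphic direction and R_a for the corresponding component of the connection, so that ∂_a φ =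
-(∂φ/∂y) R_a. Differentiating the identity φ^*Ω = Ω along `a` shows that the formal 1-form Ω_{ik}
R_a^i dy^k is closed (`IsFormalExp.conn_closed`). The weights 1/(k+1) in the action are the homotopy
operator of the formal Poincaré lemma (`pderiv_primitive`), so h_a = R̂_a^i Ω_{il} y^l satisfies
∂h_a/∂y^k = Ω_{ik} R_a^i. Thus S_R and S_R̄ are sums of terms (∫ h_a(X)) dx^a, and Taylor expansion
in the nilpotent fields gives their Hamiltonian vector fields R_a dx^a.

Equality of mixed derivatives of φ in x, together with invertibility of ∂φ/∂y, gives flatness of R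
(`IsFormalExp.conn_flat`). Contracting with Ω and integrating in y gives ∂_a h_b - ∂_b h_a = Ω_{ij}
R_a^i R_b^j + c, with c constant in y (`IsFormalExp.connHam_flat`). The constant is harmless: as a
0-form on the source it has zero integral over a 3-manifold (`pot_C`). Multiplying by dx^a dx^b and
integrating gives every bracket among S_R and S_R̄ in the single statement `bvForm_connVF`.

The brackets with the kinetic term are integrals of exact forms: (S_a, Ŝ) integrates d(h_a(X)) dx^a
and (Ŝ, Ŝ) integrates d(Ω_{ij} X^i dX^j). They vanish on a closed source by Stokes
(`integral_deRham`). The same integration by parts, applied to the variation of Ŝ, leaves exactly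
the boundary 1-form when there is a boundary (`bvForm_deRham_eq`).

Three technical layers support this. Forms take values in an infinite-dimensional Grassmann algebra
without topology, so derivatives and integrals are taken coefficientwise; for values in a
finite-dimensional subspace these operations are determined by composition with linear functionals
(`dual_coefwise`). Superfields are nilpotent, uniformly over the compact source
(`IsSuperfield.exists_isNilTuple`), so power series in them are finite sums. Finally, the bracket is
defined by choosing Hamiltonian vector fields; an unlimited supply of odd constants shows that the
choice does not matter (`IsHamiltonian.bvForm_eq`, `bvBracket_eq`). -/

/-- Contraction of a Grassmann element with a linear functional on the generators. -/
def contract (d : Module.Dual ℂ (Gen N →₀ ℂ)) : Grass N →ₗ[ℂ] Grass N :=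
  CliffordAlgebra.contractLeft (Q := (0 : QuadraticForm ℂ (Gen N →₀ ℂ))) d

theorem dtheta_eq_contract (μ : Fin 3) :
    dtheta (N := N) μ = contract (Finsupp.lapply (Sum.inl μ)) := rfl

theorem grass_induction {P : Grass N → Prop} (hc : ∀ r, P (algebraMap ℂ _ r))
    (hadd : ∀ x y, P x → P y → P (x + y))
    (hι : ∀ x m, P x → P (ExteriorAlgebra.ι ℂ m * x)) (a : Grass N) : P a :=
  CliffordAlgebra.left_induction (Q := (0 : QuadraticForm ℂ (Gen N →₀ ℂ))) hc hadd hι a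

theorem parity_ι (v : Gen N →₀ ℂ) :
    parity (ExteriorAlgebra.ι ℂ v) = -ExteriorAlgebra.ι ℂ v := by
  rw [parity, ExteriorAlgebra.map_apply_ι]; simp

theorem contract_ι (d : Module.Dual ℂ (Gen N →₀ ℂ)) (v : Gen N →₀ ℂ) :
    contract d (ExteriorAlgebra.ι ℂ v) = algebraMap ℂ _ (d v) :=
  CliffordAlgebra.contractLeft_ι (0 : QuadraticForm ℂ (Gen N →₀ ℂ)) d v

theorem contract_algebraMap (d : Module.Dual ℂ (Gen N →₀ ℂ)) (r : ℂ) :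
    contract d (algebraMap ℂ (Grass N) r) = 0 :=
  CliffordAlgebra.contractLeft_algebraMap (0 : QuadraticForm ℂ (Gen N →₀ ℂ)) d r

theorem contract_ι_mul (d : Module.Dual ℂ (Gen N →₀ ℂ)) (v : Gen N →₀ ℂ) (b : Grass N) :
    contract d (ExteriorAlgebra.ι ℂ v * b) = d v • b - ExteriorAlgebra.ι ℂ v * contract d b :=
  CliffordAlgebra.contractLeft_ι_mul (Q := (0 : QuadraticForm ℂ (Gen N →₀ ℂ))) d v b

/-- Contractions are left antiderivations. -/
theorem contract_mul (d : Module.Dual ℂ (Gen N →₀ ℂ)) (a b : Grass N) :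
    contract d (a * b) = contract d a * b + parity a * contract d b := by
  induction a using grass_induction with
  | hc r =>
    rw [contract_algebraMap, AlgHom.commutes, ← Algebra.smul_def, ← Algebra.smul_def, map_smul]
    simp
  | hadd x y hx hy => simp only [add_mul, map_add, hx, hy]; abel
  | hι x m hx =>
    rw [mul_assoc, contract_ι_mul, contract_ι_mul, hx, map_mul, parity_ι]
    simp only [sub_mul, smul_mul_assoc, mul_add, neg_mul, mul_assoc]
    abel

theorem parity_contract (d : Module.Dual ℂ (Gen N →₀ ℂ)) (a : Grass N) :
    parity (contract d a) = -contract d (parity a) := by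
  induction a using grass_induction with
  | hc r => simp [contract_algebraMap]
  | hadd x y hx hy => simp only [map_add, hx, hy]; abel
  | hι x m hx =>
    rw [contract_ι_mul, map_sub, map_mul, hx, map_mul, parity_ι, map_smul, neg_mul, neg_mul, map_neg,
      contract_ι_mul]
    simp

theorem contract_contract (d : Module.Dual ℂ (Gen N →₀ ℂ)) (a : Grass N) :
    contract d (contract d a) = 0 :=
  CliffordAlgebra.contractLeft_contractLeft _ _

theorem contract_comm (d d' : Module.Dual ℂ (Gen N →₀ ℂ)) (a : Grass N) :
    contract d (contract d' a) = -contract d' (contract d a) :=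
  CliffordAlgebra.contractLeft_comm _ _ _

/-- The sign rule for a generator, with `parity` carrying the sign so that `b` need not be
homogeneous. -/
theorem ι_mul_eq (v : Gen N →₀ ℂ) (b : Grass N) :
    ExteriorAlgebra.ι ℂ v * b = parity b * ExteriorAlgebra.ι ℂ v := by
  induction b using grass_induction with
  | hc r => rw [AlgHom.commutes, Algebra.commutes]
  | hadd x y hx hy => simp only [map_add, mul_add, add_mul, hx, hy]
  | hι x m hx =>
    have h := ExteriorAlgebra.ι_add_mul_swap (R := ℂ) v m
    rw [map_mul, parity_ι, mul_assoc, ← hx, ← mul_assoc, ← mul_assoc, eq_neg_of_add_eq_zero_left h]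
    simp

theorem IsEven.comm {a : Grass N} (ha : IsEven a) (b : Grass N) : a * b = b * a := by
  induction b using grass_induction with
  | hc r => exact (Algebra.commutes r a).symm
  | hadd x y hx hy => simp only [mul_add, add_mul, hx, hy]
  | hι x m hx =>
    have h := ι_mul_eq m a
    rw [ha] at h
    rw [← mul_assoc, ← h, mul_assoc, hx, mul_assoc]

theorem IsOdd.mul_eq {b : Grass N} (hb : IsOdd b) (a : Grass N) : a * b = b * parity a := by
  induction a using grass_induction with
  | hc r => rw [AlgHom.commutes, Algebra.commutes]
  | hadd x y hx hy => simp only [map_add, mul_add, add_mul, hx, hy]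
  | hι x m hx =>
    have h := ι_mul_eq m b
    rw [hb] at h
    rw [mul_assoc, hx, ← mul_assoc, h, map_mul, parity_ι]
    simp [mul_assoc]

theorem IsOdd.anticomm {a b : Grass N} (ha : IsOdd a) (hb : IsOdd b) : a * b = -(b * a) := by
  rw [hb.mul_eq, ha, mul_neg]

theorem isEven_zero : IsEven (0 : Grass N) := map_zero _

theorem IsEven.add {a b : Grass N} (ha : IsEven a) (hb : IsEven b) : IsEven (a + b) := by
  unfold IsEven at *; rw [map_add, ha, hb]

theorem IsEven.smul {a : Grass N} (c : ℂ) (ha : IsEven a) : IsEven (c • a) := by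
  unfold IsEven at *; rw [map_smul, ha]

theorem IsEven.mul {a b : Grass N} (ha : IsEven a) (hb : IsEven b) : IsEven (a * b) := by
  unfold IsEven at *; rw [map_mul, ha, hb]

theorem IsOdd.add {a b : Grass N} (ha : IsOdd a) (hb : IsOdd b) : IsOdd (a + b) := by
  unfold IsOdd at *; rw [map_add, ha, hb, neg_add]

theorem IsOdd.neg {a : Grass N} (ha : IsOdd a) : IsOdd (-a) := by
  unfold IsOdd at *; rw [map_neg, ha]

theorem IsEven.mul_odd {a b : Grass N} (ha : IsEven a) (hb : IsOdd b) : IsOdd (a * b) := by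
  unfold IsEven IsOdd at *; rw [map_mul, ha, hb, mul_neg]

theorem IsOdd.mul_odd {a b : Grass N} (ha : IsOdd a) (hb : IsOdd b) : IsEven (a * b) := by
  unfold IsEven IsOdd at *; rw [map_mul, ha, hb, neg_mul_neg]

theorem isEven_sum {ι : Type*} (s : Finset ι) (f : ι → Grass N) (h : ∀ i ∈ s, IsEven (f i)) :
    IsEven (∑ i ∈ s, f i) :=
  Finset.sum_induction _ _ (fun _ _ => IsEven.add) isEven_zero h

theorem isOdd_sum {ι : Type*} (s : Finset ι) (f : ι → Grass N) (h : ∀ i ∈ s, IsOdd (f i)) :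
    IsOdd (∑ i ∈ s, f i) :=
  Finset.sum_induction _ _ (fun _ _ => IsOdd.add) (by simp [IsOdd]) h

theorem isOdd_gen (g : Gen N) : IsOdd (gen g) := parity_ι _

theorem isOdd_theta (μ : Fin 3) : IsOdd (theta (N := N) μ) := isOdd_gen _

theorem gen_mul_self (g : Gen N) : gen g * gen g = 0 := ExteriorAlgebra.ι_sq_zero _

theorem gen_anticomm (g h : Gen N) : gen g * gen h = -(gen h * gen g) :=
  (isOdd_gen g).anticomm (isOdd_gen h)

/-- The auxiliary odd constants. -/
def eta (a : ℕ) : Grass N := gen (Sum.inr (Sum.inr (Sum.inr a)))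

/-! #### Grassmann constants -/

theorem isConst_gen (h : Fin N ⊕ (Fin N ⊕ ℕ)) : IsConst (gen (Sum.inr h) : Grass N) := by
  intro μ
  rw [dtheta_eq_contract, gen, contract_ι]
  simp

theorem IsConst.mul {a b : Grass N} (ha : IsConst a) (hb : IsConst b) : IsConst (a * b) := by
  intro μ
  rw [dtheta_eq_contract, contract_mul, ← dtheta_eq_contract, ha, hb]
  simp

theorem dtheta_mul_const (μ : Fin 3) (a : Grass N) {b : Grass N} (hb : IsConst b) :
    dtheta μ (a * b) = dtheta μ a * b := by
  rw [dtheta_eq_contract, contract_mul, ← dtheta_eq_contract, hb, mul_zero, add_zero]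

theorem berezin_mul_const (a : Grass N) {b : Grass N} (hb : IsConst b) :
    berezin (a * b) = berezin a * b := by
  simp only [berezin, dtheta_mul_const _ _ hb]

/-- Three contractions each reverse parity, so Berezin integration in dimension 3 is an odd
operation. This is why integrals of even densities are odd. -/
theorem parity_berezin (a : Grass N) : parity (berezin a) = -berezin (parity a) := by
  simp only [berezin, dtheta_eq_contract, parity_contract, map_neg, neg_neg]

/-- The Berezin integral as a linear map. -/
def berezinL : Grass N →ₗ[ℂ] Grass N := dtheta 2 ∘ₗ dtheta 1 ∘ₗ dtheta 0

theorem berezinL_apply (a : Grass N) : berezinL a = berezin a := rfl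

/-- An element of the Grassmann algebra involves finitely many generators, so all but finitely many
of the auxiliary constants are absent from it. -/
theorem exists_eta_contract_eq_zero (z : Grass N) : ∃ A : ℕ, ∀ a ≥ A,
    contract (Finsupp.lapply (Sum.inr (Sum.inr (Sum.inr a)))) z = 0 := by
  induction z using grass_induction with
  | hc r => exact ⟨0, fun a _ => contract_algebraMap _ _⟩
  | hadd x y hx hy =>
    obtain ⟨A, hA⟩ := hx
    obtain ⟨B, hB⟩ := hy
    refine ⟨max A B, fun a ha => ?_⟩
    rw [map_add, hA a (le_trans (le_max_left _ _) ha), hB a (le_trans (le_max_right _ _) ha),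
      add_zero]
  | hι x m hx =>
    obtain ⟨A, hA⟩ := hx
    -- The indices of auxiliary generators in the support of `m` form a finite set; other generators
    -- are sent to the harmless default 0.
    have hfin : (Set.range fun i : m.support =>
        (match (i : Gen N) with | Sum.inr (Sum.inr (Sum.inr a)) => a | _ => 0)).Finite :=
      Set.finite_range _
    obtain ⟨B, hB⟩ := hfin.bddAbove
    refine ⟨max A (B + 1), fun a ha => ?_⟩
    rw [contract_ι_mul, hA a (le_trans (le_max_left _ _) ha)]
    have : m (Sum.inr (Sum.inr (Sum.inr a))) = 0 := by
      by_contra hne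
      have h := hB ⟨⟨_, Finsupp.mem_support_iff.2 hne⟩, rfl⟩
      have h2 := le_trans (le_max_right A (B + 1)) ha
      dsimp only at h
      omega
    simp [Finsupp.lapply_apply, this]

/-- Contracting η_a z = 0 with the dual of a generator η_a that does not occur in `z` returns `z`
itself. -/
theorem eq_zero_of_eta_mul {z : Grass N} (A : ℕ) (h : ∀ a ≥ A, eta a * z = 0) : z = 0 := by
  obtain ⟨B, hB⟩ := exists_eta_contract_eq_zero z
  have h1 := congrArg (contract (Finsupp.lapply (Sum.inr (Sum.inr (Sum.inr (max A B))))))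
    (h _ (le_max_left A B))
  rw [eta, gen, contract_ι_mul, hB _ (le_max_right A B)] at h1
  simpa using h1

/-- A Grassmann element is determined by its products with nilpotent even constants. -/
theorem eq_of_forall_even_const {y z : Grass N}
    (h : ∀ t : Grass N, IsEven t → IsConst t → t * t = 0 → t * y = t * z) : y = z := by
  rw [← sub_eq_zero]
  -- The test constants are t = η_b η_a: even, of square zero, and free of θ.
  refine eq_zero_of_eta_mul 0 fun a _ => eq_zero_of_eta_mul 0 fun b _ => ?_
  rw [← mul_assoc, mul_sub, sub_eq_zero]
  refine h _ ((isOdd_gen _).mul_odd (isOdd_gen _)) ((isConst_gen _).mul (isConst_gen _)) ?_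
  rw [mul_assoc, ← mul_assoc (eta a), eta, eta, gen_anticomm _ (Sum.inr (Sum.inr (Sum.inr b)))]
  rw [neg_mul, mul_assoc, gen_mul_self]
  simp

/-! #### Nilpotency -/

/-- Links `parity` with the grade involution of the Clifford algebra of the zero form, whose even
part has an induction principle. -/
theorem parity_eq_involute (a : Grass N) :
    parity a = CliffordAlgebra.involute (Q := (0 : QuadraticForm ℂ (Gen N →₀ ℂ))) a := by
  induction a using grass_induction with
  | hc r => rw [AlgHom.commutes]; exact (AlgHom.commutes _ r).symm
  | hadd x y hx hy => rw [map_add, hx, hy]; exact (map_add _ x y).symm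
  | hι x m hx =>
    rw [map_mul, hx, parity_ι]
    erw [map_mul, CliffordAlgebra.involute_ι]

/-- Averaging with `parity` projects onto the even part, and an even element is its own average. -/
theorem IsEven.mem_even {a : Grass N} (ha : IsEven a) :
    a ∈ CliffordAlgebra.evenOdd (0 : QuadraticForm ℂ (Gen N →₀ ℂ)) 0 := by
  have h : ∀ b : Grass N,
      b + parity b ∈ CliffordAlgebra.evenOdd (0 : QuadraticForm ℂ (Gen N →₀ ℂ)) 0 ∧
      b - parity b ∈ CliffordAlgebra.evenOdd (0 : QuadraticForm ℂ (Gen N →₀ ℂ)) 1 := by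
    intro b
    have hb : b ∈ CliffordAlgebra.evenOdd (0 : QuadraticForm ℂ (Gen N →₀ ℂ)) 0 ⊔
        CliffordAlgebra.evenOdd (0 : QuadraticForm ℂ (Gen N →₀ ℂ)) 1 := by
      rw [(CliffordAlgebra.evenOdd_isCompl (0 : QuadraticForm ℂ (Gen N →₀ ℂ))).sup_eq_top]
      trivial
    obtain ⟨x, hx, y, hy, rfl⟩ := Submodule.mem_sup.1 hb
    have hx' : parity (x : Grass N) = x :=
      (parity_eq_involute _).trans (CliffordAlgebra.involute_eq_of_mem_even hx)
    have hy' : parity (y : Grass N) = -y :=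
      (parity_eq_involute _).trans (CliffordAlgebra.involute_eq_of_mem_odd hy)
    have h1 : parity ((x : Grass N) + (y : Grass N)) = x - y := by
      rw [map_add, hx', hy', sub_eq_add_neg]
    constructor
    · have : (x : Grass N) + y + parity ((x : Grass N) + y) = (2 : ℂ) • x := by
        rw [h1, two_smul]; abel
      exact this ▸ Submodule.smul_mem _ _ hx
    · have : (x : Grass N) + y - parity ((x : Grass N) + y) = (2 : ℂ) • y := by
        rw [h1, two_smul]; abel
      exact this ▸ Submodule.smul_mem _ _ hy
  have h2 := (h a).1
  rw [show parity a = a from ha, ← two_smul ℂ a] at h2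
  have h3 := Submodule.smul_mem _ (2 : ℂ)⁻¹ h2
  rwa [smul_smul, inv_mul_cancel₀ two_ne_zero, one_smul] at h3

/-- By induction over the even subalgebra, an even element minus its scalar part is nilpotent: a
product of two generators has square zero, and even elements commute, so nilpotency survives sums
and products. -/
theorem IsEven.isNilpotent {a : Grass N} (ha : IsEven a)
    (h0 : ExteriorAlgebra.algebraMapInv a = 0) : IsNilpotent a := by
  have key : ∀ x, ∀ hx : x ∈ CliffordAlgebra.evenOdd (0 : QuadraticForm ℂ (Gen N →₀ ℂ)) 0,
      IsEven (x : Grass N) ∧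
      IsNilpotent ((x : Grass N) - algebraMap ℂ _ (ExteriorAlgebra.algebraMapInv (x : Grass N))) := by
    intro x hx
    induction x, hx using CliffordAlgebra.even_induction with
    | algebraMap r =>
      refine ⟨AlgHom.commutes _ _, ?_⟩
      have : algebraMap ℂ (Grass N) r -
          algebraMap ℂ _ (ExteriorAlgebra.algebraMapInv (algebraMap ℂ (Grass N) r)) = 0 := by
        rw [AlgHom.commutes]; simp
      exact this ▸ IsNilpotent.zero
    | add x y hx hy ihx ihy =>
      refine ⟨ihx.1.add ihy.1, ?_⟩
      have hcomm : Commute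
          ((x : Grass N) - algebraMap ℂ _ (ExteriorAlgebra.algebraMapInv (x : Grass N)))
          ((y : Grass N) - algebraMap ℂ _ (ExteriorAlgebra.algebraMapInv (y : Grass N))) := by
        refine Commute.sub_left ?_ (Algebra.commutes _ _)
        exact ihx.1.comm _
      have := hcomm.isNilpotent_add ihx.2 ihy.2
      convert this using 1
      erw [map_add, map_add]
      abel
    | ι_mul_ι_mul m₁ m₂ x hx ih =>
      have he : IsEven (ExteriorAlgebra.ι ℂ m₁ * ExteriorAlgebra.ι ℂ m₂ : Grass N) :=
        IsOdd.mul_odd (parity_ι _) (parity_ι _)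
      refine ⟨he.mul ih.1, ?_⟩
      have hz : ExteriorAlgebra.algebraMapInv
          ((ExteriorAlgebra.ι ℂ m₁ * ExteriorAlgebra.ι ℂ m₂ : Grass N) * x) = 0 := by
        rw [map_mul, map_mul]
        have : ExteriorAlgebra.algebraMapInv (ExteriorAlgebra.ι ℂ m₁ : Grass N) = 0 := by
          simp [ExteriorAlgebra.algebraMapInv]
        rw [this]; simp
      have h1 : IsNilpotent ((ExteriorAlgebra.ι ℂ m₁ * ExteriorAlgebra.ι ℂ m₂ : Grass N) * x) := by
        refine Commute.isNilpotent_mul_right (he.comm _) ⟨2, ?_⟩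
        rw [pow_two, mul_assoc, ← mul_assoc (ExteriorAlgebra.ι ℂ m₂),
          IsOdd.anticomm (parity_ι m₂) (parity_ι m₁), neg_mul, mul_assoc,
          ExteriorAlgebra.ι_sq_zero]
        simp
      have h2 : ((ExteriorAlgebra.ι ℂ m₁ * ExteriorAlgebra.ι ℂ m₂ : Grass N) * x) -
          algebraMap ℂ _ (ExteriorAlgebra.algebraMapInv
          ((ExteriorAlgebra.ι ℂ m₁ * ExteriorAlgebra.ι ℂ m₂ : Grass N) * x)) =
          (ExteriorAlgebra.ι ℂ m₁ * ExteriorAlgebra.ι ℂ m₂ : Grass N) * x := by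
        rw [hz]; simp
      exact h2.symm ▸ h1
  have := (key a ha.mem_even).2
  rwa [h0, map_zero, sub_zero] at this

end RozanskyWitten
end

noncomputable section

namespace RozanskyWitten

variable {N : ℕ}

/-! #### Substitutions of the odd coordinates -/

/-- The action of `substTheta J` on generators. -/
def substGen (J : Matrix (Fin 3) (Fin 3) ℝ) : (Gen N →₀ ℂ) →ₗ[ℂ] (Gen N →₀ ℂ) :=
  Finsupp.linearCombination ℂ (fun g : Gen N =>
    match g with
    | Sum.inl μ => ∑ ν, (J μ ν : ℂ) • Finsupp.single (Sum.inl ν) 1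
    | Sum.inr h => Finsupp.single (Sum.inr h) 1)

theorem substTheta_ι (J : Matrix (Fin 3) (Fin 3) ℝ) (v : Gen N →₀ ℂ) :
    substTheta J (ExteriorAlgebra.ι ℂ v) = ExteriorAlgebra.ι ℂ (substGen J v) :=
  ExteriorAlgebra.map_apply_ι _ _

theorem substGen_inl (J : Matrix (Fin 3) (Fin 3) ℝ) (μ : Fin 3) (c : ℂ) :
    substGen (N := N) J (Finsupp.single (Sum.inl μ) c) =
      c • ∑ ν, (J μ ν : ℂ) • Finsupp.single (Sum.inl ν) 1 := by
  simp [substGen]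

theorem substGen_inr (J : Matrix (Fin 3) (Fin 3) ℝ) (h : Fin N ⊕ (Fin N ⊕ ℕ)) (c : ℂ) :
    substGen (N := N) J (Finsupp.single (Sum.inr h) c) = Finsupp.single (Sum.inr h) c := by
  simp [substGen]

theorem substTheta_theta (J : Matrix (Fin 3) (Fin 3) ℝ) (μ : Fin 3) :
    substTheta J (theta (N := N) μ) = ∑ ν, (J μ ν : ℂ) • theta ν := by
  rw [theta, gen, substTheta_ι, substGen_inl, one_smul, map_sum]
  simp only [map_smul]
  rfl

theorem substTheta_gen_inr (J : Matrix (Fin 3) (Fin 3) ℝ) (h : Fin N ⊕ (Fin N ⊕ ℕ)) :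
    substTheta J (gen (Sum.inr h)) = gen (Sum.inr h) := by
  rw [gen, substTheta_ι, substGen_inr]

/-- The chain rule for odd derivatives under a linear substitution of generators. -/
theorem contract_substTheta (d : Module.Dual ℂ (Gen N →₀ ℂ)) (J : Matrix (Fin 3) (Fin 3) ℝ)
    (a : Grass N) :
    contract d (substTheta J a) = substTheta J (contract (d ∘ₗ substGen J) a) := by
  induction a using grass_induction with
  | hc r => simp [contract_algebraMap]
  | hadd x y hx hy => simp only [map_add, hx, hy]
  | hι x m hx =>
    rw [map_mul, substTheta_ι, contract_ι_mul, hx, contract_ι_mul, map_sub, map_mul, substTheta_ι,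
      map_smul]
    rfl

theorem lapply_comp_substGen (J : Matrix (Fin 3) (Fin 3) ℝ) (μ : Fin 3) :
    (Finsupp.lapply (Sum.inl μ) : Module.Dual ℂ (Gen N →₀ ℂ)) ∘ₗ substGen J =
      ∑ ν, (J ν μ : ℂ) • Finsupp.lapply (Sum.inl ν) := by
  refine Finsupp.lhom_ext fun g c => ?_
  rcases g with ν | h
  · rw [LinearMap.comp_apply, substGen_inl]
    simp [Finsupp.lapply_apply, Finsupp.single_apply, mul_comm]
  · rw [LinearMap.comp_apply, substGen_inr]
    simp [Finsupp.lapply_apply]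

theorem dtheta_substTheta (μ : Fin 3) (J : Matrix (Fin 3) (Fin 3) ℝ) (a : Grass N) :
    dtheta μ (substTheta J a) = ∑ ν, (J ν μ : ℂ) • substTheta J (dtheta ν a) := by
  rw [dtheta_eq_contract, contract_substTheta, lapply_comp_substGen]
  have : contract (N := N) (∑ ν, (J ν μ : ℂ) • Finsupp.lapply (Sum.inl ν)) =
      ∑ ν, (J ν μ : ℂ) • dtheta ν := by
    simp only [contract, map_sum, map_smul, dtheta]
  rw [this, LinearMap.sum_apply, map_sum]
  exact Finset.sum_congr rfl fun ν _ => by rw [LinearMap.smul_apply, map_smul]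

theorem dtheta_dtheta (μ : Fin 3) (a : Grass N) : dtheta μ (dtheta μ a) = 0 :=
  contract_contract _ _

theorem dtheta_comm (μ ν : Fin 3) (a : Grass N) :
    dtheta μ (dtheta ν a) = -dtheta ν (dtheta μ a) :=
  contract_comm _ _ _

/-- `θ^μ ∂/∂θ^μ` is complementary to the substitution `θ^μ ↦ 0`. -/
theorem substTheta_diagonal (μ : Fin 3) (a : Grass N) :
    substTheta (Matrix.diagonal (fun ν => if ν = μ then 0 else 1)) a =
      a - theta μ * dtheta μ a := by
  have hgen : ∀ v : Gen N →₀ ℂ,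
      substGen (Matrix.diagonal (fun ν => if ν = μ then 0 else 1)) v =
        v - v (Sum.inl μ) • Finsupp.single (Sum.inl μ) 1 := by
    intro v
    induction v using Finsupp.induction_linear with
    | zero => simp
    | add f g hf hg => rw [map_add, hf, hg, Finsupp.add_apply, add_smul]; abel
    | single g c =>
      rcases g with ν | h
      · rw [substGen_inl]
        by_cases hν : ν = μ
        · subst hν
          simp [Matrix.diagonal_apply]
        · rw [Finset.sum_eq_single ν (fun x _ hx => by simp [hx.symm])
            (by simp)]
          simp [hν]
      · rw [substGen_inr]; simp
  induction a using grass_induction with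
  | hc r => rw [AlgHom.commutes, dtheta_eq_contract, contract_algebraMap]; simp
  | hadd x y hx hy => simp only [map_add, hx, hy, mul_add]; abel
  | hι x m hx =>
    have h1 : theta μ * (ExteriorAlgebra.ι ℂ m * dtheta μ x) =
        -(ExteriorAlgebra.ι ℂ m * (theta μ * dtheta μ x)) := by
      rw [← mul_assoc, (isOdd_theta μ).anticomm (parity_ι m), neg_mul, mul_assoc]
    have h2 : theta (N := N) μ * theta μ = 0 := gen_mul_self _
    rw [map_mul, hx, substTheta_ι, hgen, map_sub, map_smul, dtheta_eq_contract, contract_ι_mul,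
      ← dtheta_eq_contract, mul_sub (theta μ), h1, sub_mul, mul_sub]
    change _ - _ - (m (Sum.inl μ) • theta μ) * _ = _
    rw [mul_sub, smul_mul_assoc, smul_mul_assoc, ← mul_assoc (theta μ) (theta μ), h2,
      Finsupp.lapply_apply, mul_smul_comm]
    simp only [zero_mul, smul_zero]
    abel

theorem substTheta_substTheta (J K : Matrix (Fin 3) (Fin 3) ℝ) (a : Grass N) :
    substTheta J (substTheta K a) = substTheta (K * J) a := by
  have hgen : ∀ v : Gen N →₀ ℂ, substGen J (substGen K v) = substGen (K * J) v := by
    intro v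
    induction v using Finsupp.induction_linear with
    | zero => simp
    | add f g hf hg => rw [map_add, map_add, map_add, hf, hg]
    | single g c =>
      rcases g with ν | h
      · simp only [substGen_inl, map_smul, map_sum, Matrix.mul_apply, one_smul]
        congr 1
        simp only [Finset.smul_sum, smul_smul]
        rw [Finset.sum_comm]
        simp only [Complex.ofReal_sum, Complex.ofReal_mul, Finset.sum_smul]
      · simp only [substGen_inr]
  induction a using grass_induction with
  | hc r => simp
  | hadd x y hx hy => simp only [map_add, hx, hy]
  | hι x m hx => simp only [map_mul, hx, substTheta_ι, hgen]

/-- By `substTheta_diagonal`, an element killed by every ∂/∂θ^μ is unchanged when any single θ^μ is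
set to zero. Setting all three to zero first makes any further substitution invisible. -/
theorem IsConst.substTheta_eq {a : Grass N} (ha : IsConst a) (J : Matrix (Fin 3) (Fin 3) ℝ) :
    substTheta J a = a := by
  have h : ∀ μ, substTheta (Matrix.diagonal (fun ν => if ν = μ then 0 else 1)) a = a := by
    intro μ
    rw [substTheta_diagonal, ha μ, mul_zero, sub_zero]
  have h0 : ∀ K : Matrix (Fin 3) (Fin 3) ℝ, substTheta K a = substTheta 0 a := by
    intro K
    have hd : ∀ L : Matrix (Fin 3) (Fin 3) ℝ,
        Matrix.diagonal (fun ν : Fin 3 => if ν = 2 then (0 : ℝ) else 1) *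
          (Matrix.diagonal (fun ν : Fin 3 => if ν = 1 then (0 : ℝ) else 1) *
          (Matrix.diagonal (fun ν : Fin 3 => if ν = 0 then (0 : ℝ) else 1) * L)) = 0 := by
      intro L
      ext i j
      simp only [Matrix.diagonal_mul, Matrix.zero_apply]
      fin_cases i <;> simp
    have h3 : substTheta K (substTheta (Matrix.diagonal (fun ν => if ν = 0 then 0 else 1))
          (substTheta (Matrix.diagonal (fun ν => if ν = 1 then 0 else 1))
          (substTheta (Matrix.diagonal (fun ν => if ν = 2 then 0 else 1)) a))) =
          substTheta K a := by rw [h 2, h 1, h 0]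
    rw [← h3, substTheta_substTheta, substTheta_substTheta, substTheta_substTheta, hd]
  rw [h0, ← h0 (Matrix.diagonal (fun ν => if ν = 0 then 0 else 1)), h 0]

theorem isConst_berezin (a : Grass N) : IsConst (berezin a) := by
  intro μ
  fin_cases μ
  · change dtheta 0 (dtheta 2 (dtheta 1 (dtheta 0 a))) = 0
    rw [dtheta_comm 0 2, dtheta_comm 0 1, dtheta_dtheta]; simp
  · change dtheta 1 (dtheta 2 (dtheta 1 (dtheta 0 a))) = 0
    rw [dtheta_comm 1 2, dtheta_dtheta]; simp
  · exact dtheta_dtheta _ _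

/-- Expanding the three odd derivatives by the chain rule and putting them in normal order produces
the signed sum over permutations, that is, the determinant. The result no longer contains θ, so the
remaining substitution acts trivially on it. -/
theorem berezin_substTheta (J : Matrix (Fin 3) (Fin 3) ℝ) (a : Grass N) :
    berezin (substTheta J a) = (J.det : ℂ) • berezin a := by
  have h : berezin (substTheta J a) = (J.det : ℂ) • substTheta J (berezin a) := by
    have c1 : ∀ b : Grass N, dtheta 0 (dtheta 1 b) = -dtheta 1 (dtheta 0 b) := dtheta_comm 0 1
    have c2 : ∀ b : Grass N, dtheta 0 (dtheta 2 b) = -dtheta 2 (dtheta 0 b) := dtheta_comm 0 2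
    have c3 : ∀ b : Grass N, dtheta 1 (dtheta 2 b) = -dtheta 2 (dtheta 1 b) := dtheta_comm 1 2
    simp only [berezin, dtheta_substTheta, map_smul, Fin.sum_univ_three, smul_add,
      map_add, dtheta_dtheta, c1, c2, c3, map_neg, map_zero, smul_zero, add_zero, zero_add,
      smul_neg, smul_smul, neg_neg, neg_zero]
    rw [Matrix.det_fin_three]
    push_cast
    module
  rw [h, (isConst_berezin a).substTheta_eq]

/-- This fixes the boundary orientation: removing θ^0 from the front leaves the boundary integral
with the conormal direction placed first. -/
theorem berezin_theta_zero_mul (a : Grass N) :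
    berezin (theta 0 * a) = berezinBoundary (killNormal a) := by
  rw [berezin, berezinBoundary, killNormal, substTheta_diagonal, dtheta_eq_contract 0,
    contract_mul, ← dtheta_eq_contract, isOdd_theta]
  congr 2
  rw [theta, gen, dtheta_eq_contract, contract_ι]
  simp [sub_eq_add_neg]

end RozanskyWitten
end

noncomputable section

namespace RozanskyWitten

open Filter Topology

/-! ### Functions with values in finite-dimensional subspaces -/

section Coefwise

variable {α W W₁ W₂ W₃ : Type*} [AddCommGroup W] [Module ℂ W] [AddCommGroup W₁] [Module ℂ W₁]
  [AddCommGroup W₂] [Module ℂ W₂] [AddCommGroup W₃] [Module ℂ W₃]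

/-- A finitely generated subspace meets only finitely many basis directions, so the finite sums in
`coefwise` are uniform over the values of a function. -/
theorem exists_finset_repr_eq_zero {V : Submodule ℂ W} (hV : V.FG) :
    ∃ F : Finset (Module.Basis.ofVectorSpaceIndex ℂ W), ∀ w ∈ V, ∀ β ∉ F,
      (Module.Basis.ofVectorSpace ℂ W).repr w β = 0 := by
  classical
  obtain ⟨S, rfl⟩ := hV
  refine ⟨S.biUnion fun w => ((Module.Basis.ofVectorSpace ℂ W).repr w).support, ?_⟩
  intro w hw β hβ
  induction hw using Submodule.span_induction with
  | mem x hx =>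
    by_contra h
    exact hβ (Finset.mem_biUnion.2 ⟨x, hx, Finsupp.mem_support_iff.2 h⟩)
  | zero => simp
  | add x y _ _ hx hy => simp [hx, hy]
  | smul c x _ hx => simp [hx]

theorem eq_sum_coord {F : Finset (Module.Basis.ofVectorSpaceIndex ℂ W)} {w : W}
    (h : ∀ β ∉ F, (Module.Basis.ofVectorSpace ℂ W).repr w β = 0) :
    w = ∑ β ∈ F, (Module.Basis.ofVectorSpace ℂ W).coord β w •
      Module.Basis.ofVectorSpace ℂ W β := by
  conv_lhs => rw [← (Module.Basis.ofVectorSpace ℂ W).linearCombination_repr w,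
    Finsupp.linearCombination_apply]
  refine Finsupp.sum_of_support_subset _ (fun β hβ => ?_) _ (by simp)
  by_contra hn
  exact Finsupp.mem_support_iff.1 hβ (h β hn)

theorem eq_of_forall_dual {w w' : W} (h : ∀ ℓ : Module.Dual ℂ W, ℓ w = ℓ w') : w = w' := by
  refine (Module.Basis.ofVectorSpace ℂ W).ext_elem fun β => ?_
  exact h ((Module.Basis.ofVectorSpace ℂ W).coord β)

/-- Coefficientwise operations are characterized by their composition with linear functionals. -/
theorem dual_coefwise {s : Set α} {f : α → W} {V : Submodule ℂ W} (hV : V.FG)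
    (hf : ∀ a ∈ s, f a ∈ V) {L : (α → ℂ) → ℂ} (hL : ∀ g g', EqOn g g' s → L g = L g')
    (Λ : Module.Dual ℂ W →ₗ[ℂ] ℂ) (hΛ : ∀ ℓ : Module.Dual ℂ W, L (fun a => ℓ (f a)) = Λ ℓ)
    (ℓ : Module.Dual ℂ W) : ℓ (coefwise L f) = L (fun a => ℓ (f a)) := by
  obtain ⟨F, hF⟩ := exists_finset_repr_eq_zero hV
  -- The operation sees a functional only through its values on the range of `f`. This gives
  -- independence of the basis.
  have h0 : ∀ ℓ : Module.Dual ℂ W, (∀ a ∈ s, ℓ (f a) = 0) → Λ ℓ = 0 := by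
    intro ℓ h
    rw [← hΛ, ← map_zero Λ, ← hΛ]
    exact hL _ _ fun a ha => h a ha
  have h1 : coefwise L f = ∑ β ∈ F, Λ ((Module.Basis.ofVectorSpace ℂ W).coord β) •
      Module.Basis.ofVectorSpace ℂ W β := by
    rw [coefwise, finsum_eq_sum_of_support_subset (s := F)]
    · exact Finset.sum_congr rfl fun β _ => by rw [← hΛ]; rfl
    · intro β hβ
      by_contra hn
      apply hβ
      have : L (fun a => (Module.Basis.ofVectorSpace ℂ W).repr (f a) β) = 0 := by
        rw [← h0 ((Module.Basis.ofVectorSpace ℂ W).coord β) fun a ha => hF _ (hf a ha) β hn, ← hΛ]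
        rfl
      simp only [this, zero_smul]
  have h2 : Λ ℓ = Λ (∑ β ∈ F, ℓ (Module.Basis.ofVectorSpace ℂ W β) •
      (Module.Basis.ofVectorSpace ℂ W).coord β) := by
    rw [← sub_eq_zero, ← map_sub]
    refine h0 _ fun a ha => ?_
    rw [LinearMap.sub_apply, sub_eq_zero]
    conv_lhs => rw [eq_sum_coord (hF _ (hf a ha))]
    simp [mul_comm]
  rw [h1, hΛ, h2]
  simp [mul_comm]

/-- If the result left `V`, a linear functional vanishing on `V` would detect it, yet on that
functional the operation is applied to a function vanishing on `s`. -/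
theorem coefwise_mem {s : Set α} {f : α → W} {V : Submodule ℂ W} (hV : V.FG)
    (hf : ∀ a ∈ s, f a ∈ V) {L : (α → ℂ) → ℂ} (hL : ∀ g g', EqOn g g' s → L g = L g')
    (Λ : Module.Dual ℂ W →ₗ[ℂ] ℂ) (hΛ : ∀ ℓ : Module.Dual ℂ W, L (fun a => ℓ (f a)) = Λ ℓ) :
    coefwise L f ∈ V := by
  by_contra hn
  obtain ⟨ℓ, h1, h2⟩ := Submodule.exists_le_ker_of_notMem hn
  apply h1
  rw [dual_coefwise hV hf hL Λ hΛ, ← map_zero Λ, ← hΛ]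
  exact hL _ _ fun a ha => h2 (hf a ha)

/-! #### Directional derivatives -/

variable {E : Type*} [NormedAddCommGroup E] [NormedSpace ℝ E]

/-- Differentiability of a function with values in a finite-dimensional subspace. -/
structure GDiff (R : Set E) (F : E → W) (u : E) : Prop where
  fd : ∃ V : Submodule ℂ W, V.FG ∧ ∀ᶠ x in 𝓝[R] u, F x ∈ V
  diff : ∀ ℓ : Module.Dual ℂ W, DifferentiableWithinAt ℝ (fun x => ℓ (F x)) R u

/-- The coefficientwise directional derivative. -/
def pd (R : Set E) (v : E) (F : E → W) (u : E) : W :=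
  coefwise (fun g : E → ℂ => fderivWithin ℝ g R u v) F

variable {R : Set E} {u v : E}

theorem GDiff.pd_spec (hu : u ∈ R) (hR : UniqueDiffWithinAt ℝ R u) {F : E → W}
    (hF : GDiff R F u) {V : Submodule ℂ W} (hV : V.FG) (hFV : ∀ᶠ x in 𝓝[R] u, F x ∈ V) :
    pd R v F u ∈ V ∧
    ∀ ℓ : Module.Dual ℂ W, ℓ (pd R v F u) = fderivWithin ℝ (fun x => ℓ (F x)) R u v := by
  have hL : ∀ g g' : E → ℂ, EqOn g g' {x | F x ∈ V} →
      fderivWithin ℝ g R u v = fderivWithin ℝ g' R u v := by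
    intro g g' h
    have hev : g =ᶠ[𝓝[R] u] g' := hFV.mono fun x hx => h hx
    rw [hev.fderivWithin_eq (h (hFV.self_of_nhdsWithin hu))]
  let Λ : Module.Dual ℂ W →ₗ[ℂ] ℂ :=
    { toFun := fun ℓ => fderivWithin ℝ (fun x => ℓ (F x)) R u v
      map_add' := fun ℓ ℓ' => by
        have := fderivWithin_fun_add hR (hF.diff ℓ) (hF.diff ℓ')
        simp only [LinearMap.add_apply]
        rw [this]; rfl
      map_smul' := fun c ℓ => by
        have := fderivWithin_fun_const_smul hR (hF.diff ℓ) c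
        simp only [LinearMap.smul_apply, RingHom.id_apply]
        rw [this]; rfl }
  exact ⟨coefwise_mem hV (s := {x | F x ∈ V}) (fun _ h => h) hL Λ fun _ => rfl,
    dual_coefwise hV (s := {x | F x ∈ V}) (fun _ h => h) hL Λ fun _ => rfl⟩

theorem GDiff.dual_pd (hu : u ∈ R) (hR : UniqueDiffWithinAt ℝ R u) {F : E → W}
    (hF : GDiff R F u) (ℓ : Module.Dual ℂ W) :
    ℓ (pd R v F u) = fderivWithin ℝ (fun x => ℓ (F x)) R u v := by
  obtain ⟨V, hV, hFV⟩ := hF.fd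
  exact (hF.pd_spec hu hR hV hFV).2 ℓ

theorem GDiff.add {F G : E → W} (hF : GDiff R F u) (hG : GDiff R G u) :
    GDiff R (fun x => F x + G x) u := by
  obtain ⟨V, hV, hFV⟩ := hF.fd
  obtain ⟨V', hV', hGV⟩ := hG.fd
  refine ⟨⟨V ⊔ V', hV.sup hV', ?_⟩, fun ℓ => ?_⟩
  · filter_upwards [hFV, hGV] with x h1 h2
    exact Submodule.add_mem_sup h1 h2
  · simp only [map_add]
    exact (hF.diff ℓ).fun_add (hG.diff ℓ)

theorem pd_add (hu : u ∈ R) (hR : UniqueDiffWithinAt ℝ R u) {F G : E → W} (hF : GDiff R F u)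
    (hG : GDiff R G u) : pd R v (fun x => F x + G x) u = pd R v F u + pd R v G u := by
  refine eq_of_forall_dual fun ℓ => ?_
  rw [(hF.add hG).dual_pd hu hR, map_add, hF.dual_pd hu hR, hG.dual_pd hu hR]
  simp only [map_add]
  rw [fderivWithin_fun_add hR (hF.diff ℓ) (hG.diff ℓ)]
  rfl

theorem GDiff.map {F : E → W₁} (hF : GDiff R F u) (T : W₁ →ₗ[ℂ] W₂) :
    GDiff R (fun x => T (F x)) u := by
  obtain ⟨V, hV, hFV⟩ := hF.fd
  refine ⟨⟨V.map T, hV.map T, hFV.mono fun x hx => Submodule.mem_map_of_mem hx⟩, fun ℓ => ?_⟩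
  exact hF.diff (ℓ ∘ₗ T)

theorem pd_map (hu : u ∈ R) (hR : UniqueDiffWithinAt ℝ R u) {F : E → W₁} (hF : GDiff R F u)
    (T : W₁ →ₗ[ℂ] W₂) : pd R v (fun x => T (F x)) u = T (pd R v F u) := by
  refine eq_of_forall_dual fun ℓ => ?_
  rw [(hF.map T).dual_pd hu hR]
  exact (hF.dual_pd hu hR (ℓ ∘ₗ T)).symm

theorem gdiff_const (w : W) : GDiff R (fun _ => w) u :=
  ⟨⟨Submodule.span ℂ {w}, Submodule.fg_span (finite_singleton w),
    Eventually.of_forall fun _ => Submodule.mem_span_singleton_self w⟩,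
    fun _ => differentiableWithinAt_const _⟩

theorem pd_const (hu : u ∈ R) (hR : UniqueDiffWithinAt ℝ R u) (w : W) :
    pd R v (fun _ => w) u = 0 := by
  refine eq_of_forall_dual fun ℓ => ?_
  rw [(gdiff_const w).dual_pd hu hR, fderivWithin_fun_const]
  simp

theorem gdiff_scalar {a : E → ℂ} (ha : DifferentiableWithinAt ℝ a R u) : GDiff R a u :=
  ⟨⟨⊤, Module.Finite.fg_top, Eventually.of_forall fun _ => trivial⟩, fun ℓ => by
    have : (fun x => ℓ (a x)) = fun x => a x * ℓ 1 := by
      ext x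
      rw [← smul_eq_mul, ← map_smul, smul_eq_mul, mul_one]
    rw [this]
    exact ha.mul_const _⟩

theorem pd_scalar (hu : u ∈ R) (hR : UniqueDiffWithinAt ℝ R u) {a : E → ℂ}
    (ha : DifferentiableWithinAt ℝ a R u) : pd R v a u = fderivWithin ℝ a R u v :=
  (gdiff_scalar ha).dual_pd hu hR LinearMap.id

theorem GDiff.congr {F G : E → W} (hu : u ∈ R) (hF : GDiff R F u) (h : F =ᶠ[𝓝[R] u] G) :
    GDiff R G u := by
  obtain ⟨V, hV, hFV⟩ := hF.fd
  refine ⟨⟨V, hV, ?_⟩, fun ℓ => ?_⟩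
  · filter_upwards [hFV, h] with x h1 h2
    exact h2 ▸ h1
  · refine (hF.diff ℓ).congr_of_eventuallyEq (h.mono fun x hx => ?_) ?_
    · simp only [hx]
    · simp only [h.self_of_nhdsWithin hu]

theorem pd_congr {F G : E → W} (hu : u ∈ R) (h : F =ᶠ[𝓝[R] u] G) : pd R v F u = pd R v G u := by
  unfold pd coefwise
  refine finsum_congr fun β => ?_
  congr 1
  have : (fun a => (Module.Basis.ofVectorSpace ℂ W).repr (F a) β) =ᶠ[𝓝[R] u]
      (fun a => (Module.Basis.ofVectorSpace ℂ W).repr (G a) β) :=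
    h.mono fun x hx => by simp only [hx]
  dsimp only
  rw [this.fderivWithin_eq (by simp only [h.self_of_nhdsWithin hu])]

/-- Near `u` both functions lie in finite-dimensional subspaces, so the pairing is a finite sum of
products of scalar coordinate functions and the ordinary product rule applies. -/
theorem gdiff_bilin_aux (hu : u ∈ R) (hR : UniqueDiffWithinAt ℝ R u) {F : E → W₁} {G : E → W₂}
    (hF : GDiff R F u) (hG : GDiff R G u) (B : W₁ →ₗ[ℂ] W₂ →ₗ[ℂ] W₃) (ℓ : Module.Dual ℂ W₃) :
    DifferentiableWithinAt ℝ (fun x => ℓ (B (F x) (G x))) R u ∧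
    fderivWithin ℝ (fun x => ℓ (B (F x) (G x))) R u v =
      ℓ (B (pd R v F u) (G u) + B (F u) (pd R v G u)) := by
  obtain ⟨V, hV, hFV⟩ := hF.fd
  obtain ⟨V', hV', hGV⟩ := hG.fd
  obtain ⟨S, hS⟩ := exists_finset_repr_eq_zero hV
  obtain ⟨S', hS'⟩ := exists_finset_repr_eq_zero hV'
  set b := Module.Basis.ofVectorSpace ℂ W₁
  set b' := Module.Basis.ofVectorSpace ℂ W₂
  have hexp : ∀ w ∈ V, ∀ w' ∈ V', ℓ (B w w') =
      ∑ β ∈ S, ∑ γ ∈ S', b.coord β w * b'.coord γ w' * ℓ (B (b β) (b' γ)) := by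
    intro w hw w' hw'
    conv_lhs => rw [eq_sum_coord (hS w hw), eq_sum_coord (hS' w' hw')]
    simp only [map_sum, map_smul, LinearMap.sum_apply, LinearMap.smul_apply, smul_eq_mul,
      Finset.mul_sum]
    rw [Finset.sum_comm]
    exact Finset.sum_congr rfl fun β _ => Finset.sum_congr rfl fun γ _ => by ring
  have hev : (fun x => ℓ (B (F x) (G x))) =ᶠ[𝓝[R] u] fun x =>
      ∑ β ∈ S, ∑ γ ∈ S', b.coord β (F x) * b'.coord γ (G x) * ℓ (B (b β) (b' γ)) := by
    filter_upwards [hFV, hGV] with x h1 h2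
    exact hexp _ h1 _ h2
  have hd : ∀ β γ, HasFDerivWithinAt
      (fun x => b.coord β (F x) * b'.coord γ (G x) * ℓ (B (b β) (b' γ)))
      (ℓ (B (b β) (b' γ)) • (b.coord β (F u) • fderivWithin ℝ (fun x => b'.coord γ (G x)) R u
        + b'.coord γ (G u) • fderivWithin ℝ (fun x => b.coord β (F x)) R u)) R u := fun β γ =>
    ((hF.diff (b.coord β)).hasFDerivWithinAt.mul
      (hG.diff (b'.coord γ)).hasFDerivWithinAt).mul_const _
  have hsum := HasFDerivWithinAt.fun_sum (u := S) fun β _ =>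
    HasFDerivWithinAt.fun_sum (u := S') fun γ _ => hd β γ
  have hmain := hsum.congr_of_eventuallyEq hev (hev.self_of_nhdsWithin hu)
  refine ⟨hmain.differentiableWithinAt, ?_⟩
  have hFu := hF.pd_spec (v := v) hu hR hV hFV
  have hGu := hG.pd_spec (v := v) hu hR hV' hGV
  rw [hmain.fderivWithin hR, map_add, hexp _ hFu.1 _ (hGV.self_of_nhdsWithin hu),
    hexp _ (hFV.self_of_nhdsWithin hu) _ hGu.1, ← Finset.sum_add_distrib]
  simp only [sum_apply]
  refine Finset.sum_congr rfl fun β _ => ?_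
  rw [← Finset.sum_add_distrib]
  refine Finset.sum_congr rfl fun γ _ => ?_
  rw [hFu.2, hGu.2]
  simp only [smul_apply, add_apply, smul_eq_mul]
  ring

theorem GDiff.bilin (hu : u ∈ R) (hR : UniqueDiffWithinAt ℝ R u) {F : E → W₁} {G : E → W₂}
    (hF : GDiff R F u) (hG : GDiff R G u) (B : W₁ →ₗ[ℂ] W₂ →ₗ[ℂ] W₃) :
    GDiff R (fun x => B (F x) (G x)) u := by
  obtain ⟨V, hV, hFV⟩ := hF.fd
  obtain ⟨V', hV', hGV⟩ := hG.fd
  refine ⟨⟨Submodule.map₂ B V V', hV.map₂ B hV', ?_⟩,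
    fun ℓ => (gdiff_bilin_aux (v := 0) hu hR hF hG B ℓ).1⟩
  filter_upwards [hFV, hGV] with x h1 h2
  exact Submodule.apply_mem_map₂ B h1 h2

theorem pd_bilin (hu : u ∈ R) (hR : UniqueDiffWithinAt ℝ R u) {F : E → W₁} {G : E → W₂}
    (hF : GDiff R F u) (hG : GDiff R G u) (B : W₁ →ₗ[ℂ] W₂ →ₗ[ℂ] W₃) :
    pd R v (fun x => B (F x) (G x)) u = B (pd R v F u) (G u) + B (F u) (pd R v G u) := by
  refine eq_of_forall_dual fun ℓ => ?_
  rw [(hF.bilin hu hR hG B).dual_pd hu hR]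
  exact (gdiff_bilin_aux hu hR hF hG B ℓ).2

/-! #### Smooth functions -/

/-- Smooth functions with values in a finite-dimensional subspace. -/
structure GSmooth (s : Set E) (F : E → W) : Prop where
  fd : ∃ V : Submodule ℂ W, V.FG ∧ ∀ x ∈ s, F x ∈ V
  smooth : ∀ ℓ : Module.Dual ℂ W, ContDiffOn ℝ ∞ (fun x => ℓ (F x)) s

variable {s : Set E}

/-- Passes between the basis-free description by linear functionals, convenient for derivatives, and
the finite expansion with smooth coefficients used to define smooth forms. -/
theorem gsmooth_iff (F : E → W) : GSmooth s F ↔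
    ∃ (B : Finset W) (a : W → E → ℂ), (∀ b ∈ B, ContDiffOn ℝ ∞ (a b) s) ∧
      ∀ x ∈ s, F x = ∑ b ∈ B, a b x • b := by
  classical
  constructor
  · rintro ⟨⟨V, hV, hFV⟩, hs⟩
    obtain ⟨S, hS⟩ := exists_finset_repr_eq_zero hV
    set b := Module.Basis.ofVectorSpace ℂ W with hb
    refine ⟨S.map ⟨b, b.injective⟩, fun w x => ∑ β ∈ S, if b β = w then b.coord β (F x) else 0,
      fun w _ => ?_, fun x hx => ?_⟩
    · refine ContDiffOn.sum fun β _ => ?_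
      split_ifs
      · exact hs _
      · exact contDiffOn_const
    · rw [Finset.sum_map]
      conv_lhs => rw [eq_sum_coord (hS _ (hFV x hx))]
      refine Finset.sum_congr rfl fun β hβ => ?_
      simp only [Function.Embedding.coeFn_mk, b.injective.eq_iff]
      rw [Finset.sum_ite_eq' S β, if_pos hβ]
  · rintro ⟨B, a, ha, hF⟩
    refine ⟨⟨Submodule.span ℂ (B : Set W), Submodule.fg_span B.finite_toSet, fun x hx => ?_⟩,
      fun ℓ => ?_⟩
    · rw [hF x hx]
      exact Submodule.sum_mem _ fun b hb => Submodule.smul_mem _ _ (Submodule.subset_span hb)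
    · have : ContDiffOn ℝ ∞ (fun x => ∑ b ∈ B, a b x * ℓ b) s :=
        ContDiffOn.sum fun b hb => (ha b hb).mul contDiffOn_const
      refine this.congr fun x hx => ?_
      rw [hF x hx]
      simp

theorem GSmooth.congr {F G : E → W} (hF : GSmooth s F) (h : EqOn F G s) : GSmooth s G := by
  obtain ⟨V, hV, hFV⟩ := hF.fd
  refine ⟨⟨V, hV, fun x hx => h hx ▸ hFV x hx⟩, fun ℓ => ?_⟩
  exact (hF.smooth ℓ).congr fun x hx => by rw [h hx]

theorem GSmooth.add {F G : E → W} (hF : GSmooth s F) (hG : GSmooth s G) :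
    GSmooth s (fun x => F x + G x) := by
  obtain ⟨V, hV, hFV⟩ := hF.fd
  obtain ⟨V', hV', hGV⟩ := hG.fd
  refine ⟨⟨V ⊔ V', hV.sup hV', fun x hx => Submodule.add_mem_sup (hFV x hx) (hGV x hx)⟩,
    fun ℓ => ?_⟩
  simp only [map_add]
  exact (hF.smooth ℓ).add (hG.smooth ℓ)

theorem GSmooth.map {F : E → W₁} (hF : GSmooth s F) (T : W₁ →ₗ[ℂ] W₂) :
    GSmooth s (fun x => T (F x)) := by
  obtain ⟨V, hV, hFV⟩ := hF.fd
  exact ⟨⟨V.map T, hV.map T, fun x hx => Submodule.mem_map_of_mem (hFV x hx)⟩,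
    fun ℓ => hF.smooth (ℓ ∘ₗ T)⟩

theorem gsmooth_const (w : W) : GSmooth s (fun _ => w) :=
  ⟨⟨Submodule.span ℂ {w}, Submodule.fg_span (finite_singleton w),
    fun _ _ => Submodule.mem_span_singleton_self w⟩, fun _ => contDiffOn_const⟩

theorem gsmooth_scalar {a : E → ℂ} (ha : ContDiffOn ℝ ∞ a s) : GSmooth s a :=
  ⟨⟨⊤, Module.Finite.fg_top, fun _ _ => trivial⟩, fun ℓ => by
    have : (fun x => ℓ (a x)) = fun x => a x * ℓ 1 := by
      ext x
      rw [← smul_eq_mul, ← map_smul, smul_eq_mul, mul_one]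
    rw [this]
    exact ha.mul contDiffOn_const⟩

theorem GSmooth.bilin {F : E → W₁} {G : E → W₂} (hF : GSmooth s F) (hG : GSmooth s G)
    (B : W₁ →ₗ[ℂ] W₂ →ₗ[ℂ] W₃) : GSmooth s (fun x => B (F x) (G x)) := by
  obtain ⟨S, a, ha, hF⟩ := (gsmooth_iff F).1 hF
  obtain ⟨S', a', ha', hG⟩ := (gsmooth_iff G).1 hG
  refine ⟨⟨Submodule.map₂ B (Submodule.span ℂ S) (Submodule.span ℂ S'),
    (Submodule.fg_span S.finite_toSet).map₂ B (Submodule.fg_span S'.finite_toSet),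
    fun x hx => ?_⟩, fun ℓ => ?_⟩
  · rw [hF x hx, hG x hx]
    exact Submodule.apply_mem_map₂ B
      (Submodule.sum_mem _ fun b hb => Submodule.smul_mem _ _ (Submodule.subset_span hb))
      (Submodule.sum_mem _ fun b hb => Submodule.smul_mem _ _ (Submodule.subset_span hb))
  · have : ContDiffOn ℝ ∞ (fun x => ∑ b ∈ S, ∑ b' ∈ S', a b x * a' b' x * ℓ (B b b')) s :=
      ContDiffOn.sum fun b hb => ContDiffOn.sum fun b' hb' =>
        ((ha b hb).mul (ha' b' hb')).mul contDiffOn_const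
    refine this.congr fun x hx => ?_
    rw [hF x hx, hG x hx]
    simp only [map_sum, map_smul, LinearMap.sum_apply, LinearMap.smul_apply, smul_eq_mul,
      Finset.mul_sum]
    rw [Finset.sum_comm]
    exact Finset.sum_congr rfl fun β _ => Finset.sum_congr rfl fun γ _ => by ring

theorem GSmooth.gdiff {F : E → W} (hF : GSmooth s F) (hs : s ∈ 𝓝[R] u) (hu : u ∈ R) :
    GDiff R F u := by
  obtain ⟨V, hV, hFV⟩ := hF.fd
  refine ⟨⟨V, hV, Filter.mem_of_superset hs hFV⟩, fun ℓ => ?_⟩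
  have h := ((hF.smooth ℓ).differentiableOn (by simp)) u (mem_of_mem_nhdsWithin hu hs)
  exact h.mono_of_mem_nhdsWithin hs

/-- As `s` is a neighbourhood within `R` of each of its points, derivatives within `R` and within
`s` agree there, and `s` inherits unique differentiability. -/
theorem GSmooth.pd {F : E → W} (hF : GSmooth s F) (hsR : s ⊆ R) (hs : ∀ x ∈ s, s ∈ 𝓝[R] x)
    (hR : UniqueDiffOn ℝ R) (v : E) : GSmooth s (fun x => pd R v F x) := by
  obtain ⟨V, hV, hFV⟩ := hF.fd
  have huniq : UniqueDiffOn ℝ s := fun x hx =>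
    (hR x (hsR hx)).mono_nhds (le_of_eq (nhdsWithin_eq_iff_eventuallyEq.2 ?_))
  · refine ⟨⟨V, hV, fun x hx => ?_⟩, fun ℓ => ?_⟩
    · exact ((hF.gdiff (hs x hx) (hsR hx)).pd_spec (hsR hx) (hR x (hsR hx)) hV
        (Filter.mem_of_superset (hs x hx) hFV)).1
    · have h := ((hF.smooth ℓ).fderivWithin (m := ∞) huniq (by simp)).clm_apply
        (contDiffOn_const (c := v))
      refine h.congr fun x hx => ?_
      rw [(hF.gdiff (hs x hx) (hsR hx)).dual_pd (hsR hx) (hR x (hsR hx))]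
      have hd := ((hF.gdiff (hs x hx) (hsR hx)).diff ℓ)
      rw [(hd.hasFDerivWithinAt.mono hsR).fderivWithin (huniq x hx)]
  · have h1 := hs x hx
    filter_upwards [mem_nhdsWithin_iff_eventually.1 h1] with y hy
    exact propext ⟨fun h => hy h, fun h => hsR h⟩

end Coefwise

end RozanskyWitten
end

noncomputable section

namespace RozanskyWitten

open Filter Topology

variable {N : ℕ}

/-! ### Evaluation of power series at nilpotent central elements -/

/-- The multi-index all of whose entries are `K`. -/
def constIndex (N K : ℕ) : Fin N →₀ ℕ := Finsupp.equivFunOnFinite.symm fun _ => K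

theorem constIndex_apply (K : ℕ) (i : Fin N) : constIndex N K i = K := rfl

/-- The ordered monomial with exponents `n`. -/
def mono {A : Type*} [Ring A] (a : Fin N → A) (n : Fin N →₀ ℕ) : A :=
  (List.ofFn fun i => a i ^ n i).prod

section Ring

variable {A : Type*} [Ring A] [Algebra ℂ A]

/-- Tuples of central elements whose `K`-th powers vanish. -/
structure IsNilTuple (K : ℕ) (a : Fin N → A) : Prop where
  central : ∀ i b, a i * b = b * a i
  pow_eq_zero : ∀ i, a i ^ K = 0

variable {K : ℕ} {a : Fin N → A}

/-- The lift of a tuple of central elements to the center. -/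
def IsNilTuple.lift (ha : IsNilTuple K a) (i : Fin N) : Subalgebra.center ℂ A :=
  ⟨a i, Subalgebra.mem_center_iff.2 fun b => (ha.central i b).symm⟩

theorem IsNilTuple.mono_eq (ha : IsNilTuple K a) (n : Fin N →₀ ℕ) :
    mono a n = ((∏ i, ha.lift i ^ n i : Subalgebra.center ℂ A) : A) := by
  rw [← List.prod_ofFn]
  change _ = (Subalgebra.center ℂ A).val _
  rw [map_list_prod, List.map_ofFn]
  rfl

theorem IsNilTuple.mono_eq_zero (ha : IsNilTuple K a) {n : Fin N →₀ ℕ}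
    (hn : ¬ n ≤ constIndex N K) : mono a n = 0 := by
  rw [ha.mono_eq]
  obtain ⟨i, hi⟩ : ∃ i, K < n i := by
    by_contra h
    push Not at h
    exact hn h
  have : ha.lift i ^ n i = 0 := by
    refine Subtype.ext ?_
    exact pow_eq_zero_of_le hi.le (ha.pow_eq_zero i)
  rw [Finset.prod_eq_zero (Finset.mem_univ i) this]
  rfl

theorem IsNilTuple.evalSeries_eq_sum (ha : IsNilTuple K a) (f : MvPowerSeries (Fin N) ℂ) :
    evalSeries f a =
      ∑ n ∈ Finset.Iic (constIndex N K), MvPowerSeries.coeff n f • mono a n := by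
  rw [evalSeries, finsum_eq_sum_of_support_subset]
  · rfl
  · intro n hn
    rw [Finset.mem_coe, Finset.mem_Iic]
    by_contra h
    apply hn
    have := ha.mono_eq_zero h
    unfold mono at this
    simp only [this, smul_zero]

theorem IsNilTuple.evalSeries_congr (ha : IsNilTuple K a) {f g : MvPowerSeries (Fin N) ℂ}
    (h : ∀ n ≤ constIndex N K, MvPowerSeries.coeff n f = MvPowerSeries.coeff n g) :
    evalSeries f a = evalSeries g a := by
  rw [ha.evalSeries_eq_sum, ha.evalSeries_eq_sum]
  exact Finset.sum_congr rfl fun n hn => by rw [h n (Finset.mem_Iic.1 hn)]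

/-- On polynomials the ordered monomials compute ordinary evaluation in the center, which is a
commutative ring. Algebraic identities are proved there and transferred to series by truncation. -/
theorem IsNilTuple.evalSeries_coe (ha : IsNilTuple K a) (p : MvPolynomial (Fin N) ℂ) :
    evalSeries (p : MvPowerSeries (Fin N) ℂ) a =
      ((MvPolynomial.aeval ha.lift p : Subalgebra.center ℂ A) : A) := by
  rw [evalSeries, finsum_eq_sum_of_support_subset (s := p.support)]
  · rw [MvPolynomial.aeval_def, MvPolynomial.eval₂_eq', AddSubmonoidClass.coe_finsetSum]
    refine Finset.sum_congr rfl fun n _ => ?_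
    rw [MvPolynomial.coeff_coe, ← Algebra.smul_def]
    change _ = _ • ((∏ i, ha.lift i ^ n i : Subalgebra.center ℂ A) : A)
    rw [← ha.mono_eq]
    rfl
  · intro n hn
    rw [Finset.mem_coe, MvPolynomial.mem_support_iff]
    intro h
    apply hn
    simp only [MvPolynomial.coeff_coe, h, zero_smul]

theorem IsNilTuple.evalSeries_trunc (ha : IsNilTuple K a) {K' : ℕ} (hK : K ≤ K')
    (f : MvPowerSeries (Fin N) ℂ) :
    evalSeries (MvPowerSeries.trunc' ℂ (constIndex N K') f : MvPowerSeries (Fin N) ℂ) a =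
      evalSeries f a := by
  refine ha.evalSeries_congr fun n hn => ?_
  rw [MvPolynomial.coeff_coe, MvPowerSeries.coeff_trunc', if_pos]
  exact hn.trans fun i => hK

/-- The product of two truncations differs from the truncation of the product only in multi-indices
beyond the bound, where the monomials vanish. -/
theorem IsNilTuple.evalSeries_mul (ha : IsNilTuple K a) (f g : MvPowerSeries (Fin N) ℂ) :
    evalSeries (f * g) a = evalSeries f a * evalSeries g a := by
  rw [← ha.evalSeries_trunc le_rfl f, ← ha.evalSeries_trunc le_rfl g, ha.evalSeries_coe,
    ha.evalSeries_coe, ← MulMemClass.coe_mul, ← map_mul, ← ha.evalSeries_coe]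
  refine ha.evalSeries_congr fun n hn => ?_
  rw [MvPolynomial.coeff_coe]
  exact (MvPowerSeries.coeff_trunc'_mul_trunc'_eq_coeff_mul _ _ _ hn).symm

theorem IsNilTuple.evalSeries_add (ha : IsNilTuple K a) (f g : MvPowerSeries (Fin N) ℂ) :
    evalSeries (f + g) a = evalSeries f a + evalSeries g a := by
  simp only [ha.evalSeries_eq_sum, map_add, add_smul, Finset.sum_add_distrib]

theorem IsNilTuple.evalSeries_smul (ha : IsNilTuple K a) (c : ℂ) (f : MvPowerSeries (Fin N) ℂ) :
    evalSeries (c • f) a = c • evalSeries f a := by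
  simp only [ha.evalSeries_eq_sum, map_smul, smul_assoc, Finset.smul_sum]

theorem evalSeries_C (a : Fin N → A) (c : ℂ) :
    evalSeries (MvPowerSeries.C c) a = algebraMap ℂ A c := by
  classical
  rw [evalSeries, finsum_eq_single _ 0]
  · simp [Algebra.algebraMap_eq_smul_one]
  · intro n hn
    rw [MvPowerSeries.coeff_C, if_neg hn, zero_smul]

/-- Evaluation at a nilpotent tuple as a linear map. -/
def IsNilTuple.evalL (ha : IsNilTuple K a) : MvPowerSeries (Fin N) ℂ →ₗ[ℂ] A where
  toFun f := evalSeries f a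
  map_add' := ha.evalSeries_add
  map_smul' := ha.evalSeries_smul

theorem IsNilTuple.evalSeries_sum (ha : IsNilTuple K a) {ι : Type*} (s : Finset ι)
    (f : ι → MvPowerSeries (Fin N) ℂ) :
    evalSeries (∑ i ∈ s, f i) a = ∑ i ∈ s, evalSeries (f i) a :=
  map_sum ha.evalL f s

theorem IsNilTuple.evalSeries_X (ha : IsNilTuple K a) (i : Fin N) :
    evalSeries (MvPowerSeries.X i) a = a i := by
  have := ha.evalSeries_coe (MvPolynomial.X i)
  rw [MvPolynomial.coe_X, MvPolynomial.aeval_X] at this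
  exact this

/-- The image tuple need not be central in `B`: only the vanishing of the image monomials is needed
to make the sum finite. -/
theorem IsNilTuple.map {B : Type*} [Ring B] [Algebra ℂ B] (ha : IsNilTuple K a) (T : A →ₐ[ℂ] B)
    (f : MvPowerSeries (Fin N) ℂ) : T (evalSeries f a) = evalSeries f (fun i => T (a i)) := by
  have hm : ∀ n, mono (fun i => T (a i)) n = T (mono a n) := fun n => by
    rw [mono, mono, map_list_prod, List.map_ofFn]
    congr 2
    ext i
    simp
  rw [ha.evalSeries_eq_sum, evalSeries, finsum_eq_sum_of_support_subset
    (s := Finset.Iic (constIndex N K))]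
  · rw [map_sum]
    refine Finset.sum_congr rfl fun n _ => ?_
    rw [map_smul, ← hm]
    rfl
  · intro n hn
    rw [Finset.mem_coe, Finset.mem_Iic]
    by_contra h
    apply hn
    have := hm n
    rw [ha.mono_eq_zero h, map_zero, mono] at this
    simp only [this, smul_zero]

/-- Taylor's formula over dual numbers: in the product step the only second-order term carries t² =
0. -/
theorem aeval_add_mul {Z : Type*} [CommRing Z] [Algebra ℂ Z] (a x : Fin N → Z) (t : Z)
    (ht : t * t = 0) (p : MvPolynomial (Fin N) ℂ) :
    MvPolynomial.aeval (fun i => a i + t * x i) p = MvPolynomial.aeval a p +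
      t * ∑ l, x l * MvPolynomial.aeval a (MvPolynomial.pderiv l p) := by
  induction p using MvPolynomial.induction_on with
  | C c => simp
  | add p q hp hq =>
    simp only [map_add, hp, hq, mul_add, Finset.sum_add_distrib]
    ring
  | mul_X p i hp =>
    simp only [map_mul, hp, MvPolynomial.aeval_X, Derivation.leibniz, MvPolynomial.pderiv_X,
      smul_eq_mul, map_add, mul_add, Finset.sum_add_distrib]
    have h1 : ∑ l, x l * (MvPolynomial.aeval a p *
        MvPolynomial.aeval a (Pi.single (M := fun _ => MvPolynomial (Fin N) ℂ) l 1 i)) =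
        x i * MvPolynomial.aeval a p := by
      rw [Finset.sum_eq_single i]
      · simp
      · intro l _ hl
        rw [Pi.single_eq_of_ne hl.symm]
        simp
      · simp
    have h2 : ∑ l, x l * (a i * MvPolynomial.aeval a (MvPolynomial.pderiv l p)) =
        a i * ∑ l, x l * MvPolynomial.aeval a (MvPolynomial.pderiv l p) := by
      rw [Finset.mul_sum]
      exact Finset.sum_congr rfl fun l _ => by ring
    rw [h1, h2]
    linear_combination x i * (∑ l, x l * MvPolynomial.aeval a (MvPolynomial.pderiv l p)) * ht

/-- Truncation at K + 1 rather than K leaves room for the derivative, whose coefficients up to K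
involve exponents up to K + 1. -/
theorem IsNilTuple.evalSeries_pderiv_trunc (ha : IsNilTuple K a) (f : MvPowerSeries (Fin N) ℂ)
    (l : Fin N) :
    evalSeries (MvPolynomial.pderiv l (MvPowerSeries.trunc' ℂ (constIndex N (K + 1)) f) :
      MvPowerSeries (Fin N) ℂ) a = evalSeries (MvPowerSeries.pderiv ℂ l f) a := by
  refine ha.evalSeries_congr fun n hn => ?_
  rw [← MvPowerSeries.pderiv_coe, MvPowerSeries.coeff_pderiv, MvPowerSeries.coeff_pderiv,
    MvPolynomial.coeff_coe, MvPowerSeries.coeff_trunc', if_pos]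
  intro i
  have h1 := hn i
  rw [constIndex_apply] at h1
  rw [Finsupp.add_apply, Finsupp.single_apply, constIndex_apply]
  split_ifs <;> omega

/-- First order Taylor expansion. -/
theorem IsNilTuple.evalSeries_add_mul (ha : IsNilTuple K a) {x : Fin N → A} {t : A}
    (hx : ∀ i b, x i * b = b * x i) (ht : ∀ b, t * b = b * t) (htt : t * t = 0)
    (f : MvPowerSeries (Fin N) ℂ) :
    evalSeries f (fun i => a i + t * x i) = evalSeries f a +
      t * ∑ l, evalSeries (MvPowerSeries.pderiv ℂ l f) a * x l := by
  -- The exponent K + 1 suffices for the sum: the first summand has K-th power zero, the commuting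
  -- summand t x has square zero, and K + 2 ≤ (K + 1) + 1.
  have hb : IsNilTuple (K + 1) (fun i => a i + t * x i) := by
    refine ⟨fun i b => ?_, fun i => ?_⟩
    · rw [add_mul, mul_add, ha.central, mul_assoc, hx, ← mul_assoc, ht, mul_assoc]
    · have hc : Commute (a i) (t * x i) := ha.central i _
      have h2 : (t * x i) ^ 2 = 0 := by
        rw [pow_two, mul_assoc, ← mul_assoc (x i), hx, mul_assoc, ← mul_assoc, htt, zero_mul]
      exact hc.add_pow_eq_zero_of_add_le_succ_of_pow_eq_zero (ha.pow_eq_zero i) h2 (by omega)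
  set p := MvPowerSeries.trunc' ℂ (constIndex N (K + 1)) f
  rw [← hb.evalSeries_trunc le_rfl f, ← ha.evalSeries_trunc (Nat.le_succ K) f,
    hb.evalSeries_coe]
  simp only [← ha.evalSeries_pderiv_trunc f, ha.evalSeries_coe]
  let x' : Fin N → Subalgebra.center ℂ A := fun i =>
    ⟨x i, Subalgebra.mem_center_iff.2 fun b => (hx i b).symm⟩
  let t' : Subalgebra.center ℂ A := ⟨t, Subalgebra.mem_center_iff.2 fun b => (ht b).symm⟩
  have h := aeval_add_mul ha.lift x' t' (Subtype.ext htt) p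
  have h2 := congrArg (Subalgebra.center ℂ A).val h
  rw [map_add, map_mul, map_sum] at h2
  simp only [map_mul] at h2
  refine h2.trans ?_
  congr 1
  change t * _ = t * _
  congr 1
  exact Finset.sum_congr rfl fun l _ => hx l _

end Ring

/-! #### Evaluation on functions -/

section Functions

variable {E : Type*} [NormedAddCommGroup E] [NormedSpace ℝ E] {R s : Set E} {u v : E} {K : ℕ}
  {X : E → Fin N → Grass N}

/-- The chain rule is proved for polynomials by induction; series then agree with a fixed truncation
on a whole neighbourhood because the nilpotency exponent is the same there. -/
theorem gdiff_evalSeries_coe (hu : u ∈ R) (hR : UniqueDiffWithinAt ℝ R u)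
    (hX : ∀ᶠ x in 𝓝[R] u, IsNilTuple K (X x)) (hd : ∀ i, GDiff R (fun x => X x i) u)
    (p : MvPolynomial (Fin N) ℂ) :
    GDiff R (fun x => evalSeries (p : MvPowerSeries (Fin N) ℂ) (X x)) u ∧
    pd R v (fun x => evalSeries (p : MvPowerSeries (Fin N) ℂ) (X x)) u =
      ∑ l, evalSeries (MvPolynomial.pderiv l p : MvPowerSeries (Fin N) ℂ) (X u) *
        pd R v (fun x => X x l) u := by
  have hXu := hX.self_of_nhdsWithin hu
  induction p using MvPolynomial.induction_on with
  | C c =>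
    simp only [MvPolynomial.coe_C, evalSeries_C]
    refine ⟨gdiff_const _, ?_⟩
    rw [pd_const hu hR, Finset.sum_eq_zero]
    intro l _
    rw [MvPolynomial.pderiv_C, MvPolynomial.coe_zero, hXu.evalSeries_eq_sum]
    simp
  | add p q hp hq =>
    have hev : (fun x => evalSeries (p : MvPowerSeries (Fin N) ℂ) (X x) +
        evalSeries (q : MvPowerSeries (Fin N) ℂ) (X x)) =ᶠ[𝓝[R] u] fun x =>
        evalSeries ((p + q : MvPolynomial (Fin N) ℂ) : MvPowerSeries (Fin N) ℂ) (X x) := by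
      filter_upwards [hX] with x hx
      rw [MvPolynomial.coe_add, hx.evalSeries_add]
    refine ⟨(hp.1.add hq.1).congr hu hev, ?_⟩
    rw [← pd_congr hu hev, pd_add hu hR hp.1 hq.1, hp.2, hq.2, ← Finset.sum_add_distrib]
    refine Finset.sum_congr rfl fun l _ => ?_
    rw [map_add, MvPolynomial.coe_add, hXu.evalSeries_add, add_mul]
  | mul_X p i hp =>
    have hev : (fun x => LinearMap.mul ℂ (Grass N) (evalSeries (p : MvPowerSeries (Fin N) ℂ) (X x))
        (X x i)) =ᶠ[𝓝[R] u] fun x =>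
        evalSeries ((p * MvPolynomial.X i : MvPolynomial (Fin N) ℂ) : MvPowerSeries (Fin N) ℂ)
          (X x) := by
      filter_upwards [hX] with x hx
      rw [MvPolynomial.coe_mul, hx.evalSeries_mul, MvPolynomial.coe_X, hx.evalSeries_X]
      rfl
    refine ⟨(hp.1.bilin hu hR (hd i) _).congr hu hev, ?_⟩
    rw [← pd_congr hu hev, pd_bilin hu hR hp.1 (hd i), hp.2]
    simp only [LinearMap.mul_apply']
    -- The factor X^i is central, so it can be written in front and later moved across the
    -- derivative of the remaining factor.
    have h1 : ∀ l, evalSeries ((MvPolynomial.pderiv l (p * MvPolynomial.X i) :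
        MvPolynomial (Fin N) ℂ) : MvPowerSeries (Fin N) ℂ) (X u) =
        (if l = i then evalSeries (p : MvPowerSeries (Fin N) ℂ) (X u) else 0) +
        X u i * evalSeries ((MvPolynomial.pderiv l p : MvPolynomial (Fin N) ℂ) :
          MvPowerSeries (Fin N) ℂ) (X u) := by
      intro l
      rw [Derivation.leibniz, MvPolynomial.pderiv_X, smul_eq_mul, smul_eq_mul,
        MvPolynomial.coe_add, hXu.evalSeries_add, MvPolynomial.coe_mul, MvPolynomial.coe_mul,
        hXu.evalSeries_mul _ (MvPolynomial.pderiv l p : MvPolynomial (Fin N) ℂ), MvPolynomial.coe_X,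
        hXu.evalSeries_X]
      congr 1
      split_ifs with h
      · subst h; simp
      · rw [Pi.single_eq_of_ne (Ne.symm h), MvPolynomial.coe_zero, mul_zero,
          hXu.evalSeries_eq_sum]
        simp
    simp only [h1, add_mul, Finset.sum_add_distrib, ite_mul, zero_mul, Finset.sum_ite_eq',
      Finset.mem_univ, if_true, Finset.sum_mul]
    rw [add_comm]
    congr 1
    refine Finset.sum_congr rfl fun l _ => ?_
    rw [← hXu.central, mul_assoc]

theorem evalSeries_trunc_eventuallyEq (hX : ∀ᶠ x in 𝓝[R] u, IsNilTuple K (X x))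
    (f : MvPowerSeries (Fin N) ℂ) :
    (fun x => evalSeries (MvPowerSeries.trunc' ℂ (constIndex N (K + 1)) f :
      MvPowerSeries (Fin N) ℂ) (X x)) =ᶠ[𝓝[R] u] fun x => evalSeries f (X x) := by
  filter_upwards [hX] with x hx
  exact hx.evalSeries_trunc (Nat.le_succ K) f

/-- The chain rule for power series in nilpotent functions. -/
theorem pd_evalSeries (hu : u ∈ R) (hR : UniqueDiffWithinAt ℝ R u)
    (hX : ∀ᶠ x in 𝓝[R] u, IsNilTuple K (X x)) (hd : ∀ i, GDiff R (fun x => X x i) u)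
    (f : MvPowerSeries (Fin N) ℂ) :
    pd R v (fun x => evalSeries f (X x)) u =
      ∑ l, evalSeries (MvPowerSeries.pderiv ℂ l f) (X u) * pd R v (fun x => X x l) u := by
  rw [← pd_congr hu (evalSeries_trunc_eventuallyEq hX f),
    (gdiff_evalSeries_coe hu hR hX hd _).2]
  refine Finset.sum_congr rfl fun l _ => ?_
  rw [(hX.self_of_nhdsWithin hu).evalSeries_pderiv_trunc f]

theorem gsmooth_evalSeries (hX : ∀ x ∈ s, IsNilTuple K (X x))
    (hd : ∀ i, GSmooth s (fun x => X x i)) (f : MvPowerSeries (Fin N) ℂ) :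
    GSmooth s (fun x => evalSeries f (X x)) := by
  have hp : ∀ p : MvPolynomial (Fin N) ℂ,
      GSmooth s (fun x => evalSeries (p : MvPowerSeries (Fin N) ℂ) (X x)) := by
    intro p
    induction p using MvPolynomial.induction_on with
    | C c =>
      simp only [MvPolynomial.coe_C, evalSeries_C]
      exact gsmooth_const _
    | add p q hp hq =>
      refine (hp.add hq).congr fun x hx => ?_
      simp only [MvPolynomial.coe_add, (hX x hx).evalSeries_add]
    | mul_X p i hp =>
      refine (hp.bilin (hd i) (LinearMap.mul ℂ (Grass N))).congr fun x hx => ?_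
      simp only [MvPolynomial.coe_mul, (hX x hx).evalSeries_mul, MvPolynomial.coe_X,
        (hX x hx).evalSeries_X]
      rfl
  exact (hp _).congr fun x hx => (hX x hx).evalSeries_trunc le_rfl f

end Functions

theorem IsNilTuple.isEven_evalSeries {K : ℕ} {a : Fin N → Grass N} (ha : IsNilTuple K a)
    (he : ∀ i, IsEven (a i)) (f : MvPowerSeries (Fin N) ℂ) : IsEven (evalSeries f a) := by
  rw [IsEven, ha.map parity f]
  congr 1
  ext i
  exact he i

end RozanskyWitten
end

noncomputable section

namespace RozanskyWitten

open Filter Topology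

variable {N : ℕ}

/-! ### Formal power series: Hamiltonians -/

theorem pderiv_comm (i k : Fin N) (f : MvPowerSeries (Fin N) ℂ) :
    MvPowerSeries.pderiv ℂ i (MvPowerSeries.pderiv ℂ k f) =
      MvPowerSeries.pderiv ℂ k (MvPowerSeries.pderiv ℂ i f) := by
  rcases eq_or_ne i k with rfl | h
  · rfl
  ext n
  simp only [MvPowerSeries.coeff_pderiv, Finsupp.add_apply, Finsupp.single_apply, if_neg h,
    if_neg h.symm, add_zero]
  rw [add_right_comm]
  ring

theorem coeff_hamNormalize (n : Fin N →₀ ℕ) (f : MvPowerSeries (Fin N) ℂ) :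
    MvPowerSeries.coeff n (hamNormalize f) = MvPowerSeries.coeff n f / ((∑ i, n i : ℕ) + 1) :=
  rfl

/-- `hamNormalize` as a linear map. -/
def hamNormalizeL : MvPowerSeries (Fin N) ℂ →ₗ[ℂ] MvPowerSeries (Fin N) ℂ where
  toFun := hamNormalize
  map_add' f g := by
    ext n
    simp only [coeff_hamNormalize, map_add, add_div]
  map_smul' c f := by
    ext n
    simp only [coeff_hamNormalize, map_smul, smul_eq_mul, mul_div_assoc, RingHom.id_apply]

/-- The Euler operator multiplies the part of degree `k` by `k`. -/
theorem coeff_euler (n : Fin N →₀ ℕ) (f : MvPowerSeries (Fin N) ℂ) :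
    MvPowerSeries.coeff n (∑ l, MvPowerSeries.pderiv ℂ l f * MvPowerSeries.X l) =
      (∑ i, n i : ℕ) * MvPowerSeries.coeff n f := by
  classical
  rw [map_sum, Nat.cast_sum, Finset.sum_mul]
  refine Finset.sum_congr rfl fun l _ => ?_
  rw [MvPowerSeries.X, MvPowerSeries.coeff_mul_monomial, mul_one]
  split_ifs with h
  · rw [MvPowerSeries.coeff_pderiv, tsub_add_cancel_of_le h]
    have h1 : 1 ≤ n l := by simpa using h l
    rw [Finsupp.tsub_apply, Finsupp.single_eq_same, Nat.cast_sub h1]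
    push_cast
    ring
  · have : n l = 0 := by
      by_contra h0
      exact h (Finsupp.single_le_iff.2 (Nat.one_le_iff_ne_zero.2 h0))
    rw [this]; simp

theorem sum_add_single (n : Fin N →₀ ℕ) (k : Fin N) :
    ∑ i, (n + Finsupp.single k 1 : Fin N →₀ ℕ) i = (∑ i, n i) + 1 := by
  simp [Finset.sum_add_distrib, Finsupp.single_apply]

/-- The Poincaré lemma for formal 1-forms. -/
theorem pderiv_primitive (f : Fin N → MvPowerSeries (Fin N) ℂ)
    (hf : ∀ k l, MvPowerSeries.pderiv ℂ k (f l) = MvPowerSeries.pderiv ℂ l (f k)) (k : Fin N) :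
    MvPowerSeries.pderiv ℂ k (∑ l, hamNormalize (f l) * MvPowerSeries.X l) = f k := by
  -- All components are rescaled by the same factor in each degree, so closedness survives the
  -- normalization.
  have h1 : ∀ l, MvPowerSeries.pderiv ℂ k (hamNormalize (f l)) =
      MvPowerSeries.pderiv ℂ l (hamNormalize (f k)) := by
    intro l
    ext n
    have := congrArg (MvPowerSeries.coeff n) (hf k l)
    rw [MvPowerSeries.coeff_pderiv, MvPowerSeries.coeff_pderiv] at this
    rw [MvPowerSeries.coeff_pderiv, MvPowerSeries.coeff_pderiv, coeff_hamNormalize,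
      coeff_hamNormalize, sum_add_single, sum_add_single, div_mul_eq_mul_div, this,
      div_mul_eq_mul_div]
  rw [map_sum]
  have h2 : ∀ l, MvPowerSeries.pderiv ℂ k (hamNormalize (f l) * MvPowerSeries.X l) =
      (if l = k then hamNormalize (f k) else 0) +
        MvPowerSeries.pderiv ℂ l (hamNormalize (f k)) * MvPowerSeries.X l := by
    intro l
    rw [Derivation.leibniz, smul_eq_mul, smul_eq_mul, h1, mul_comm (MvPowerSeries.X l)]
    congr 1
    split_ifs with h
    · subst h; simp
    · rw [MvPowerSeries.pderiv_X_of_ne h, mul_zero]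
  -- What remains is the normalized k-th component plus its Euler derivative. In degree m this is
  -- multiplication by m + 1, which cancels the normalization.
  simp only [h2, Finset.sum_add_distrib, Finset.sum_ite_eq', Finset.mem_univ, if_true]
  ext n
  have h0 : ((∑ i, n i : ℕ) : ℂ) + 1 ≠ 0 := Nat.cast_add_one_ne_zero _
  rw [map_add, coeff_euler, coeff_hamNormalize]
  field_simp
  ring

/-! ### Wirtinger derivatives -/

/-- The derivatives `∂/∂x^j` and `∂/∂x̄^j`. -/
def wirt (a : Fin N ⊕ Fin N) (x : Fin N → ℂ) (g : (Fin N → ℂ) → ℂ) : ℂ :=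
  match a with
  | Sum.inl j => partialHol j x g
  | Sum.inr j => partialAnti j x g

/-- Both Wirtinger derivatives have one shape, with c = -i or c = i, so each rule below is proved
once for both types of direction. -/
theorem wirt_eq (a : Fin N ⊕ Fin N) : ∃ (v w : Fin N → ℂ) (c : ℂ), ∀ x g,
    wirt a x g = (1 / 2) * (fderiv ℝ g x v + c * fderiv ℝ g x w) := by
  rcases a with j | j
  · refine ⟨Pi.single j 1, Pi.single j Complex.I, -Complex.I, fun x g => ?_⟩
    rw [wirt, partialHol]; ring
  · exact ⟨Pi.single j 1, Pi.single j Complex.I, Complex.I, fun x g => rfl⟩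

section Wirt

variable (a b : Fin N ⊕ Fin N) {x : Fin N → ℂ} {g h : (Fin N → ℂ) → ℂ}

theorem wirt_add (hg : DifferentiableAt ℝ g x) (hh : DifferentiableAt ℝ h x) :
    wirt a x (fun y => g y + h y) = wirt a x g + wirt a x h := by
  obtain ⟨v, w, c, e⟩ := wirt_eq a
  rw [e, e, e, fderiv_fun_add hg hh]
  simp only [add_apply]
  ring

theorem wirt_const_mul (k : ℂ) (hg : DifferentiableAt ℝ g x) :
    wirt a x (fun y => k * g y) = k * wirt a x g := by
  obtain ⟨v, w, c, e⟩ := wirt_eq a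
  rw [e, e, fderiv_const_mul hg]
  simp only [smul_apply, smul_eq_mul]
  ring

theorem wirt_mul (hg : DifferentiableAt ℝ g x) (hh : DifferentiableAt ℝ h x) :
    wirt a x (fun y => g y * h y) = wirt a x g * h x + g x * wirt a x h := by
  obtain ⟨v, w, c, e⟩ := wirt_eq a
  rw [e, e, e, fderiv_fun_mul hg hh]
  simp only [add_apply, smul_apply, smul_eq_mul]
  ring

theorem wirt_const (k : ℂ) : wirt a x (fun _ => k) = 0 := by
  obtain ⟨v, w, c, e⟩ := wirt_eq a
  rw [e, fderiv_fun_const]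
  simp

theorem wirt_congr (hgh : g =ᶠ[𝓝 x] h) : wirt a x g = wirt a x h := by
  obtain ⟨v, w, c, e⟩ := wirt_eq a
  rw [e, e, hgh.fderiv_eq]

theorem wirt_sum {ι : Type*} (s : Finset ι) (g : ι → (Fin N → ℂ) → ℂ)
    (hg : ∀ i ∈ s, DifferentiableAt ℝ (g i) x) :
    wirt a x (fun y => ∑ i ∈ s, g i y) = ∑ i ∈ s, wirt a x (g i) := by
  classical
  induction s using Finset.induction_on with
  | empty => simp [wirt_const]
  | insert i s hi ih =>
    simp only [Finset.sum_insert hi]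
    rw [wirt_add a (hg i (Finset.mem_insert_self _ _))
      (DifferentiableAt.fun_sum fun j hj => hg j (Finset.mem_insert_of_mem hj)),
      ih fun j hj => hg j (Finset.mem_insert_of_mem hj)]

variable {U : Set (Fin N → ℂ)}

theorem contDiffOn_fderiv_apply (hU : IsOpen U) (hg : ContDiffOn ℝ ∞ g U) (v : Fin N → ℂ) :
    ContDiffOn ℝ ∞ (fun y => fderiv ℝ g y v) U :=
  ((hg.fderiv_of_isOpen hU (m := ∞) (by simp)).clm_apply contDiffOn_const)

theorem contDiffOn_wirt (hU : IsOpen U) (hg : ContDiffOn ℝ ∞ g U) :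
    ContDiffOn ℝ ∞ (fun y => wirt a y g) U := by
  obtain ⟨v, w, c, e⟩ := wirt_eq a
  simp only [e]
  exact contDiffOn_const.mul ((contDiffOn_fderiv_apply hU hg v).add
    (contDiffOn_const.mul (contDiffOn_fderiv_apply hU hg w)))

theorem differentiableAt_of_contDiffOn (hU : IsOpen U) (hx : x ∈ U) (hg : ContDiffOn ℝ ∞ g U) :
    DifferentiableAt ℝ g x :=
  (hg.contDiffAt (hU.mem_nhds hx)).differentiableAt (by simp)

/-- Symmetry of the second real derivative, the source of all commutations of ∂/∂x and ∂/∂x̄. -/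
theorem fderiv_fderiv_comm (hU : IsOpen U) (hx : x ∈ U) (hg : ContDiffOn ℝ ∞ g U)
    (v w : Fin N → ℂ) :
    fderiv ℝ (fun y => fderiv ℝ g y v) x w = fderiv ℝ (fun y => fderiv ℝ g y w) x v := by
  have hs : IsSymmSndFDerivAt ℝ g x :=
    (hg.contDiffAt (hU.mem_nhds hx)).isSymmSndFDerivAt
      (by rw [minSmoothness_of_isRCLikeNormedField]; exact ENat.LEInfty.out)
  have hd : DifferentiableAt ℝ (fderiv ℝ g) x :=
    ((hg.fderiv_of_isOpen hU (m := ∞) (by simp)).contDiffAt (hU.mem_nhds hx)).differentiableAt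
      (by simp)
  have h1 : ∀ v w, fderiv ℝ (fun y => fderiv ℝ g y v) x w = fderiv ℝ (fderiv ℝ g) x w v := by
    intro v w
    rw [fderiv_clm_apply hd (differentiableAt_const v)]
    simp
  rw [h1, h1]
  exact hs w v

theorem wirt_comm (hU : IsOpen U) (hx : x ∈ U) (hg : ContDiffOn ℝ ∞ g U) :
    wirt a x (fun y => wirt b y g) = wirt b x (fun y => wirt a y g) := by
  obtain ⟨v, w, c, e⟩ := wirt_eq a
  obtain ⟨v', w', c', e'⟩ := wirt_eq b
  have hd : ∀ v, DifferentiableAt ℝ (fun y => fderiv ℝ g y v) x := fun v =>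
    differentiableAt_of_contDiffOn hU hx (contDiffOn_fderiv_apply hU hg v)
  have key : ∀ v w c v', fderiv ℝ (fun y => (1 / 2 : ℂ) * (fderiv ℝ g y v + c * fderiv ℝ g y w)) x v'
      = (1 / 2) * (fderiv ℝ (fun y => fderiv ℝ g y v) x v'
        + c * fderiv ℝ (fun y => fderiv ℝ g y w) x v') := by
    intro v w c v'
    rw [fderiv_const_mul ((hd v).fun_add ((hd w).const_mul c)),
      fderiv_fun_add (hd v) ((hd w).const_mul c), fderiv_const_mul (hd w)]
    simp only [smul_apply, add_apply, smul_eq_mul]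
  simp only [e, e', key]
  rw [fderiv_fderiv_comm hU hx hg v v', fderiv_fderiv_comm hU hx hg v w',
    fderiv_fderiv_comm hU hx hg w v', fderiv_fderiv_comm hU hx hg w w']
  ring

end Wirt

/-! ### Smooth families of formal power series -/

/-- The coefficients are smooth on `U`. -/
def SmoothFam (U : Set (Fin N → ℂ)) (F : (Fin N → ℂ) → MvPowerSeries (Fin N) ℂ) : Prop :=
  ∀ n, ContDiffOn ℝ ∞ (fun x => MvPowerSeries.coeff n (F x)) U

section Fam

variable {U : Set (Fin N → ℂ)} {F G : (Fin N → ℂ) → MvPowerSeries (Fin N) ℂ}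

theorem SmoothFam.mul (hF : SmoothFam U F) (hG : SmoothFam U G) :
    SmoothFam U (fun x => F x * G x) := by
  classical
  intro n
  simp only [MvPowerSeries.coeff_mul]
  exact ContDiffOn.sum fun p _ => (hF p.1).mul (hG p.2)

theorem SmoothFam.sum {ι : Type*} (s : Finset ι)
    {F : ι → (Fin N → ℂ) → MvPowerSeries (Fin N) ℂ} (hF : ∀ i ∈ s, SmoothFam U (F i)) :
    SmoothFam U (fun x => ∑ i ∈ s, F i x) := by
  intro n
  simp only [map_sum]
  exact ContDiffOn.sum fun i hi => hF i hi n

theorem SmoothFam.neg (hF : SmoothFam U F) : SmoothFam U (fun x => -F x) := by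
  intro n
  simp only [map_neg]
  exact (hF n).neg

theorem SmoothFam.smul (c : ℂ) (hF : SmoothFam U F) : SmoothFam U (fun x => c • F x) := by
  intro n
  simp only [map_smul, smul_eq_mul]
  exact contDiffOn_const.mul (hF n)

theorem SmoothFam.const (f : MvPowerSeries (Fin N) ℂ) : SmoothFam U (fun _ => f) :=
  fun _ => contDiffOn_const

theorem SmoothFam.pderiv (i : Fin N) (hF : SmoothFam U F) :
    SmoothFam U (fun x => MvPowerSeries.pderiv ℂ i (F x)) := by
  intro n
  simp only [MvPowerSeries.coeff_pderiv]
  exact (hF _).mul contDiffOn_const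

theorem SmoothFam.hamNormalize (hF : SmoothFam U F) :
    SmoothFam U (fun x => hamNormalize (F x)) := by
  intro n
  simp only [coeff_hamNormalize, div_eq_mul_inv]
  exact (hF n).mul contDiffOn_const

/-- The derivative of a family of formal power series with respect to the parameters. -/
def famDeriv (a : Fin N ⊕ Fin N) (F : (Fin N → ℂ) → MvPowerSeries (Fin N) ℂ) (x : Fin N → ℂ) :
    MvPowerSeries (Fin N) ℂ :=
  coefMap (wirt a x) F

variable (a b : Fin N ⊕ Fin N) {x : Fin N → ℂ}

theorem coeff_famDeriv (n : Fin N →₀ ℕ) (F : (Fin N → ℂ) → MvPowerSeries (Fin N) ℂ) :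
    MvPowerSeries.coeff n (famDeriv a F x) = wirt a x (fun y => MvPowerSeries.coeff n (F y)) :=
  rfl

theorem SmoothFam.famDeriv (hU : IsOpen U) (hF : SmoothFam U F) :
    SmoothFam U (fun x => famDeriv a F x) :=
  fun n => contDiffOn_wirt a hU (hF n)

theorem famDeriv_mul (hU : IsOpen U) (hx : x ∈ U) (hF : SmoothFam U F) (hG : SmoothFam U G) :
    famDeriv a (fun y => F y * G y) x = famDeriv a F x * G x + F x * famDeriv a G x := by
  classical
  ext n
  have hd : ∀ n, DifferentiableAt ℝ (fun y => MvPowerSeries.coeff n (F y)) x := fun n =>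
    differentiableAt_of_contDiffOn hU hx (hF n)
  have hd' : ∀ n, DifferentiableAt ℝ (fun y => MvPowerSeries.coeff n (G y)) x := fun n =>
    differentiableAt_of_contDiffOn hU hx (hG n)
  rw [coeff_famDeriv, map_add]
  simp only [MvPowerSeries.coeff_mul]
  rw [wirt_sum a _ _ fun p _ => (hd p.1).fun_mul (hd' p.2), ← Finset.sum_add_distrib]
  refine Finset.sum_congr rfl fun p _ => ?_
  rw [wirt_mul a (hd _) (hd' _)]
  rfl

theorem famDeriv_sum (hU : IsOpen U) (hx : x ∈ U) {ι : Type*} (s : Finset ι)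
    {F : ι → (Fin N → ℂ) → MvPowerSeries (Fin N) ℂ} (hF : ∀ i ∈ s, SmoothFam U (F i)) :
    famDeriv a (fun y => ∑ i ∈ s, F i y) x = ∑ i ∈ s, famDeriv a (F i) x := by
  ext n
  rw [coeff_famDeriv, map_sum]
  simp only [map_sum]
  exact wirt_sum a _ _ fun i hi => differentiableAt_of_contDiffOn hU hx (hF i hi n)

theorem famDeriv_smul (hU : IsOpen U) (hx : x ∈ U) (c : ℂ) (hF : SmoothFam U F) :
    famDeriv a (fun y => c • F y) x = c • famDeriv a F x := by
  ext n
  rw [coeff_famDeriv]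
  simp only [map_smul, smul_eq_mul]
  exact wirt_const_mul a c (differentiableAt_of_contDiffOn hU hx (hF n))

theorem famDeriv_pderiv (hU : IsOpen U) (hx : x ∈ U) (i : Fin N) (hF : SmoothFam U F) :
    famDeriv a (fun y => MvPowerSeries.pderiv ℂ i (F y)) x =
      MvPowerSeries.pderiv ℂ i (famDeriv a F x) := by
  ext n
  rw [coeff_famDeriv, MvPowerSeries.coeff_pderiv, coeff_famDeriv]
  simp only [MvPowerSeries.coeff_pderiv]
  have hd := differentiableAt_of_contDiffOn hU hx (hF (n + Finsupp.single i 1))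
  rw [wirt_mul a hd (differentiableAt_const _), wirt_const]
  ring

theorem famDeriv_const (f : MvPowerSeries (Fin N) ℂ) : famDeriv a (fun _ => f) x = 0 := by
  ext n
  rw [coeff_famDeriv, wirt_const, map_zero]

theorem famDeriv_congr (hU : IsOpen U) (hx : x ∈ U) (h : EqOn F G U) :
    famDeriv a F x = famDeriv a G x := by
  ext n
  rw [coeff_famDeriv, coeff_famDeriv]
  exact wirt_congr a (Filter.mem_of_superset (hU.mem_nhds hx) fun y hy => by
    exact congrArg _ (h hy))

theorem famDeriv_comm (hU : IsOpen U) (hx : x ∈ U) (hF : SmoothFam U F) :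
    famDeriv a (fun y => famDeriv b F y) x = famDeriv b (fun y => famDeriv a F y) x := by
  ext n
  exact wirt_comm a b hU hx (hF n)

/-- Since `A` has constant term the identity, the degree-n coefficient of A B = 1 expresses that
coefficient of `B` through coefficients of `A` and strictly lower ones of `B`. Smoothness follows by
recursion on `n`, over all rows at once because the recursion mixes them. -/
theorem smoothFam_of_mul_eq_one {m : ℕ}
    {A B : (Fin N → ℂ) → Matrix (Fin m) (Fin m) (MvPowerSeries (Fin N) ℂ)}
    (hA : ∀ i j, SmoothFam U (fun x => A x i j))
    (h0 : ∀ x ∈ U, ∀ i j, MvPowerSeries.constantCoeff (A x i j) = if i = j then 1 else 0)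
    (h1 : ∀ x ∈ U, A x * B x = 1) (i j : Fin m) : SmoothFam U (fun x => B x i j) := by
  classical
  intro n
  induction n using WellFoundedLT.induction generalizing i with
  | _ n ih =>
    have hmem : ((0, n) : (Fin N →₀ ℕ) × (Fin N →₀ ℕ)) ∈ Finset.HasAntidiagonal.antidiagonal n :=
      Finset.HasAntidiagonal.mem_antidiagonal.2 (zero_add n)
    have hval : ∀ x ∈ U, MvPowerSeries.coeff n (B x i j) =
        MvPowerSeries.coeff n ((1 : Matrix (Fin m) (Fin m) (MvPowerSeries (Fin N) ℂ)) i j) -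
        ∑ k, ∑ p ∈ (Finset.HasAntidiagonal.antidiagonal n).erase (0, n),
          MvPowerSeries.coeff p.1 (A x i k) * MvPowerSeries.coeff p.2 (B x k j) := by
      intro x hx
      rw [← h1 x hx, Matrix.mul_apply, map_sum, ← Finset.sum_sub_distrib,
        Finset.sum_eq_single i]
      · rw [MvPowerSeries.coeff_mul, ← Finset.add_sum_erase _ _ hmem,
          add_sub_cancel_right]
        simp [h0 x hx]
      · intro k _ hk
        rw [MvPowerSeries.coeff_mul, ← Finset.add_sum_erase _ _ hmem,
          add_sub_cancel_right]
        simp [h0 x hx, hk.symm]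
      · simp
    refine ContDiffOn.congr ?_ hval
    refine contDiffOn_const.sub (ContDiffOn.sum fun k _ => ContDiffOn.sum fun p hp => ?_)
    refine (hA i k p.1).mul (ih p.2 ?_ k)
    rw [Finset.mem_erase, Finset.HasAntidiagonal.mem_antidiagonal] at hp
    refine lt_of_le_of_ne (hp.2 ▸ le_add_self) fun h => hp.1 ?_
    have : p.1 = 0 := by simpa [h] using hp.2
    exact Prod.ext this h

end Fam

end RozanskyWitten
end

noncomputable section

namespace RozanskyWitten

open Filter Topology

variable {N : ℕ}

/-! ### The Grothendieck connection -/

/-- Both types of components of the connection. -/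
def conn (φ : (Fin N → ℂ) → Fin N → MvPowerSeries (Fin N) ℂ) (a : Fin N ⊕ Fin N)
    (x : Fin N → ℂ) (i : Fin N) : MvPowerSeries (Fin N) ℂ :=
  -∑ p, (fibreJac φ x)⁻¹ i p * famDeriv a (fun x' => φ x' p) x

variable {U : Set (Fin N → ℂ)} {φ : (Fin N → ℂ) → Fin N → MvPowerSeries (Fin N) ℂ}
  {Ω : Matrix (Fin N) (Fin N) ℂ} (a b : Fin N ⊕ Fin N) {x : Fin N → ℂ}

theorem IsFormalExp.smoothFam (hφ : IsFormalExp U φ) (p : Fin N) :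
    SmoothFam U (fun x => φ x p) := hφ.smooth p

theorem IsFormalExp.constantCoeff_fibreJac (hφ : IsFormalExp U φ) (hx : x ∈ U) (p i : Fin N) :
    MvPowerSeries.constantCoeff (fibreJac φ x p i) = if p = i then 1 else 0 := by
  rw [fibreJac, Matrix.of_apply, ← MvPowerSeries.coeff_zero_eq_constantCoeff_apply,
    MvPowerSeries.coeff_pderiv, zero_add, hφ.first x hx]
  simp

/-- A power series is a unit as soon as its constant term is; here the constant term of the Jacobian
is the identity matrix because φ = x + y + O(y²). -/
theorem IsFormalExp.isUnit_det (hφ : IsFormalExp U φ) (hx : x ∈ U) :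
    IsUnit (fibreJac φ x).det := by
  rw [MvPowerSeries.isUnit_iff_constantCoeff, RingHom.map_det]
  have : (MvPowerSeries.constantCoeff (σ := Fin N) (R := ℂ)).mapMatrix (fibreJac φ x) = 1 := by
    ext p i
    rw [RingHom.mapMatrix_apply, Matrix.map_apply, hφ.constantCoeff_fibreJac hx, Matrix.one_apply]
  rw [this, Matrix.det_one]
  exact isUnit_one

theorem IsFormalExp.smoothFam_fibreJac (hφ : IsFormalExp U φ) (p i : Fin N) :
    SmoothFam U (fun x => fibreJac φ x p i) :=
  (hφ.smoothFam p).pderiv i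

theorem IsFormalExp.smoothFam_inv (hφ : IsFormalExp U φ) (i p : Fin N) :
    SmoothFam U (fun x => (fibreJac φ x)⁻¹ i p) :=
  smoothFam_of_mul_eq_one hφ.smoothFam_fibreJac (fun _ hx => hφ.constantCoeff_fibreJac hx)
    (fun _ hx => Matrix.mul_nonsing_inv _ (hφ.isUnit_det hx)) i p

theorem IsFormalExp.smoothFam_conn (hφ : IsFormalExp U φ) (hU : IsOpen U) (i : Fin N) :
    SmoothFam U (fun x => conn φ a x i) :=
  (SmoothFam.sum _ fun p _ => (hφ.smoothFam_inv i p).mul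
    ((hφ.smoothFam p).famDeriv a hU)).neg

/-- The definition of the connection solved for ∂_a φ. Working with this form avoids differentiating
the inverse Jacobian. -/
theorem IsFormalExp.famDeriv_eq (hφ : IsFormalExp U φ) (hx : x ∈ U) (p : Fin N) :
    famDeriv a (fun x' => φ x' p) x = -∑ i, fibreJac φ x p i * conn φ a x i := by
  have h : Matrix.mulVec (fibreJac φ x) (Matrix.mulVec (fibreJac φ x)⁻¹
      fun p => famDeriv a (fun x' => φ x' p) x) = fun p => famDeriv a (fun x' => φ x' p) x := by
    rw [Matrix.mulVec_mulVec, Matrix.mul_nonsing_inv _ (hφ.isUnit_det hx), Matrix.one_mulVec]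
  have h2 := congrFun h p
  rw [← h2]
  simp only [Matrix.mulVec, dotProduct, conn, mul_neg, Finset.sum_neg_distrib, neg_neg]

/-- The components of the connection are Hamiltonian vector fields. -/
theorem IsFormalExp.conn_closed (hφ : IsFormalExp U φ) (hU : IsOpen U) (hx : x ∈ U)
    (hΩ : ∀ i j, Ω i j = -Ω j i) (hφΩ : PreservesForm Ω U φ) (k l : Fin N) :
    MvPowerSeries.pderiv ℂ k (∑ i, Ω i l • conn φ a x i) =
      MvPowerSeries.pderiv ℂ l (∑ i, Ω i k • conn φ a x i) := by
  set D : Fin N → MvPowerSeries (Fin N) ℂ := fun p => famDeriv a (fun x' => φ x' p) x with hD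
  -- Replacing Ω by its pullback φ^*Ω and using J R = -∂_a φ removes the inverse Jacobian from the
  -- 1-form.
  have hf : ∀ l, ∑ i, Ω i l • conn φ a x i =
      -∑ p, ∑ q, Ω p q • (D p * fibreJac φ x q l) := by
    intro l
    have h1 : ∀ i, Ω i l • conn φ a x i =
        ∑ p, ∑ q, Ω p q • (fibreJac φ x p i * conn φ a x i * fibreJac φ x q l) := by
      intro i
      rw [MvPowerSeries.smul_eq_C_mul, ← hφΩ x hx i l, Finset.sum_mul]
      refine Finset.sum_congr rfl fun p _ => ?_
      rw [Finset.sum_mul]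
      refine Finset.sum_congr rfl fun q _ => ?_
      rw [smul_mul_assoc]
      congr 1
      ring
    simp only [h1]
    rw [Finset.sum_comm, ← Finset.sum_neg_distrib]
    refine Finset.sum_congr rfl fun p _ => ?_
    rw [Finset.sum_comm, ← Finset.sum_neg_distrib]
    refine Finset.sum_congr rfl fun q _ => ?_
    rw [← Finset.smul_sum, ← Finset.sum_mul, ← smul_neg, hD]
    dsimp only
    rw [hφ.famDeriv_eq a hx p, neg_mul, neg_neg]
  -- The second sum contains ∂_k ∂_l φ and is symmetric in k and l, so closedness only concerns the
  -- first.
  have hpd : ∀ k l, MvPowerSeries.pderiv ℂ k (∑ i, Ω i l • conn φ a x i) =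
      -(∑ p, ∑ q, Ω p q • (MvPowerSeries.pderiv ℂ k (D p) * fibreJac φ x q l)) -
        ∑ p, ∑ q, Ω p q • (D p * MvPowerSeries.pderiv ℂ k
          (MvPowerSeries.pderiv ℂ l (φ x q))) := by
    intro k l
    rw [hf, map_neg, map_sum, ← neg_add', ← Finset.sum_add_distrib]
    congr 1
    refine Finset.sum_congr rfl fun p _ => ?_
    rw [map_sum, ← Finset.sum_add_distrib]
    refine Finset.sum_congr rfl fun q _ => ?_
    rw [Derivation.map_smul, Derivation.leibniz, ← smul_add, smul_eq_mul, smul_eq_mul]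
    congr 1
    rw [fibreJac, Matrix.of_apply]
    ring
  -- This is the derivative along `a` of φ^*Ω = Ω, whose right-hand side does not depend on x.
  have hS : ∑ p, ∑ q, Ω p q • (MvPowerSeries.pderiv ℂ k (D p) * fibreJac φ x q l) +
      ∑ p, ∑ q, Ω p q • (fibreJac φ x p k * MvPowerSeries.pderiv ℂ l (D q)) = 0 := by
    rw [← famDeriv_const a (x := x) (MvPowerSeries.C (Ω k l)),
      ← famDeriv_congr a hU hx (fun y hy => hφΩ y hy k l), famDeriv_sum a hU hx (F := fun p y => ∑ q, Ω p q •
      (fibreJac φ y p k * fibreJac φ y q l)) _ fun p _ =>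
      SmoothFam.sum _ fun q _ => ((hφ.smoothFam_fibreJac p k).mul
        (hφ.smoothFam_fibreJac q l)).smul _, ← Finset.sum_add_distrib]
    refine Finset.sum_congr rfl fun p _ => ?_
    rw [famDeriv_sum a hU hx (F := fun q y => Ω p q • (fibreJac φ y p k * fibreJac φ y q l))
      _ fun q _ => ((hφ.smoothFam_fibreJac p k).mul
        (hφ.smoothFam_fibreJac q l)).smul _, ← Finset.sum_add_distrib]
    refine Finset.sum_congr rfl fun q _ => ?_
    rw [famDeriv_smul a hU hx _ ((hφ.smoothFam_fibreJac p k).mul (hφ.smoothFam_fibreJac q l)),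
      famDeriv_mul a hU hx (hφ.smoothFam_fibreJac p k) (hφ.smoothFam_fibreJac q l), ← smul_add]
    simp only [hD]
    rw [← famDeriv_pderiv a hU hx k (hφ.smoothFam p), ← famDeriv_pderiv a hU hx l (hφ.smoothFam q)]
    rfl
  have hS' : ∑ p, ∑ q, Ω p q • (fibreJac φ x p k * MvPowerSeries.pderiv ℂ l (D q)) =
      -∑ p, ∑ q, Ω p q • (MvPowerSeries.pderiv ℂ l (D p) * fibreJac φ x q k) := by
    rw [Finset.sum_comm, ← Finset.sum_neg_distrib]
    refine Finset.sum_congr rfl fun p _ => ?_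
    rw [← Finset.sum_neg_distrib]
    refine Finset.sum_congr rfl fun q _ => ?_
    rw [hΩ q p, mul_comm, neg_smul]
  rw [hS', ← sub_eq_add_neg, sub_eq_zero] at hS
  rw [hpd, hpd, hS]
  simp only [pderiv_comm k l]

/-- The connection is flat. -/
theorem IsFormalExp.conn_flat (hφ : IsFormalExp U φ) (hU : IsOpen U) (hx : x ∈ U) (k : Fin N) :
    famDeriv a (fun y => conn φ b y k) x - famDeriv b (fun y => conn φ a y k) x +
      (∑ i, conn φ a x i * MvPowerSeries.pderiv ℂ i (conn φ b x k) -
        ∑ i, conn φ b x i * MvPowerSeries.pderiv ℂ i (conn φ a x k)) = 0 := by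
  -- The second derivative of φ splits into a term symmetric in the two directions and the Jacobian
  -- applied to half of the curvature expression. Comparing both orders of differentiation puts the
  -- curvature in the kernel of the Jacobian.
  have hD : ∀ a b : Fin N ⊕ Fin N, ∀ p, famDeriv b (fun y => famDeriv a (fun x' => φ x' p) y) x =
      ∑ i, ∑ k, MvPowerSeries.pderiv ℂ i (fibreJac φ x p k) * conn φ b x k * conn φ a x i +
      ∑ k, fibreJac φ x p k * ((∑ i, conn φ a x i * MvPowerSeries.pderiv ℂ i (conn φ b x k)) -
        famDeriv b (fun y => conn φ a y k) x) := by
    intro a b p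
    have hsm : ∀ i, SmoothFam U fun y => fibreJac φ y p i * conn φ a y i := fun i =>
      (hφ.smoothFam_fibreJac p i).mul (hφ.smoothFam_conn a hU i)
    have h1 : EqOn (fun y => famDeriv a (fun x' => φ x' p) y)
        (fun y => (-1 : ℂ) • ∑ i, fibreJac φ y p i * conn φ a y i) U := fun y hy => by
      dsimp only
      rw [hφ.famDeriv_eq a hy p, neg_one_smul]
    rw [famDeriv_congr b hU hx h1, famDeriv_smul b hU hx _ (SmoothFam.sum _ fun i _ => hsm i),
      famDeriv_sum b hU hx _ fun i _ => hsm i, neg_one_smul]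
    have h2 : ∀ i, famDeriv b (fun y => fibreJac φ y p i * conn φ a y i) x =
        -(∑ k, MvPowerSeries.pderiv ℂ i (fibreJac φ x p k) * conn φ b x k * conn φ a x i) -
        (∑ k, fibreJac φ x p k * (conn φ a x i * MvPowerSeries.pderiv ℂ i (conn φ b x k))) +
        fibreJac φ x p i * famDeriv b (fun y => conn φ a y i) x := by
      intro i
      rw [famDeriv_mul b hU hx (hφ.smoothFam_fibreJac p i) (hφ.smoothFam_conn a hU i)]
      congr 1
      have h3 : famDeriv b (fun y => fibreJac φ y p i) x =
          MvPowerSeries.pderiv ℂ i (famDeriv b (fun y => φ y p) x) :=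
        famDeriv_pderiv b hU hx i (hφ.smoothFam p)
      rw [h3, hφ.famDeriv_eq b hx p, map_neg, map_sum, neg_mul, ← neg_add', Finset.sum_mul,
        ← Finset.sum_add_distrib]
      congr 1
      refine Finset.sum_congr rfl fun k _ => ?_
      rw [Derivation.leibniz, smul_eq_mul, smul_eq_mul]
      ring
    simp only [h2, Finset.sum_add_distrib, Finset.sum_sub_distrib, Finset.sum_neg_distrib, mul_sub,
      Finset.mul_sum]
    rw [Finset.sum_comm (f := fun i k => fibreJac φ x p k *
      (conn φ a x i * MvPowerSeries.pderiv ℂ i (conn φ b x k)))]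
    ring
  set T : Fin N → MvPowerSeries (Fin N) ℂ := fun k =>
    famDeriv a (fun y => conn φ b y k) x - famDeriv b (fun y => conn φ a y k) x +
      (∑ i, conn φ a x i * MvPowerSeries.pderiv ℂ i (conn φ b x k) -
        ∑ i, conn φ b x i * MvPowerSeries.pderiv ℂ i (conn φ a x k)) with hT
  have hJT : Matrix.mulVec (fibreJac φ x) T = 0 := by
    ext1 p
    have h1 := hD a b p
    rw [famDeriv_comm b a hU hx (hφ.smoothFam p), hD b a p] at h1
    have h2 : ∑ i, ∑ k, MvPowerSeries.pderiv ℂ i (fibreJac φ x p k) * conn φ b x k * conn φ a x i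
        = ∑ i, ∑ k, MvPowerSeries.pderiv ℂ i (fibreJac φ x p k) * conn φ a x k * conn φ b x i := by
      rw [Finset.sum_comm]
      refine Finset.sum_congr rfl fun k _ => Finset.sum_congr rfl fun i _ => ?_
      rw [fibreJac, Matrix.of_apply, Matrix.of_apply, pderiv_comm]
      ring
    rw [h2, add_right_inj, ← sub_eq_zero, ← Finset.sum_sub_distrib] at h1
    change ∑ k, fibreJac φ x p k * T k = 0
    rw [← neg_eq_zero, ← h1, ← Finset.sum_neg_distrib]
    refine Finset.sum_congr rfl fun k _ => ?_
    rw [hT]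
    ring
  have h := congrArg (Matrix.mulVec (fibreJac φ x)⁻¹) hJT
  rw [Matrix.mulVec_mulVec, Matrix.nonsing_inv_mul _ (hφ.isUnit_det hx), Matrix.one_mulVec,
    Matrix.mulVec_zero] at h
  exact congrFun h k

/-- The Hamiltonian of a component of the connection. -/
def connHam (Ω : Matrix (Fin N) (Fin N) ℂ) (φ : (Fin N → ℂ) → Fin N → MvPowerSeries (Fin N) ℂ)
    (a : Fin N ⊕ Fin N) (x : Fin N → ℂ) : MvPowerSeries (Fin N) ℂ :=
  ∑ l, hamNormalize (∑ i, Ω i l • conn φ a x i) * MvPowerSeries.X l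

theorem IsFormalExp.pderiv_connHam (hφ : IsFormalExp U φ) (hU : IsOpen U) (hx : x ∈ U)
    (hΩ : ∀ i j, Ω i j = -Ω j i) (hφΩ : PreservesForm Ω U φ) (k : Fin N) :
    MvPowerSeries.pderiv ℂ k (connHam Ω φ a x) = ∑ i, Ω i k • conn φ a x i :=
  pderiv_primitive _ (fun k l => hφ.conn_closed a hU hx hΩ hφΩ k l) k

theorem IsFormalExp.smoothFam_connHam (hφ : IsFormalExp U φ) (hU : IsOpen U) :
    SmoothFam U (connHam Ω φ a) :=
  SmoothFam.sum _ fun _ _ => (SmoothFam.hamNormalize (SmoothFam.sum _ fun i _ =>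
    (hφ.smoothFam_conn a hU i).smul _)).mul (SmoothFam.const _)

/-- The Hamiltonians satisfy the Maurer–Cartan equation up to constants. -/
theorem IsFormalExp.connHam_flat (hφ : IsFormalExp U φ) (hU : IsOpen U) (hx : x ∈ U)
    (hΩ : ∀ i j, Ω i j = -Ω j i) (hφΩ : PreservesForm Ω U φ) :
    ∃ c : ℂ, famDeriv a (connHam Ω φ b) x - famDeriv b (connHam Ω φ a) x =
      (∑ i, ∑ j, Ω i j • (conn φ a x i * conn φ b x j)) + MvPowerSeries.C c := by
  set E := famDeriv a (connHam Ω φ b) x - famDeriv b (connHam Ω φ a) x -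
    ∑ i, ∑ j, Ω i j • (conn φ a x i * conn φ b x j) with hE
  suffices h : E = MvPowerSeries.C (MvPowerSeries.constantCoeff E) from
    ⟨_, by rw [← h, hE]; ring⟩
  -- A formal power series over ℂ is determined by its y-derivatives and its constant term; the
  -- constant term is what remains uncontrolled.
  refine MvPowerSeries.pderiv.ext (fun l => ?_) (by simp)
  rw [MvPowerSeries.pderiv_C]
  have hd : ∀ a b : Fin N ⊕ Fin N, MvPowerSeries.pderiv ℂ l (famDeriv a (connHam Ω φ b) x) =
      ∑ i, Ω i l • famDeriv a (fun y => conn φ b y i) x := by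
    intro a b
    rw [← famDeriv_pderiv a hU hx l (hφ.smoothFam_connHam b hU),
      famDeriv_congr a hU hx fun y hy => hφ.pderiv_connHam b hU hy hΩ hφΩ l,
      famDeriv_sum a hU hx _ fun i _ => (hφ.smoothFam_conn b hU i).smul _]
    exact Finset.sum_congr rfl fun i _ => famDeriv_smul a hU hx _ (hφ.smoothFam_conn b hU i)
  have hcl : ∀ a j, ∑ i, Ω i j • MvPowerSeries.pderiv ℂ l (conn φ a x i) =
      ∑ i, Ω i l • MvPowerSeries.pderiv ℂ j (conn φ a x i) := by
    intro a j
    have := hφ.conn_closed a hU hx hΩ hφΩ l j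
    simpa only [map_sum, Derivation.map_smul] using this
  -- Closedness moves the derivative ∂_l from the vector field onto Ω-contracted components, so the
  -- gradient of Ω(R_a, R_b) becomes Ω contracted with the Lie bracket that appears in the flatness
  -- equation.
  have hq : MvPowerSeries.pderiv ℂ l (∑ i, ∑ j, Ω i j • (conn φ a x i * conn φ b x j)) =
      ∑ k, Ω k l • (∑ i, conn φ b x i * MvPowerSeries.pderiv ℂ i (conn φ a x k) -
        ∑ i, conn φ a x i * MvPowerSeries.pderiv ℂ i (conn φ b x k)) := by
    have e1 : ∑ k, Ω k l • ∑ i, conn φ b x i * MvPowerSeries.pderiv ℂ i (conn φ a x k) =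
        ∑ i, ∑ j, Ω i j • (MvPowerSeries.pderiv ℂ l (conn φ a x i) * conn φ b x j) := by
      simp only [Finset.smul_sum]
      rw [Finset.sum_comm, Finset.sum_comm (γ := Fin N) (f := fun i j =>
        Ω i j • (MvPowerSeries.pderiv ℂ l (conn φ a x i) * conn φ b x j))]
      refine Finset.sum_congr rfl fun j _ => ?_
      simp only [← smul_mul_assoc, ← Finset.sum_mul, hcl a j]
      rw [Finset.sum_mul]
      refine Finset.sum_congr rfl fun k _ => ?_
      rw [smul_mul_assoc, mul_comm (conn φ b x j), smul_mul_assoc]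
    have e2 : ∑ k, Ω k l • ∑ i, conn φ a x i * MvPowerSeries.pderiv ℂ i (conn φ b x k) =
        -∑ i, ∑ j, Ω i j • (conn φ a x i * MvPowerSeries.pderiv ℂ l (conn φ b x j)) := by
      simp only [Finset.smul_sum]
      rw [Finset.sum_comm, ← Finset.sum_neg_distrib]
      refine Finset.sum_congr rfl fun i _ => ?_
      have h3 : ∑ j, Ω i j • (conn φ a x i * MvPowerSeries.pderiv ℂ l (conn φ b x j)) =
          -(conn φ a x i * ∑ j, Ω j i • MvPowerSeries.pderiv ℂ l (conn φ b x j)) := by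
        rw [Finset.mul_sum, ← Finset.sum_neg_distrib]
        refine Finset.sum_congr rfl fun j _ => ?_
        rw [hΩ i j, neg_smul, mul_smul_comm]
      rw [h3, neg_neg, hcl b i, Finset.mul_sum]
      refine Finset.sum_congr rfl fun k _ => ?_
      rw [mul_smul_comm]
    simp only [smul_sub, Finset.sum_sub_distrib]
    rw [e1, e2, sub_neg_eq_add, map_sum, ← Finset.sum_add_distrib]
    refine Finset.sum_congr rfl fun i _ => ?_
    rw [map_sum, ← Finset.sum_add_distrib]
    refine Finset.sum_congr rfl fun j _ => ?_
    rw [Derivation.map_smul, Derivation.leibniz, ← smul_add, smul_eq_mul, smul_eq_mul]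
    congr 1
    ring
  rw [hE, map_sub, map_sub, hd, hd, hq, ← Finset.sum_sub_distrib, ← Finset.sum_sub_distrib]
  refine Finset.sum_eq_zero fun k _ => ?_
  have h := hφ.conn_flat a b hU hx k
  rw [← smul_sub, ← smul_sub]
  convert smul_zero (Ω k l) using 2
  rw [← h]
  ring

end RozanskyWitten
end

noncomputable section

namespace RozanskyWitten

open Filter Topology

variable {N : ℕ}

/-! ### The exterior derivative in a chart -/

section LocalD

section General

variable {W : Type*} [AddCommGroup W] [Module ℂ W]
  {E : Type*} [NormedAddCommGroup E] [NormedSpace ℝ E] {R s : Set E} {u : E}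

/-- At boundary points the second derivative within `R` is still symmetric, because such points are
limits of interior ones; this is the role of `hcl`. -/
theorem pd_pd_comm (hs : ∀ x ∈ s, s ∈ 𝓝[R] x) (hsR : s ⊆ R) (hR : UniqueDiffOn ℝ R)
    (hcl : R ⊆ closure (interior R)) {F : E → W} (hF : GSmooth s F) (hu : u ∈ s) (v w : E) :
    pd R w (fun x => pd R v F x) u = pd R v (fun x => pd R w F x) u := by
  refine eq_of_forall_dual fun ℓ => ?_
  have h1 : ∀ v w, ℓ (pd R w (fun x => pd R v F x) u) =
      fderivWithin ℝ (fderivWithin ℝ (fun x => ℓ (F x)) R) R u w v := by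
    intro v w
    rw [((hF.pd hsR hs hR v).gdiff (hs u hu) (hsR hu)).dual_pd (hsR hu) (hR u (hsR hu))]
    have hev : (fun x => ℓ (pd R v F x)) =ᶠ[𝓝[R] u]
        fun x => fderivWithin ℝ (fun x => ℓ (F x)) R x v := by
      filter_upwards [hs u hu] with x hx
      exact (hF.gdiff (hs x hx) (hsR hx)).dual_pd (hsR hx) (hR x (hsR hx)) ℓ
    rw [hev.fderivWithin_eq (hev.self_of_nhdsWithin (hsR hu))]
    have hd : DifferentiableWithinAt ℝ (fderivWithin ℝ (fun x => ℓ (F x)) R) R u := by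
      have hc : ContDiffWithinAt ℝ ∞ (fun x => ℓ (F x)) R u :=
        ((hF.smooth ℓ) u hu).mono_of_mem_nhdsWithin (hs u hu)
      exact (hc.fderivWithin_right (m := 1) hR
        (by rw [one_add_one_eq_two]; exact ENat.LEInfty.out) (hsR hu)).differentiableWithinAt (by simp)
    rw [fderivWithin_clm_apply (hR u (hsR hu)) hd (differentiableWithinAt_const v)]
    simp
  rw [h1, h1]
  have hc : ContDiffWithinAt ℝ ∞ (fun x => ℓ (F x)) R u :=
    ((hF.smooth ℓ) u hu).mono_of_mem_nhdsWithin (hs u hu)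
  exact hc.isSymmSndFDerivWithinAt
    (by rw [minSmoothness_of_isRCLikeNormedField]; exact ENat.LEInfty.out) hR
    (hcl (hsR hu)) (hsR hu) w v

end General

abbrev E3 : Type := EuclideanSpace ℝ (Fin 3)

/-- The standard basis vectors. -/
def e3 (μ : Fin 3) : E3 := EuclideanSpace.single μ 1

variable {R s : Set E3} {u : E3} {F G : E3 → Grass N}

/-- The exterior derivative in coordinates. -/
def locD (R : Set E3) (F : E3 → Grass N) (u : E3) : Grass N :=
  ∑ μ, theta μ * pd R (e3 μ) F u

theorem locD_add (hu : u ∈ R) (hR : UniqueDiffWithinAt ℝ R u) (hF : GDiff R F u)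
    (hG : GDiff R G u) : locD R (fun x => F x + G x) u = locD R F u + locD R G u := by
  have : ∀ v : E3, pd R v (fun x => F x + G x) u = pd R v F u + pd R v G u := by
    intro v
    rw [pd_add hu hR hF hG]
  simp only [locD, this, mul_add, Finset.sum_add_distrib]

theorem locD_smul (hu : u ∈ R) (hR : UniqueDiffWithinAt ℝ R u) (c : ℂ) (hF : GDiff R F u) :
    locD R (fun x => c • F x) u = c • locD R F u := by
  have : ∀ v, pd R v (fun x => c • F x) u = c • pd R v F u := fun v => by
    have h := pd_map (v := v) hu hR hF (LinearMap.lsmul ℂ (Grass N) c)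
    simpa only [LinearMap.lsmul_apply] using h
  simp only [locD, this, mul_smul_comm, Finset.smul_sum]

theorem locD_const (hu : u ∈ R) (hR : UniqueDiffWithinAt ℝ R u) (a : Grass N) :
    locD R (fun _ => a) u = 0 := by
  simp only [locD, pd_const hu hR, mul_zero, Finset.sum_const_zero]

theorem locD_congr (hu : u ∈ R) (h : F =ᶠ[𝓝[R] u] G) : locD R F u = locD R G u := by
  simp only [locD, pd_congr hu h]

theorem GDiff.mul (hu : u ∈ R) (hR : UniqueDiffWithinAt ℝ R u) (hF : GDiff R F u)
    (hG : GDiff R G u) : GDiff R (fun x => F x * G x) u :=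
  hF.bilin hu hR hG (LinearMap.mul ℂ (Grass N))

theorem GSmooth.mul (hF : GSmooth s F) (hG : GSmooth s G) : GSmooth s (fun x => F x * G x) :=
  hF.bilin hG (LinearMap.mul ℂ (Grass N))

theorem gsmooth_sum {ι : Type*} (S : Finset ι) {F : ι → E3 → Grass N}
    (h : ∀ i ∈ S, GSmooth s (F i)) : GSmooth s (fun x => ∑ i ∈ S, F i x) := by
  classical
  induction S using Finset.induction_on with
  | empty => simpa using gsmooth_const 0
  | insert i S hi ih =>
    simp only [Finset.sum_insert hi]
    exact (h i (Finset.mem_insert_self _ _)).add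
      (ih fun j hj => h j (Finset.mem_insert_of_mem hj))

theorem gdiff_sum {ι : Type*} (S : Finset ι) {F : ι → E3 → Grass N}
    (h : ∀ i ∈ S, GDiff R (F i) u) : GDiff R (fun x => ∑ i ∈ S, F i x) u := by
  classical
  induction S using Finset.induction_on with
  | empty => simpa using gdiff_const 0
  | insert i S hi ih =>
    simp only [Finset.sum_insert hi]
    exact (h i (Finset.mem_insert_self _ _)).add
      (ih fun j hj => h j (Finset.mem_insert_of_mem hj))

theorem locD_sum {ι : Type*} (hu : u ∈ R) (hR : UniqueDiffWithinAt ℝ R u) (S : Finset ι)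
    {F : ι → E3 → Grass N} (h : ∀ i ∈ S, GDiff R (F i) u) :
    locD R (fun x => ∑ i ∈ S, F i x) u = ∑ i ∈ S, locD R (F i) u := by
  classical
  induction S using Finset.induction_on with
  | empty => simpa using locD_const hu hR 0
  | insert i S hi ih =>
    simp only [Finset.sum_insert hi]
    rw [locD_add hu hR (h i (Finset.mem_insert_self _ _))
      (gdiff_sum S fun j hj => h j (Finset.mem_insert_of_mem hj)),
      ih fun j hj => h j (Finset.mem_insert_of_mem hj)]

/-- The exterior derivative is an odd derivation. -/
theorem locD_mul (hu : u ∈ R) (hR : UniqueDiffWithinAt ℝ R u) (hF : GDiff R F u)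
    (hG : GDiff R G u) :
    locD R (fun x => F x * G x) u = locD R F u * G u + parity (F u) * locD R G u := by
  have : ∀ v, pd R v (fun x => F x * G x) u = pd R v F u * G u + F u * pd R v G u := fun v =>
    pd_bilin hu hR hF hG (LinearMap.mul ℂ (Grass N))
  simp only [locD, this, mul_add, Finset.sum_add_distrib, Finset.sum_mul, Finset.mul_sum]
  congr 1
  · exact Finset.sum_congr rfl fun μ _ => (mul_assoc _ _ _).symm
  · refine Finset.sum_congr rfl fun μ _ => ?_
    rw [← mul_assoc, ← mul_assoc]
    congr 1
    exact ι_mul_eq _ _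

theorem GSmooth.locD (hsR : s ⊆ R) (hs : ∀ x ∈ s, s ∈ 𝓝[R] x) (hR : UniqueDiffOn ℝ R)
    (hF : GSmooth s F) : GSmooth s (locD R F) :=
  gsmooth_sum _ fun μ _ => (hF.pd hsR hs hR (e3 μ)).map (LinearMap.mulLeft ℂ (theta μ))

theorem locD_locD (hs : ∀ x ∈ s, s ∈ 𝓝[R] x) (hsR : s ⊆ R) (hR : UniqueDiffOn ℝ R)
    (hcl : R ⊆ closure (interior R)) (hF : GSmooth s F) (hu : u ∈ s) :
    locD R (locD R F) u = 0 := by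
  have hpd : ∀ μ, GDiff R (fun x => pd R (e3 μ) F x) u := fun μ =>
    (hF.pd hsR hs hR (e3 μ)).gdiff (hs u hu) (hsR hu)
  have hpd' : ∀ μ, GDiff R (fun x => theta μ * pd R (e3 μ) F x) u := fun μ =>
    (hpd μ).map (LinearMap.mulLeft ℂ (theta μ))
  have h1 : ∀ ν, pd R (e3 ν) (locD R F) u =
      ∑ μ, theta μ * pd R (e3 ν) (fun x => pd R (e3 μ) F x) u := by
    intro ν
    have hsum : ∀ S : Finset (Fin 3), pd R (e3 ν)
        (fun x => ∑ μ ∈ S, theta μ * pd R (e3 μ) F x) u =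
        ∑ μ ∈ S, theta μ * pd R (e3 ν) (fun x => pd R (e3 μ) F x) u := by
      intro S
      classical
      induction S using Finset.induction_on with
      | empty => simpa using pd_const (hsR hu) (hR u (hsR hu)) (0 : Grass N)
      | insert i S hi ih =>
        simp only [Finset.sum_insert hi]
        rw [pd_add (hsR hu) (hR u (hsR hu)) (hpd' i) (gdiff_sum S fun j _ => hpd' j), ih]
        congr 1
        exact pd_map (hsR hu) (hR u (hsR hu)) (hpd i) (LinearMap.mulLeft ℂ (theta i))
    exact hsum _
  have h2 : locD R (locD R F) u =
      ∑ ν, ∑ μ, theta ν * theta μ * pd R (e3 ν) (fun x => pd R (e3 μ) F x) u := by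
    conv_lhs => rw [RozanskyWitten.locD]
    simp only [h1, Finset.mul_sum, mul_assoc]
  -- Symmetric second derivatives are paired with anticommuting θ's, so d² equals its own negative.
  have h3 : locD R (locD R F) u = -locD R (locD R F) u := by
    conv_lhs => rw [h2, Finset.sum_comm]
    rw [h2, ← Finset.sum_neg_distrib]
    refine Finset.sum_congr rfl fun μ _ => ?_
    rw [← Finset.sum_neg_distrib]
    refine Finset.sum_congr rfl fun ν _ => ?_
    rw [pd_pd_comm hs hsR hR hcl hF hu, (isOdd_theta ν).anticomm (isOdd_theta μ), neg_mul]
  have h4 : (2 : ℂ) • locD R (locD R F) u = 0 := by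
    rw [two_smul]
    nth_rewrite 1 [h3]
    exact neg_add_cancel _
  exact (smul_eq_zero.1 h4).resolve_left two_ne_zero

/-! #### Changes of coordinates -/

/-- The Jacobian matrix of a change of coordinates. -/
def jacE (R : Set E3) (τ : E3 → E3) (u : E3) : Matrix (Fin 3) (Fin 3) ℝ :=
  fun μ ν => fderivWithin ℝ τ R u (e3 ν) μ

variable {τ : E3 → E3}

theorem contDiffOn_coord (hτ : ContDiffOn ℝ ∞ τ s) (l : Fin 3) :
    ContDiffOn ℝ ∞ (fun x => ((τ x l : ℝ) : ℂ)) s := by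
  have h1 : ContDiffOn ℝ ∞ (fun x => τ x l) s := (contDiffOn_euclidean.1 hτ) l
  exact Complex.ofRealCLM.contDiff.comp_contDiffOn h1

theorem fderivWithin_coord (hs : ∀ x ∈ s, s ∈ 𝓝[R] x) (hsR : s ⊆ R) (hR : UniqueDiffOn ℝ R)
    (hτ : ContDiffOn ℝ ∞ τ s) (hu : u ∈ s) (l ν : Fin 3) :
    fderivWithin ℝ (fun x => ((τ x l : ℝ) : ℂ)) R u (e3 ν) = ((jacE R τ u l ν : ℝ) : ℂ) := by
  have hd : DifferentiableWithinAt ℝ τ R u :=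
    ((hτ.differentiableOn (by simp)) u hu).mono_of_mem_nhdsWithin (hs u hu)
  have h := (Complex.ofRealCLM.comp (EuclideanSpace.proj (𝕜 := ℝ) l)).hasFDerivAt.comp_hasFDerivWithinAt
    u hd.hasFDerivWithinAt
  have h2 := h.fderivWithin (hR u (hsR hu))
  change fderivWithin ℝ ((Complex.ofRealCLM.comp (EuclideanSpace.proj (𝕜 := ℝ) l)) ∘ τ) R u (e3 ν)
    = _
  rw [h2]
  rfl

/-- Under a coordinate change θ^l becomes dτ^l. Hence pullbacks of coordinate differentials are
exact, and closed by d² = 0. -/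
theorem substTheta_theta_eq_locD (hs : ∀ x ∈ s, s ∈ 𝓝[R] x) (hsR : s ⊆ R)
    (hR : UniqueDiffOn ℝ R) (hτ : ContDiffOn ℝ ∞ τ s) (hu : u ∈ s) (l : Fin 3) :
    substTheta (jacE R τ u) (theta (N := N) l) =
      locD R (fun x => ((τ x l : ℝ) : ℂ) • (1 : Grass N)) u := by
  rw [substTheta_theta, locD]
  refine Finset.sum_congr rfl fun ν _ => ?_
  have hd : DifferentiableWithinAt ℝ (fun x => ((τ x l : ℝ) : ℂ)) R u :=
    (((contDiffOn_coord hτ l).differentiableOn (by simp)) u hu).mono_of_mem_nhdsWithin (hs u hu)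
  have h := pd_map (v := e3 ν) (hsR hu) (hR u (hsR hu)) (gdiff_scalar hd)
    (LinearMap.toSpanSingleton ℂ (Grass N) 1)
  simp only [LinearMap.toSpanSingleton_apply] at h
  rw [h, pd_scalar (hsR hu) (hR u (hsR hu)) hd, fderivWithin_coord hs hsR hR hτ hu]
  simp

theorem gsmooth_smul_const {a : E3 → ℂ} (ha : ContDiffOn ℝ ∞ a s) (b : Grass N) :
    GSmooth s (fun x => a x • b) :=
  (gsmooth_scalar ha).map (LinearMap.toSpanSingleton ℂ (Grass N) b)

/-- Pullbacks of constant forms are smooth and closed. -/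
theorem locD_substTheta_const (hs : ∀ x ∈ s, s ∈ 𝓝[R] x) (hsR : s ⊆ R)
    (hR : UniqueDiffOn ℝ R) (hcl : R ⊆ closure (interior R)) (hτ : ContDiffOn ℝ ∞ τ s)
    (b : Grass N) :
    GSmooth s (fun x => substTheta (jacE R τ x) b) ∧
    ∀ u ∈ s, locD R (fun x => substTheta (jacE R τ x) b) u = 0 := by
  have hι : ∀ m : Gen N →₀ ℂ,
      GSmooth s (fun x => substTheta (jacE R τ x) (ExteriorAlgebra.ι ℂ m)) ∧
      ∀ u ∈ s, locD R (fun x => substTheta (jacE R τ x) (ExteriorAlgebra.ι ℂ m)) u = 0 := by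
    intro m
    induction m using Finsupp.induction_linear with
    | zero =>
      simp only [map_zero]
      exact ⟨gsmooth_const 0, fun u hu => locD_const (hsR hu) (hR u (hsR hu)) 0⟩
    | add f g hf hg =>
      simp only [map_add]
      refine ⟨hf.1.add hg.1, fun u hu => ?_⟩
      rw [locD_add (hsR hu) (hR u (hsR hu)) (hf.1.gdiff (hs u hu) (hsR hu))
        (hg.1.gdiff (hs u hu) (hsR hu)), hf.2 u hu, hg.2 u hu, add_zero]
    | single g c =>
      have hg : ExteriorAlgebra.ι ℂ (Finsupp.single g c) = c • (gen g : Grass N) := by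
        rw [gen, ← map_smul, Finsupp.smul_single, smul_eq_mul, mul_one]
      simp only [hg, map_smul]
      rcases g with l | h
      · have hsm : GSmooth s (fun x => ((τ x l : ℝ) : ℂ) • (1 : Grass N)) :=
          gsmooth_smul_const (contDiffOn_coord hτ l) 1
        have heq : EqOn (fun x => locD R (fun x => ((τ x l : ℝ) : ℂ) • (1 : Grass N)) x)
            (fun x => substTheta (jacE R τ x) (gen (Sum.inl l))) s := fun x hx =>
          (substTheta_theta_eq_locD hs hsR hR hτ hx l).symm
        have hsm2 := (hsm.locD hsR hs hR).congr heq
        refine ⟨hsm2.map (c • LinearMap.id), fun u hu => ?_⟩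
        rw [locD_smul (hsR hu) (hR u (hsR hu)) c (hsm2.gdiff (hs u hu) (hsR hu)),
          ← locD_congr (hsR hu) (Filter.mem_of_superset (hs u hu) heq)]
        rw [locD_locD hs hsR hR hcl hsm hu, smul_zero]
      · simp only [substTheta_gen_inr]
        exact ⟨gsmooth_const _, fun u hu => locD_const (hsR hu) (hR u (hsR hu)) _⟩
  induction b using grass_induction with
  | hc r =>
    simp only [AlgHom.commutes]
    exact ⟨gsmooth_const _, fun u hu => locD_const (hsR hu) (hR u (hsR hu)) _⟩
  | hadd x y hx hy =>
    simp only [map_add]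
    refine ⟨hx.1.add hy.1, fun u hu => ?_⟩
    rw [locD_add (hsR hu) (hR u (hsR hu)) (hx.1.gdiff (hs u hu) (hsR hu))
      (hy.1.gdiff (hs u hu) (hsR hu)), hx.2 u hu, hy.2 u hu, add_zero]
  | hι x m hx =>
    simp only [map_mul]
    refine ⟨(hι m).1.mul hx.1, fun u hu => ?_⟩
    rw [locD_mul (hsR hu) (hR u (hsR hu)) ((hι m).1.gdiff (hs u hu) (hsR hu))
      (hx.1.gdiff (hs u hu) (hsR hu)), hx.2 u hu, (hι m).2 u hu, zero_mul, mul_zero, add_zero]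

/-- The exterior derivative commutes with pullbacks. -/
theorem locD_pullback (hs : ∀ x ∈ s, s ∈ 𝓝[R] x) (hsR : s ⊆ R) (hR : UniqueDiffOn ℝ R)
    (hcl : R ⊆ closure (interior R)) (hτ : ContDiffOn ℝ ∞ τ s) {s' : Set E3} (hsR' : s' ⊆ R)
    (hs' : ∀ x ∈ s', s' ∈ 𝓝[R] x) (hmaps : MapsTo τ s s') (hG : GSmooth s' G) (hu : u ∈ s) :
    locD R (fun x => substTheta (jacE R τ x) (G (τ x))) u =
      substTheta (jacE R τ u) (locD R G (τ u)) := by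
  obtain ⟨B, a, ha, hGB⟩ := (gsmooth_iff G).1 hG
  have hRu := hR u (hsR hu)
  have hτu : τ u ∈ s' := hmaps hu
  -- Writing the form as a finite sum of scalar functions times constant Grassmann elements leaves
  -- only the chain rule for functions: pullbacks of the constant elements are closed.
  have hev : (fun x => substTheta (jacE R τ x) (G (τ x))) =ᶠ[𝓝[R] u]
      fun x => ∑ b ∈ B, (a b (τ x) • (1 : Grass N)) * substTheta (jacE R τ x) b := by
    filter_upwards [hs u hu] with x hx
    rw [hGB _ (hmaps hx), map_sum]
    exact Finset.sum_congr rfl fun b _ => by rw [map_smul, smul_one_mul]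
  have hev' : G =ᶠ[𝓝[R] (τ u)] fun x => ∑ b ∈ B, (a b x • (1 : Grass N)) * b := by
    filter_upwards [hs' _ hτu] with x hx
    rw [hGB _ hx]
    exact Finset.sum_congr rfl fun b _ => by rw [smul_one_mul]
  have haτ : ∀ b ∈ B, ContDiffOn ℝ ∞ (fun x => a b (τ x)) s := fun b hb =>
    (ha b hb).comp hτ hmaps
  have hd1 : ∀ b ∈ B, GDiff R (fun x => a b (τ x) • (1 : Grass N)) u := fun b hb =>
    (gsmooth_smul_const (haτ b hb) 1).gdiff (hs u hu) (hsR hu)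
  have hd2 : ∀ b : Grass N, GDiff R (fun x => substTheta (jacE R τ x) b) u := fun b =>
    (locD_substTheta_const hs hsR hR hcl hτ b).1.gdiff (hs u hu) (hsR hu)
  have hd3 : ∀ b ∈ B, GDiff R (fun x => a b x • (1 : Grass N)) (τ u) := fun b hb =>
    (gsmooth_smul_const (ha b hb) 1).gdiff (hs' _ hτu) (hsR' hτu)
  rw [locD_congr (hsR hu) hev, locD_congr (hsR' hτu) hev',
    locD_sum (hsR hu) hRu _ fun b hb => (hd1 b hb).mul (hsR hu) hRu (hd2 b),
    locD_sum (hsR' hτu) (hR _ (hsR' hτu)) _ fun b hb =>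
      (hd3 b hb).mul (hsR' hτu) (hR _ (hsR' hτu)) (gdiff_const b), map_sum]
  refine Finset.sum_congr rfl fun b hb => ?_
  rw [locD_mul (hsR hu) hRu (hd1 b hb) (hd2 b),
    locD_mul (hsR' hτu) (hR _ (hsR' hτu)) (hd3 b hb) (gdiff_const b),
    (locD_substTheta_const hs hsR hR hcl hτ b).2 u hu, locD_const (hsR' hτu) (hR _ (hsR' hτu)),
    mul_zero, add_zero, add_zero, map_mul]
  congr 1
  have hdb : DifferentiableWithinAt ℝ (a b) R (τ u) :=
    (((ha b hb).differentiableOn (by simp)) _ hτu).mono_of_mem_nhdsWithin (hs' _ hτu)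
  have hdτ : DifferentiableWithinAt ℝ τ R u :=
    ((hτ.differentiableOn (by simp)) u hu).mono_of_mem_nhdsWithin (hs u hu)
  have hda : DifferentiableWithinAt ℝ (fun x => a b (τ x)) R u :=
    (((haτ b hb).differentiableOn (by simp)) u hu).mono_of_mem_nhdsWithin (hs u hu)
  have hp1 : ∀ v, pd R v (fun x => a b (τ x) • (1 : Grass N)) u =
      fderivWithin ℝ (fun x => a b (τ x)) R u v • 1 := by
    intro v
    have h := pd_map (v := v) (hsR hu) hRu (gdiff_scalar hda)
      (LinearMap.toSpanSingleton ℂ (Grass N) 1)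
    simp only [LinearMap.toSpanSingleton_apply] at h
    rw [h, pd_scalar (hsR hu) hRu hda]
  have hp2 : ∀ v, pd R v (fun x => a b x • (1 : Grass N)) (τ u) =
      fderivWithin ℝ (a b) R (τ u) v • 1 := by
    intro v
    have h := pd_map (v := v) (hsR' hτu) (hR _ (hsR' hτu)) (gdiff_scalar hdb)
      (LinearMap.toSpanSingleton ℂ (Grass N) 1)
    simp only [LinearMap.toSpanSingleton_apply] at h
    rw [h, pd_scalar (hsR' hτu) (hR _ (hsR' hτu)) hdb]
  have hchain : ∀ μ, fderivWithin ℝ (fun x => a b (τ x)) R u (e3 μ) =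
      ∑ l, ((jacE R τ u l μ : ℝ) : ℂ) * fderivWithin ℝ (a b) R (τ u) (e3 l) := by
    intro μ
    have hc : HasFDerivWithinAt (fun x => a b (τ x))
        ((fderivWithin ℝ (a b) R (τ u)).comp (fderivWithin ℝ τ R u)) s u :=
      (hdb.hasFDerivWithinAt.mono hsR').comp u (hdτ.hasFDerivWithinAt.mono hsR) hmaps
    have hc2 := (hc.mono_of_mem_nhdsWithin (hs u hu)).fderivWithin hRu
    rw [hc2, ContinuousLinearMap.comp_apply]
    have hexp : fderivWithin ℝ τ R u (e3 μ) = ∑ l, jacE R τ u l μ • e3 l := by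
      ext k
      -- Columns of the Jacobian matrix are the images of the standard basis vectors.
      simp [jacE, e3, Pi.single_apply]
    rw [hexp, map_sum]
    exact Finset.sum_congr rfl fun l _ => by rw [map_smul, Complex.real_smul]
  simp only [locD, hp1, hp2, hchain, map_sum, map_smul, substTheta_theta,
    mul_smul_one, Finset.sum_smul, Finset.smul_sum, Finset.mul_sum]
  rw [Finset.sum_comm]
  refine Finset.sum_congr rfl fun l _ => Finset.sum_congr rfl fun μ _ => ?_
  rw [smul_smul, mul_comm]

end LocalD

end RozanskyWitten
end

noncomputable section

namespace RozanskyWitten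

open Filter Topology

variable {N : ℕ}

/-! ### Forms on the source -/

/-- The closed half space. -/
abbrev halfRange : Set E3 := range (𝓡∂ 3)

theorem uniqueDiffOn_halfRange : UniqueDiffOn ℝ halfRange := (𝓡∂ 3).uniqueDiffOn

theorem halfRange_subset_closure : halfRange ⊆ closure (interior halfRange) :=
  (𝓡∂ 3).range_subset_closure_interior

section Forms

variable {S : Type*} [TopologicalSpace S] [ChartedSpace (EuclideanHalfSpace 3) S]

local notation "Chart" => atlas (EuclideanHalfSpace 3) S

/-- The image of a chart in the half space. -/
def tgt (c : Chart) : Set E3 := (c.1.extend (𝓡∂ 3)).target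

/-- The inverse of a chart. -/
def inv (c : Chart) (u : E3) : S := (c.1.extend (𝓡∂ 3)).symm u

/-- The coordinates of a point. -/
def crd (c : Chart) (p : S) : E3 := c.1.extend (𝓡∂ 3) p

/-- The expression of a form in a chart as a function of the coordinates. -/
def loc (f : SForm N S) (c : Chart) (u : E3) : Grass N := f c (inv c u)

theorem tgt_subset (c : Chart) : tgt c ⊆ halfRange := c.1.extend_target_subset_range

theorem tgt_mem_nhdsWithin (c : Chart) : ∀ u ∈ tgt c, tgt c ∈ 𝓝[halfRange] u := by
  intro u hu
  have hp : (c.1.extend (𝓡∂ 3)).symm u ∈ c.1.source := by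
    rw [← c.1.extend_source (I := 𝓡∂ 3)]
    exact (c.1.extend (𝓡∂ 3)).map_target hu
  have h := c.1.extend_target_mem_nhdsWithin (I := 𝓡∂ 3) hp
  rwa [(c.1.extend (𝓡∂ 3)).right_inv hu] at h

theorem inv_mem {c : Chart} {u : E3} (hu : u ∈ tgt c) : inv c u ∈ c.1.source := by
  have := (c.1.extend (𝓡∂ 3)).map_target hu
  rwa [c.1.extend_source] at this

theorem crd_mem {c : Chart} {p : S} (hp : p ∈ c.1.source) : crd c p ∈ tgt c :=
  (c.1.extend (𝓡∂ 3)).map_source (by rwa [c.1.extend_source])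

theorem inv_crd {c : Chart} {p : S} (hp : p ∈ c.1.source) : inv c (crd c p) = p :=
  (c.1.extend (𝓡∂ 3)).left_inv (by rwa [c.1.extend_source])

theorem crd_inv {c : Chart} {u : E3} (hu : u ∈ tgt c) : crd c (inv c u) = u :=
  (c.1.extend (𝓡∂ 3)).right_inv hu

theorem deRham_eq_locD (f : SForm N S) (c : Chart) (p : S) :
    deRham f c p = locD halfRange (loc f c) (crd c p) := rfl

theorem loc_deRham (f : SForm N S) {c : Chart} {u : E3} (hu : u ∈ tgt c) :
    loc (deRham f) c u = locD halfRange (loc f c) u := by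
  rw [loc, deRham_eq_locD, crd_inv hu]

/-! #### Changes of charts -/

/-- The change of coordinates from `c` to `c'`. -/
def trans (c c' : Chart) (u : E3) : E3 := crd c' (inv c u)

/-- The domain of the change of coordinates from `c` to `c'`. -/
def overlap (c c' : Chart) : Set E3 := {u | u ∈ tgt c ∧ inv c u ∈ c'.1.source}

theorem overlap_subset (c c' : Chart) : overlap c c' ⊆ tgt c := fun _ h => h.1

theorem overlap_eq_source (c c' : Chart) :
    overlap c c' = ((𝓡∂ 3).extendCoordChange c.1 c'.1).source := by
  ext u
  simp only [overlap, tgt, inv, ModelWithCorners.extendCoordChange, PartialEquiv.trans_source,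
    PartialEquiv.symm_source, mem_ofPred_eq, mem_inter_iff, mem_preimage, c'.1.extend_source]

theorem overlap_mem_nhdsWithin (c c' : Chart) :
    ∀ u ∈ overlap c c', overlap c c' ∈ 𝓝[halfRange] u := by
  intro u hu
  rw [overlap_eq_source] at hu ⊢
  exact (𝓡∂ 3).extendCoordChange_source_mem_nhdsWithin hu

theorem mapsTo_trans (c c' : Chart) : MapsTo (trans c c') (overlap c c') (overlap c' c) := by
  intro u hu
  refine ⟨crd_mem hu.2, ?_⟩
  rw [trans, inv_crd hu.2]
  exact inv_mem hu.1

theorem inv_trans {c c' : Chart} {u : E3} (hu : u ∈ overlap c c') :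
    inv c' (trans c c' u) = inv c u := inv_crd hu.2

theorem trans_trans {c c' : Chart} {u : E3} (hu : u ∈ overlap c c') :
    trans c' c (trans c c' u) = u := by
  rw [trans, inv_trans hu, crd_inv hu.1]

theorem jac_eq_jacE (c c' : Chart) (p : S) :
    jac c.1 c'.1 p = jacE halfRange (trans c c') (crd c p) := rfl

theorem isSForm_of_gsmooth {f : SForm N S}
    (h1 : ∀ c c' : Chart, ∀ p ∈ c.1.source ∩ c'.1.source,
      f c p = substTheta (jac c.1 c'.1 p) (f c' p))
    (h2 : ∀ c, GSmooth (tgt c) (loc f c)) : IsSForm f :=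
  ⟨h1, fun c => (gsmooth_iff _).1 (h2 c)⟩

variable {f g : SForm N S}

theorem IsSForm.gsmooth (hf : IsSForm f) (c : Chart) : GSmooth (tgt c) (loc f c) :=
  (gsmooth_iff _).2 (hf.smooth c)

theorem IsSForm.gdiff (hf : IsSForm f) {c : Chart} {u : E3} (hu : u ∈ tgt c) :
    GDiff halfRange (loc f c) u :=
  (hf.gsmooth c).gdiff (tgt_mem_nhdsWithin c u hu) (tgt_subset c hu)

theorem IsSForm.loc_eq (hf : IsSForm f) {c c' : Chart} {u : E3} (hu : u ∈ overlap c c') :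
    loc f c u = substTheta (jacE halfRange (trans c c') u) (loc f c' (trans c c' u)) := by
  rw [loc, hf.compat c c' (inv c u) ⟨inv_mem hu.1, hu.2⟩, jac_eq_jacE, crd_inv hu.1, loc,
    inv_trans hu]

/-- Agreement of two families of expressions on the domains of the charts. -/
def SEq (f g : SForm N S) : Prop := ∀ c : Chart, ∀ p ∈ c.1.source, f c p = g c p

theorem SEq.loc_eqOn (h : SEq f g) (c : Chart) : EqOn (loc f c) (loc g c) (tgt c) :=
  fun _ hu => h c _ (inv_mem hu)

theorem SEq.deRham (h : SEq f g) : SEq (deRham f) (deRham g) := by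
  intro c p hp
  rw [deRham_eq_locD, deRham_eq_locD]
  exact locD_congr (tgt_subset c (crd_mem hp))
    (Filter.mem_of_superset (tgt_mem_nhdsWithin c _ (crd_mem hp)) (h.loc_eqOn c))

theorem IsSForm.add (hf : IsSForm f) (hg : IsSForm g) : IsSForm (f + g) :=
  isSForm_of_gsmooth
    (fun c c' p hp => by
      simp only [Pi.add_apply, map_add, hf.compat c c' p hp, hg.compat c c' p hp])
    fun c => (hf.gsmooth c).add (hg.gsmooth c)

theorem IsSForm.mul (hf : IsSForm f) (hg : IsSForm g) : IsSForm (f * g) :=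
  isSForm_of_gsmooth
    (fun c c' p hp => by
      simp only [Pi.mul_apply, map_mul, hf.compat c c' p hp, hg.compat c c' p hp])
    fun c => (hf.gsmooth c).mul (hg.gsmooth c)

theorem IsSForm.smul (a : ℂ) (hf : IsSForm f) : IsSForm (a • f) :=
  isSForm_of_gsmooth
    (fun c c' p hp => by
      simp only [Pi.smul_apply, map_smul, hf.compat c c' p hp])
    fun c => (hf.gsmooth c).map (LinearMap.lsmul ℂ (Grass N) a)

theorem IsSForm.neg (hf : IsSForm f) : IsSForm (-f) := by
  rw [← neg_one_smul ℂ f]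
  exact hf.smul _

theorem isSForm_constForm {a : Grass N} (ha : IsConst a) : IsSForm (constForm (S := S) a) :=
  isSForm_of_gsmooth (fun _ _ _ _ => (ha.substTheta_eq _).symm) fun _ => gsmooth_const a

theorem isConst_zero : IsConst (0 : Grass N) := fun _ => map_zero _

theorem isSForm_zero : IsSForm (0 : SForm N S) := isSForm_constForm isConst_zero

theorem isSForm_sum {ι : Type*} (A : Finset ι) {f : ι → SForm N S} (h : ∀ i ∈ A, IsSForm (f i)) :
    IsSForm (∑ i ∈ A, f i) := by
  classical
  induction A using Finset.induction_on with
  | empty => exact isSForm_zero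
  | insert i A hi ih =>
    rw [Finset.sum_insert hi]
    exact (h i (Finset.mem_insert_self _ _)).add
      (ih fun j hj => h j (Finset.mem_insert_of_mem hj))

/-- A scalar function as a form. -/
def funForm (a : S → ℂ) : SForm N S := fun _ p => algebraMap ℂ (Grass N) (a p)

theorem isSForm_funForm {a : S → ℂ} (ha : ∀ c : Chart, ContDiffOn ℝ ∞ (fun u => a (inv c u)) (tgt c)) :
    IsSForm (funForm (N := N) a) :=
  isSForm_of_gsmooth (fun _ _ _ _ => ((substTheta _).commutes _).symm) fun c =>
    (gsmooth_scalar (ha c)).map (Algebra.linearMap ℂ (Grass N))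

section Smooth

variable [IsManifold (𝓡∂ 3) ∞ S]

theorem chart_mem_maximalAtlas (c : Chart) : c.1 ∈ IsManifold.maximalAtlas (𝓡∂ 3) ∞ S :=
  IsManifold.subset_maximalAtlas c.2

theorem contDiffOn_trans (c c' : Chart) : ContDiffOn ℝ ∞ (trans c c') (overlap c c') := by
  rw [overlap_eq_source]
  exact (𝓡∂ 3).contDiffOn_extendCoordChange (chart_mem_maximalAtlas c) (chart_mem_maximalAtlas c')

theorem IsSForm.deRham (hf : IsSForm f) : IsSForm (deRham f) := by
  refine isSForm_of_gsmooth (fun c c' p hp => ?_) fun c => ?_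
  · have hu : crd c p ∈ overlap c c' := ⟨crd_mem hp.1, by rw [inv_crd hp.1]; exact hp.2⟩
    have ht : trans c c' (crd c p) = crd c' p := by rw [trans, inv_crd hp.1]
    rw [deRham_eq_locD, deRham_eq_locD, jac_eq_jacE, ← ht]
    rw [← locD_pullback (overlap_mem_nhdsWithin c c')
      ((overlap_subset c c').trans (tgt_subset c)) uniqueDiffOn_halfRange halfRange_subset_closure
      (contDiffOn_trans c c') (tgt_subset c') (tgt_mem_nhdsWithin c')
      ((mapsTo_trans c c').mono_right (overlap_subset c' c)) (hf.gsmooth c') hu]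
    exact locD_congr (tgt_subset c hu.1)
      (Filter.mem_of_superset (overlap_mem_nhdsWithin c c' _ hu) fun x hx => hf.loc_eq hx)
  · exact ((hf.gsmooth c).locD (tgt_subset c) (tgt_mem_nhdsWithin c) uniqueDiffOn_halfRange).congr
      fun u hu => (loc_deRham f hu).symm

end Smooth

theorem deRham_deRham (hf : IsSForm f) : SEq (RozanskyWitten.deRham (RozanskyWitten.deRham f)) 0 := by
  intro c p hp
  rw [deRham_eq_locD, locD_congr (tgt_subset c (crd_mem hp)) (G := locD halfRange (loc f c))
    (Filter.mem_of_superset (tgt_mem_nhdsWithin c _ (crd_mem hp)) fun u hu => loc_deRham f hu)]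
  exact locD_locD (tgt_mem_nhdsWithin c) (tgt_subset c) uniqueDiffOn_halfRange
    halfRange_subset_closure (hf.gsmooth c) (crd_mem hp)

theorem deRham_mul (hf : IsSForm f) (hg : IsSForm g) {c : Chart} {p : S} (hp : p ∈ c.1.source) :
    RozanskyWitten.deRham (f * g) c p = RozanskyWitten.deRham f c p * g c p +
      parity (f c p) * RozanskyWitten.deRham g c p := by
  have h := locD_mul (tgt_subset c (crd_mem hp)) (uniqueDiffOn_halfRange _ (tgt_subset c (crd_mem hp)))
    (hf.gdiff (crd_mem hp)) (hg.gdiff (crd_mem hp))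
  rw [loc, loc, inv_crd hp] at h
  exact h

theorem deRham_add (hf : IsSForm f) (hg : IsSForm g) :
    SEq (RozanskyWitten.deRham (f + g)) (RozanskyWitten.deRham f + RozanskyWitten.deRham g) :=
  fun c _ hp => locD_add (tgt_subset c (crd_mem hp))
    (uniqueDiffOn_halfRange _ (tgt_subset c (crd_mem hp)))
    (hf.gdiff (crd_mem hp)) (hg.gdiff (crd_mem hp))

theorem deRham_smul (a : ℂ) (hf : IsSForm f) :
    SEq (RozanskyWitten.deRham (a • f)) (a • RozanskyWitten.deRham f) :=
  fun c _ hp => locD_smul (tgt_subset c (crd_mem hp))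
    (uniqueDiffOn_halfRange _ (tgt_subset c (crd_mem hp))) a (hf.gdiff (crd_mem hp))

theorem deRham_constForm (a : Grass N) : SEq (RozanskyWitten.deRham (constForm (S := S) a)) 0 :=
  fun c _ hp => locD_const (tgt_subset c (crd_mem hp))
    (uniqueDiffOn_halfRange _ (tgt_subset c (crd_mem hp))) a

theorem deRham_sum {ι : Type*} (A : Finset ι) {f : ι → SForm N S} (h : ∀ i ∈ A, IsSForm (f i)) :
    SEq (RozanskyWitten.deRham (∑ i ∈ A, f i)) (∑ i ∈ A, RozanskyWitten.deRham (f i)) := by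
  classical
  induction A using Finset.induction_on with
  | empty => exact deRham_constForm 0
  | insert i A hi ih =>
    intro c p hp
    rw [Finset.sum_insert hi, Finset.sum_insert hi, deRham_add (h i (Finset.mem_insert_self _ _))
      (isSForm_sum A fun j hj => h j (Finset.mem_insert_of_mem hj)) c p hp, Pi.add_apply,
      Pi.add_apply, ih (fun j hj => h j (Finset.mem_insert_of_mem hj)) c p hp]
    rfl

theorem parity_deRham (hf : IsSForm f) {c : Chart} {p : S} (hp : p ∈ c.1.source) :
    parity (RozanskyWitten.deRham f c p) = -RozanskyWitten.deRham (fun c p => parity (f c p)) c p := by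
  have hu := tgt_subset c (crd_mem hp)
  rw [deRham_eq_locD, deRham_eq_locD, locD, locD, map_sum, ← Finset.sum_neg_distrib]
  refine Finset.sum_congr rfl fun μ _ => ?_
  rw [map_mul, isOdd_theta, neg_mul]
  congr 2
  exact (pd_map hu (uniqueDiffOn_halfRange _ hu) (hf.gdiff (crd_mem hp)) parity.toLinearMap).symm

theorem IsEvenForm.deRham (he : IsEvenForm f) (hf : IsSForm f) :
    IsOddForm (RozanskyWitten.deRham f) := by
  intro c p hp
  rw [IsOdd, parity_deRham hf hp]
  congr 1
  exact (SEq.deRham (f := fun c p => parity (f c p)) (g := f) fun c p hp => he c p hp) c p hp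

/-! #### Power series in superfields -/

/-- Commuting nilpotents add: the sum of the exponents of the spanning elements bounds the exponent
of every linear combination. -/
theorem exists_pow_eq_zero_of_span (B : Finset (Grass N))
    (hB : ∀ b ∈ B, IsEven b ∧ IsNilpotent b) :
    ∃ K, ∀ x ∈ Submodule.span ℂ (B : Set (Grass N)), x ^ K = 0 := by
  classical
  induction B using Finset.induction_on with
  | empty => exact ⟨1, fun x hx => by simpa using hx⟩
  | insert b B hb ih =>
    obtain ⟨K, hK⟩ := ih fun x hx => hB x (Finset.mem_insert_of_mem hx)
    obtain ⟨he, m, hm⟩ := hB b (Finset.mem_insert_self _ _)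
    refine ⟨m + K, fun x hx => ?_⟩
    rw [Finset.coe_insert] at hx
    obtain ⟨r, z, hz, rfl⟩ := Submodule.mem_span_insert.1 hx
    have hc : Commute (r • b) z := (he.smul r).comm z
    refine hc.add_pow_eq_zero_of_add_le_succ_of_pow_eq_zero (m := m) (n := K) ?_ (hK z hz)
      (Nat.le_succ _)
    rw [smul_pow, hm, smul_zero]

/-- Evenness and vanishing scalar part are linear conditions, so they cut out a finite-dimensional
subspace of `V` spanned by even nilpotents. -/
theorem exists_pow_eq_zero_of_fg {V : Submodule ℂ (Grass N)} (hV : V.FG) :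
    ∃ K, ∀ x ∈ V, IsEven x → ExteriorAlgebra.algebraMapInv x = 0 → x ^ K = 0 := by
  let W : Submodule ℂ (Grass N) := V ⊓ (LinearMap.ker (parity.toLinearMap - LinearMap.id) ⊓
    LinearMap.ker (ExteriorAlgebra.algebraMapInv (R := ℂ) (M := Gen N →₀ ℂ)).toLinearMap)
  have hW : W.FG := by
    have : FiniteDimensional ℂ V := Module.Finite.iff_fg.2 hV
    exact Module.Finite.iff_fg.1 (Submodule.finiteDimensional_of_le (inf_le_left : W ≤ V))
  obtain ⟨B, hB⟩ := hW
  have hmem : ∀ x ∈ W, IsEven x ∧ ExteriorAlgebra.algebraMapInv x = 0 := fun x hx =>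
    ⟨sub_eq_zero.1 hx.2.1, hx.2.2⟩
  obtain ⟨K, hK⟩ := exists_pow_eq_zero_of_span B fun b hb => by
    obtain ⟨h1, h2⟩ := hmem b (hB ▸ Submodule.subset_span hb)
    exact ⟨h1, h1.isNilpotent h2⟩
  exact ⟨K, fun x hx h1 h2 => hK x (hB ▸ ⟨hx, sub_eq_zero.2 h1, h2⟩)⟩

variable [CompactSpace S]

/-- Superfields are uniformly nilpotent. -/
theorem IsSuperfield.exists_isNilTuple {X : SField N S} (hX : IsSuperfield X) :
    ∃ K, ∀ c : Chart, ∀ p ∈ c.1.source, IsNilTuple K (fun i => X i c p) := by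
  have h1 : ∀ (c : Chart) i, ∃ K, ∀ p ∈ c.1.source, X i c p ^ K = 0 := by
    intro c i
    obtain ⟨V, hV, hfV⟩ := ((hX.1 i).1.gsmooth c).fd
    obtain ⟨K, hK⟩ := exists_pow_eq_zero_of_fg hV
    refine ⟨K, fun p hp => hK _ ?_ ((hX.1 i).2 c p hp) (hX.2 i c p hp)⟩
    have := hfV _ (crd_mem hp)
    rwa [loc, inv_crd hp] at this
  choose K hK using h1
  -- The exponent obtained so far depends on the chart. Finitely many preferred charts cover the
  -- source, and the change of chart is an algebra homomorphism, so their exponents serve for every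
  -- chart.
  obtain ⟨T, hT⟩ := CompactSpace.elim_nhds_subcover (fun q : S => (chartAt (EuclideanHalfSpace 3) q).source)
    fun q => chart_source_mem_nhds _ q
  refine ⟨∑ q ∈ T, ∑ i, K (chartIn q) i, fun c p hp => ⟨fun i b => ((hX.1 i).2 c p hp).comm b, ?_⟩⟩
  intro i
  have hpT : p ∈ ⋃ q ∈ T, (chartAt (EuclideanHalfSpace 3) q).source := hT ▸ mem_univ p
  obtain ⟨q, hq, hpq⟩ := mem_iUnion₂.1 hpT
  rw [(hX.1 i).1.compat c (chartIn q) p ⟨hp, hpq⟩, ← map_pow]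
  have hle : K (chartIn q) i ≤ ∑ q ∈ T, ∑ i, K (chartIn q) i :=
    (Finset.single_le_sum (f := fun i => K (chartIn q) i) (fun _ _ => Nat.zero_le _)
      (Finset.mem_univ i)).trans
    (Finset.single_le_sum (f := fun q => ∑ i, K (chartIn q) i) (fun _ _ => Nat.zero_le _) hq)
  rw [pow_eq_zero_of_le hle (hK (chartIn q) i p hpq), map_zero]

theorem IsSuperfield.isSForm_evalField {X : SField N S} (hX : IsSuperfield X)
    (h : MvPowerSeries (Fin N) ℂ) : IsSForm (evalField h X) := by
  obtain ⟨K, hK⟩ := hX.exists_isNilTuple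
  refine isSForm_of_gsmooth (fun c c' p hp => ?_) fun c => ?_
  · rw [evalField, evalField, (hK c' p hp.2).map]
    congr 1
    ext i
    exact (hX.1 i).1.compat c c' p hp
  · exact gsmooth_evalSeries (X := fun u i => loc (X i) c u) (fun u hu => hK c _ (inv_mem hu))
      (fun i => (hX.1 i).1.gsmooth c) h

theorem IsSuperfield.isEvenForm_evalField {X : SField N S} (hX : IsSuperfield X)
    (h : MvPowerSeries (Fin N) ℂ) : IsEvenForm (evalField h X) := by
  obtain ⟨K, hK⟩ := hX.exists_isNilTuple
  exact fun c p hp => (hK c p hp).isEven_evalSeries (fun i => (hX.1 i).2 c p hp) h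

/-- The chain rule for power series in superfields. -/
theorem IsSuperfield.deRham_evalField {X : SField N S} (hX : IsSuperfield X)
    (h : MvPowerSeries (Fin N) ℂ) :
    SEq (deRham (evalField h X))
      (∑ l, evalField (MvPowerSeries.pderiv ℂ l h) X * deRham (X l)) := by
  obtain ⟨K, hK⟩ := hX.exists_isNilTuple
  intro c p hp
  have hu := tgt_subset c (crd_mem hp)
  have hev : ∀ g : MvPowerSeries (Fin N) ℂ, IsEven (evalSeries g fun i => X i c p) := fun g =>
    hX.isEvenForm_evalField g c p hp
  have hch : ∀ v, pd halfRange v (loc (evalField h X) c) (crd c p) =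
      ∑ l, evalSeries (MvPowerSeries.pderiv ℂ l h) (fun i => X i c p) *
        pd halfRange v (loc (X l) c) (crd c p) := by
    intro v
    have h1 := pd_evalSeries (v := v) (X := fun u i => loc (X i) c u) hu
      (uniqueDiffOn_halfRange _ hu) (K := K)
      (Filter.mem_of_superset (tgt_mem_nhdsWithin c _ (crd_mem hp))
        fun u hu => hK c _ (inv_mem hu)) (fun i => (hX.1 i).1.gdiff (crd_mem hp)) h
    simp only [loc, inv_crd hp] at h1
    exact h1
  simp only [Finset.sum_apply, Pi.mul_apply, deRham_eq_locD, locD, hch, Finset.mul_sum]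
  rw [Finset.sum_comm]
  refine Finset.sum_congr rfl fun l _ => Finset.sum_congr rfl fun μ _ => ?_
  rw [← mul_assoc, ← mul_assoc]
  congr 1
  exact ((hev _).comm _).symm

end Forms

end RozanskyWitten
end

noncomputable section

namespace RozanskyWitten

open Filter Topology MeasureTheory

variable {N : ℕ}

/-! ### Coefficientwise integrals -/

section CoefficientIntegral

variable {α : Type*} [MeasureSpace α] {W W₂ : Type*} [AddCommGroup W] [Module ℂ W]
  [AddCommGroup W₂] [Module ℂ W₂] {s : Set α} {F G : α → W}

/-- The coefficientwise integral. -/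
def intC (s : Set α) (F : α → W) : W := coefwise (fun g : α → ℂ => ∫ u in s, g u) F

/-- Integrable functions with values in a finite-dimensional subspace. -/
structure GInt (s : Set α) (F : α → W) : Prop where
  fd : ∃ V : Submodule ℂ W, V.FG ∧ ∀ x ∈ s, F x ∈ V
  integrable : ∀ ℓ : Module.Dual ℂ W, IntegrableOn (fun x => ℓ (F x)) s

theorem intC_congr (hs : MeasurableSet s) (h : EqOn F G s) : intC s F = intC s G := by
  unfold intC coefwise
  refine finsum_congr fun b => ?_
  congr 1
  exact setIntegral_congr_fun hs fun x hx => by simp only [h hx]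

theorem intC_zero : intC s (fun _ => (0 : W)) = 0 := by
  unfold intC coefwise
  simp

theorem GInt.dual_intC (hs : MeasurableSet s) (hF : GInt s F) (ℓ : Module.Dual ℂ W) :
    ℓ (intC s F) = ∫ u in s, ℓ (F u) := by
  obtain ⟨V, hV, hFV⟩ := hF.fd
  let Λ : Module.Dual ℂ W →ₗ[ℂ] ℂ :=
    { toFun := fun ℓ => ∫ u in s, ℓ (F u)
      map_add' := fun ℓ ℓ' => integral_add (hF.integrable ℓ) (hF.integrable ℓ')
      map_smul' := fun c ℓ => integral_const_mul c _ }
  exact dual_coefwise hV hFV (L := fun g : α → ℂ => ∫ u in s, g u)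
    (fun g g' h => setIntegral_congr_fun hs h) Λ (fun _ => rfl) ℓ

theorem GInt.add (hF : GInt s F) (hG : GInt s G) : GInt s (fun x => F x + G x) := by
  obtain ⟨V, hV, hFV⟩ := hF.fd
  obtain ⟨V', hV', hGV⟩ := hG.fd
  refine ⟨⟨V ⊔ V', hV.sup hV', fun x hx => Submodule.add_mem_sup (hFV x hx) (hGV x hx)⟩,
    fun ℓ => ?_⟩
  simp only [map_add]
  exact (hF.integrable ℓ).add (hG.integrable ℓ)

theorem intC_add (hs : MeasurableSet s) (hF : GInt s F) (hG : GInt s G) :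
    intC s (fun x => F x + G x) = intC s F + intC s G := by
  refine eq_of_forall_dual fun ℓ => ?_
  rw [(hF.add hG).dual_intC hs, map_add, hF.dual_intC hs, hG.dual_intC hs]
  simp only [map_add]
  exact integral_add (hF.integrable ℓ) (hG.integrable ℓ)

theorem GInt.map (hF : GInt s F) (T : W →ₗ[ℂ] W₂) : GInt s (fun x => T (F x)) := by
  obtain ⟨V, hV, hFV⟩ := hF.fd
  exact ⟨⟨V.map T, hV.map T, fun x hx => Submodule.mem_map_of_mem (hFV x hx)⟩,
    fun ℓ => hF.integrable (ℓ ∘ₗ T)⟩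

theorem intC_map (hs : MeasurableSet s) (hF : GInt s F) (T : W →ₗ[ℂ] W₂) :
    intC s (fun x => T (F x)) = T (intC s F) := by
  refine eq_of_forall_dual fun ℓ => ?_
  rw [(hF.map T).dual_intC hs]
  exact (hF.dual_intC hs (ℓ ∘ₗ T)).symm

end CoefficientIntegral

theorem gint_of_gsmooth {W : Type*} [AddCommGroup W] [Module ℂ W] {s K : Set E3} {F : E3 → W}
    (hs : MeasurableSet s) (hK : IsCompact K) (hKs : K ⊆ s) (hF : GSmooth s F)
    (h0 : ∀ u ∈ s, u ∉ K → F u = 0) : GInt s F := by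
  refine ⟨hF.fd, fun ℓ => ?_⟩
  have h1 : IntegrableOn (fun x => ℓ (F x)) K :=
    ((hF.smooth ℓ).continuousOn.mono hKs).integrableOn_compact hK
  refine h1.of_forall_sdiff_eq_zero hs fun x hx => ?_
  rw [h0 x hx.1 hx.2, map_zero]

/-- A relatively open subset is the intersection of `R` with an open set. -/
theorem measurableSet_of_mem_nhdsWithin {R s : Set E3} (hR : MeasurableSet R) (hsR : s ⊆ R)
    (hs : ∀ x ∈ s, s ∈ 𝓝[R] x) : MeasurableSet s := by
  have : s = R ∩ interior (s ∪ Rᶜ) := by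
    refine Subset.antisymm (fun x hx => ⟨hsR hx, ?_⟩) fun x hx => ?_
    · rw [mem_interior_iff_mem_nhds]
      filter_upwards [mem_nhdsWithin_iff_eventually.1 (hs x hx)] with y hy
      by_cases hyR : y ∈ R
      · exact Or.inl (hy hyR)
      · exact Or.inr hyR
    · exact (interior_subset hx.2).resolve_right fun h => h hx.1
  rw [this]
  exact hR.inter isOpen_interior.measurableSet

theorem measurableSet_halfRange : MeasurableSet halfRange := (𝓡∂ 3).isClosed_range.measurableSet

section Forms

variable {S : Type*} [TopologicalSpace S] [ChartedSpace (EuclideanHalfSpace 3) S]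

local notation "Chart" => atlas (EuclideanHalfSpace 3) S

theorem measurableSet_tgt (c : Chart) : MeasurableSet (tgt c) :=
  measurableSet_of_mem_nhdsWithin measurableSet_halfRange (tgt_subset c) (tgt_mem_nhdsWithin c)

theorem measurableSet_overlap (c c' : Chart) : MeasurableSet (overlap c c') :=
  measurableSet_of_mem_nhdsWithin measurableSet_halfRange
    ((overlap_subset c c').trans (tgt_subset c)) (overlap_mem_nhdsWithin c c')

variable {f g : SForm N S} {K : Set S}

/-- The form vanishes outside `K`. -/
def SuppIn (f : SForm N S) (K : Set S) : Prop :=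
  ∀ c : Chart, ∀ p ∈ c.1.source, p ∉ K → f c p = 0

theorem SuppIn.add (hf : SuppIn f K) (hg : SuppIn g K) : SuppIn (f + g) K := by
  intro c p hp hK
  rw [Pi.add_apply, Pi.add_apply, hf c p hp hK, hg c p hp hK, add_zero]

theorem SuppIn.mul_left (hf : SuppIn f K) (g : SForm N S) : SuppIn (g * f) K := by
  intro c p hp hK
  rw [Pi.mul_apply, Pi.mul_apply, hf c p hp hK, mul_zero]

theorem SuppIn.mul_right (hf : SuppIn f K) (g : SForm N S) : SuppIn (f * g) K := by
  intro c p hp hK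
  rw [Pi.mul_apply, Pi.mul_apply, hf c p hp hK, zero_mul]

theorem SuppIn.smul (hf : SuppIn f K) (a : ℂ) : SuppIn (a • f) K := by
  intro c p hp hK
  rw [Pi.smul_apply, Pi.smul_apply, hf c p hp hK, smul_zero]

theorem SuppIn.deRham (hK : IsClosed K) (hf : SuppIn f K) : SuppIn (deRham f) K := by
  intro c p hp hpK
  have hu := crd_mem hp
  rw [deRham_eq_locD, locD_congr (tgt_subset c hu) (G := fun _ => 0),
    locD_const (tgt_subset c hu) (uniqueDiffOn_halfRange _ (tgt_subset c hu))]
  have hcont : ContinuousWithinAt (inv c) halfRange (crd c p) :=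
    ((c.1.continuousOn_extend_symm (I := 𝓡∂ 3)) _ hu).mono_of_mem_nhdsWithin
      (tgt_mem_nhdsWithin c _ hu)
  have h1 : ∀ᶠ u in 𝓝[halfRange] (crd c p), inv c u ∈ Kᶜ :=
    hcont (hK.isOpen_compl.mem_nhds (by rwa [inv_crd hp]))
  filter_upwards [h1, tgt_mem_nhdsWithin c _ hu] with u h1 h2
  exact hf c _ (inv_mem h2) h1

theorem isCompact_crd_image [CompactSpace S] (c : Chart) (hK : IsClosed K) (hKc : K ⊆ c.1.source) :
    IsCompact (crd c '' K) :=
  hK.isCompact.image_of_continuousOn (c.1.continuousOn_extend.mono (by rwa [c.1.extend_source]))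

theorem crd_image_subset (c : Chart) (hKc : K ⊆ c.1.source) : crd c '' K ⊆ tgt c := by
  rintro _ ⟨p, hp, rfl⟩
  exact crd_mem (hKc hp)

theorem SuppIn.loc_eq_zero (hf : SuppIn f K) {c : Chart} {u : E3} (hu : u ∈ tgt c)
    (hK : u ∉ crd c '' K) : loc f c u = 0 :=
  hf c _ (inv_mem hu) fun h => hK ⟨_, h, crd_inv hu⟩

theorem gint_loc [CompactSpace S] (hf : IsSForm f) {c : Chart} (hK : IsClosed K) (hKc : K ⊆ c.1.source)
    (hfK : SuppIn f K) : GInt (tgt c) (loc f c) :=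
  gint_of_gsmooth (measurableSet_tgt c) (isCompact_crd_image c hK hKc) (crd_image_subset c hKc)
    (hf.gsmooth c) fun _ hu h => hfK.loc_eq_zero hu h

/-- The integral of a form over the domain of a chart. -/
def chartInt (c : Chart) (f : SForm N S) : Grass N := intC (tgt c) fun u => berezin (loc f c u)

theorem chartInt_congr {c : Chart} (h : SEq f g) : chartInt c f = chartInt c g :=
  intC_congr (measurableSet_tgt c) fun u hu => by
    rw [h.loc_eqOn c hu]

theorem chartInt_eq_zero {c : Chart} (h : SEq f 0) : chartInt c f = 0 := by
  rw [chartInt_congr h]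
  unfold chartInt loc
  simp only [Pi.zero_apply, berezin, map_zero]
  exact intC_zero

section Compact

variable [CompactSpace S]

theorem chartInt_eq {c : Chart} (hf : IsSForm f) (hK : IsClosed K) (hKc : K ⊆ c.1.source)
    (hfK : SuppIn f K) : chartInt c f = berezin (intC (tgt c) (loc f c)) := by
  exact intC_map (measurableSet_tgt c) (gint_loc hf hK hKc hfK) (berezinL (N := N))

theorem chartInt_add {c : Chart} (hf : IsSForm f) (hg : IsSForm g) (hK : IsClosed K)
    (hKc : K ⊆ c.1.source) (hfK : SuppIn f K) (hgK : SuppIn g K) :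
    chartInt c (f + g) = chartInt c f + chartInt c g := by
  rw [chartInt_eq (hf.add hg) hK hKc (hfK.add hgK), chartInt_eq hf hK hKc hfK,
    chartInt_eq hg hK hKc hgK, ← berezinL_apply, ← berezinL_apply, ← berezinL_apply, ← map_add]
  congr 1
  exact intC_add (measurableSet_tgt c) (gint_loc hf hK hKc hfK) (gint_loc hg hK hKc hgK)

theorem chartInt_sum {ι : Type*} (A : Finset ι) {c : Chart} {f : ι → SForm N S}
    (hf : ∀ i ∈ A, IsSForm (f i)) (hK : IsClosed K) (hKc : K ⊆ c.1.source)
    (hfK : ∀ i ∈ A, SuppIn (f i) K) :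
    chartInt c (∑ i ∈ A, f i) = ∑ i ∈ A, chartInt c (f i) := by
  classical
  have hsupp : ∀ B : Finset ι, (∀ i ∈ B, SuppIn (f i) K) → SuppIn (∑ i ∈ B, f i) K := by
    intro B hB c p hp hpK
    rw [Finset.sum_apply, Finset.sum_apply]
    exact Finset.sum_eq_zero fun i hi => hB i hi c p hp hpK
  induction A using Finset.induction_on with
  | empty => exact chartInt_eq_zero fun _ _ _ => rfl
  | insert i A hi ih =>
    have h1 := fun j hj => hf j (Finset.mem_insert_of_mem (a := j) (b := i) hj)
    have h2 := fun j hj => hfK j (Finset.mem_insert_of_mem (a := j) (b := i) hj)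
    rw [Finset.sum_insert hi, Finset.sum_insert hi,
      chartInt_add (hf i (Finset.mem_insert_self _ _)) (isSForm_sum A h1) hK hKc
        (hfK i (Finset.mem_insert_self _ _)) (hsupp A h2), ih h1 h2]

theorem chartInt_smul {c : Chart} (a : ℂ) (hf : IsSForm f) (hK : IsClosed K)
    (hKc : K ⊆ c.1.source) (hfK : SuppIn f K) : chartInt c (a • f) = a • chartInt c f := by
  rw [chartInt_eq (hf.smul a) hK hKc (hfK.smul a), chartInt_eq hf hK hKc hfK, ← berezinL_apply,
    ← berezinL_apply, ← map_smul]
  congr 1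
  exact intC_map (measurableSet_tgt c) (gint_loc hf hK hKc hfK) (LinearMap.lsmul ℂ (Grass N) a)

theorem chartInt_mul_const {c : Chart} {a : Grass N} (ha : IsConst a) (hf : IsSForm f)
    (hK : IsClosed K) (hKc : K ⊆ c.1.source) (hfK : SuppIn f K) :
    chartInt c (f * constForm a) = chartInt c f * a := by
  rw [chartInt_eq (hf.mul (isSForm_constForm ha)) hK hKc (hfK.mul_right _),
    chartInt_eq hf hK hKc hfK, ← berezin_mul_const _ ha]
  congr 1
  exact intC_map (measurableSet_tgt c) (gint_loc hf hK hKc hfK) (LinearMap.mulRight ℂ a)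

theorem parity_chartInt {c : Chart} (hf : IsSForm f) (hK : IsClosed K)
    (hKc : K ⊆ c.1.source) (hfK : SuppIn f K) :
    parity (chartInt c f) = -chartInt c (fun c p => parity (f c p)) := by
  have h1 := intC_map (measurableSet_tgt c) (gint_loc hf hK hKc hfK)
    (berezinL (N := N) ∘ₗ (parity (N := N)).toLinearMap)
  simp only [LinearMap.comp_apply, berezinL_apply, AlgHom.toLinearMap_apply] at h1
  rw [chartInt_eq hf hK hKc hfK, parity_berezin, chartInt]
  exact congrArg Neg.neg h1.symm

/-- Invariance of the integral under changes of charts. -/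
theorem chartInt_eq_chartInt [IsManifold (𝓡∂ 3) ∞ S] (hS : IsOriented S) {c c' : Chart}
    (hf : IsSForm f) (hK : IsClosed K) (hKc : K ⊆ c.1.source) (hKc' : K ⊆ c'.1.source)
    (hfK : SuppIn f K) : chartInt c f = chartInt c' f := by
  refine eq_of_forall_dual fun ℓ => ?_
  -- The support lies in both charts, so the integral over the whole chart domain may be restricted
  -- to the overlap.
  have key : ∀ c c' : Chart, K ⊆ c.1.source → K ⊆ c'.1.source →
      ℓ (chartInt c f) = ∫ u in overlap c c', ℓ (berezin (loc f c u)) := by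
    intro c c' hKc hKc'
    have hG := (gint_loc hf hK hKc hfK).map (berezinL (N := N))
    simp only [berezinL_apply] at hG
    rw [chartInt, hG.dual_intC (measurableSet_tgt c)]
    refine setIntegral_eq_of_subset_of_forall_sdiff_eq_zero (measurableSet_tgt c)
      (overlap_subset c c') fun u hu => ?_
    have : loc f c u = 0 := hfK c _ (inv_mem hu.1) fun h => hu.2 ⟨hu.1, hKc' h⟩
    rw [this, berezin, map_zero, map_zero, map_zero, map_zero]
  rw [key c c' hKc hKc', key c' c hKc' hKc]
  have himg : trans c c' '' overlap c c' = overlap c' c := by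
    refine Subset.antisymm (mapsTo_trans c c').image_subset fun u hu => ?_
    exact ⟨trans c' c u, mapsTo_trans c' c hu, trans_trans hu⟩
  have hinj : InjOn (trans c c') (overlap c c') := fun u hu v hv h => by
    rw [← trans_trans hu, ← trans_trans hv, h]
  have hder : ∀ u ∈ overlap c c', HasFDerivWithinAt (trans c c')
      (fderivWithin ℝ (trans c c') halfRange u) (overlap c c') u := by
    intro u hu
    have hd : DifferentiableWithinAt ℝ (trans c c') halfRange u :=
      (((contDiffOn_trans c c').differentiableOn (by simp)) u hu).mono_of_mem_nhdsWithin
        (overlap_mem_nhdsWithin c c' u hu)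
    exact hd.hasFDerivWithinAt.mono ((overlap_subset c c').trans (tgt_subset c))
  rw [← himg, integral_image_eq_integral_abs_det_fderiv_smul volume (measurableSet_overlap c c')
    hder hinj]
  refine setIntegral_congr_fun (measurableSet_overlap c c') fun u hu => ?_
  have hdet : (fderivWithin ℝ (trans c c') halfRange u).det =
      (jacE halfRange (trans c c') u).det := by
    rw [ContinuousLinearMap.det, ← LinearMap.det_toMatrix (EuclideanSpace.basisFun (Fin 3) ℝ).toBasis]
    congr 1
  have hpos : 0 < (jacE halfRange (trans c c') u).det := by
    have := hS c.1 c.2 c'.1 c'.2 (inv c u) ⟨inv_mem hu.1, hu.2⟩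
    rwa [jac_eq_jacE, crd_inv hu.1] at this
  -- The Jacobian factor of the change of variables is |det J|, that of the Berezin integral is det
  -- J; orientation makes them equal.
  rw [hdet, abs_of_pos hpos, hf.loc_eq hu, berezin_substTheta, map_smul, smul_eq_mul,
    Complex.real_smul]

end Compact

end Forms

end RozanskyWitten
end

noncomputable section

namespace RozanskyWitten

open Filter Topology MeasureTheory

variable {N : ℕ}

/-! ### The divergence theorem in the half space -/

theorem halfRange_eq : halfRange = {u : E3 | 0 ≤ u 0} := range_modelWithCornersEuclideanHalfSpace 3

theorem fderivWithin_eq_zero_of_notMem {g : E3 → ℂ} {K : Set E3} (hK : IsClosed K)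
    (h0 : ∀ u, u ∉ K → g u = 0) {u : E3} (hu : u ∉ K) : fderivWithin ℝ g halfRange u = 0 := by
  have h : g =ᶠ[𝓝[halfRange] u] fun _ => 0 :=
    mem_nhdsWithin_of_mem_nhds (Filter.mem_of_superset (hK.isOpen_compl.mem_nhds hu) h0)
  rw [h.fderivWithin_eq (h0 u hu), fderivWithin_fun_const]
  rfl

/-- The support fits in the box [0, B] × [-B, B]², and the divergence theorem on the box has five
faces off the support. Only the face u^0 = 0 contributes, with a minus sign as a lower face. -/
theorem integral_divergence_halfRange {g : Fin 3 → E3 → ℂ} {K : Set E3} (hK : IsCompact K)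
    (hg : ∀ μ, ContDiffOn ℝ ∞ (g μ) halfRange) (h0 : ∀ μ u, u ∉ K → g μ u = 0) :
    ∫ u in halfRange, ∑ μ, fderivWithin ℝ (g μ) halfRange u (e3 μ) =
      -∫ v : EuclideanSpace ℝ (Fin 2), g 0 !₂[0, v 0, v 1] := by
  obtain ⟨B, hB⟩ := hK.isBounded.subset_ball 0
  have hB0 : ∀ u ∈ K, ∀ i, |u i| < B := fun u hu i => by
    have h1 := hB hu
    rw [mem_ball_zero_iff] at h1
    exact (PiLp.norm_apply_le u i).trans_lt h1
  have hB1 : ∀ u : E3, ∀ i, B ≤ |u i| → u ∉ K := fun u i h hu => (hB0 u hu i).not_ge h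
  -- The box must satisfy a ≤ b; a negative radius is possible only when `K` is empty.
  wlog hBpos : 0 ≤ B generalizing B
  · exact this (max B 0) (hB.trans (Metric.ball_subset_ball (le_max_left _ _)))
      (fun u hu i => (hB0 u hu i).trans_le (le_max_left _ _))
      (fun u i h => hB1 u i ((le_max_left _ _).trans h)) (le_max_right _ _)
  let Φ : (Fin 3 → ℝ) → E3 := WithLp.toLp 2
  let L : (Fin 3 → ℝ) →L[ℝ] E3 := (PiLp.continuousLinearEquiv 2 ℝ (fun _ : Fin 3 => ℝ)).symm
  have hΦL : ∀ x, L x = Φ x := fun _ => rfl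
  let a : Fin 3 → ℝ := ![0, -B, -B]
  let b : Fin 3 → ℝ := ![B, B, B]
  have hb : ∀ i, b i = B := by intro i; fin_cases i <;> rfl
  have hab : a ≤ b := by
    intro i
    fin_cases i
    · exact hBpos
    · exact neg_le_self hBpos
    · exact neg_le_self hBpos
  have hIcc : ∀ x ∈ Icc a b, Φ x ∈ halfRange := fun x hx => by
    rw [halfRange_eq]
    exact hx.1 0
  have hdc : ∀ μ, ContinuousOn (fderivWithin ℝ (g μ) halfRange) halfRange := fun μ =>
    (hg μ).continuousOn_fderivWithin uniqueDiffOn_halfRange (by simp)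
  let f' : Fin 3 → (Fin 3 → ℝ) → (Fin 3 → ℝ) →L[ℝ] ℂ := fun i x =>
    (fderivWithin ℝ (g i) halfRange (Φ x)).comp L
  have hcont : ContinuousOn Φ (Icc a b) := (PiLp.continuous_toLp 2 _).continuousOn
  have he : ∀ i, L (Pi.single i 1) = e3 i := fun i => rfl
  have hdiv := integral_divergence_of_hasFDerivAt_off_countable' a b hab (fun i x => g i (Φ x)) f'
    ∅ countable_empty (fun i => (hg i).continuousOn.comp hcont hIcc)
    (fun x hx i => by
      have hx0 : 0 < x 0 := (hx.1 0 (mem_univ _)).1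
      have hmem : halfRange ∈ 𝓝 (Φ x) := by
        rw [← mem_interior_iff_mem_nhds, halfRange, interior_range_modelWithCornersEuclideanHalfSpace]
        exact hx0
      have hd : DifferentiableAt ℝ (g i) (Φ x) :=
        (((hg i).differentiableOn (by simp)) _ (mem_of_mem_nhds hmem)).differentiableAt hmem
      have h1 : HasFDerivAt (g i) (fderivWithin ℝ (g i) halfRange (L x)) (L x) := by
        rw [hΦL, fderivWithin_of_mem_nhds hmem]
        exact hd.hasFDerivAt
      exact h1.comp x L.hasFDerivAt)
    (by
      refine ContinuousOn.integrableOn_Icc ?_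
      refine continuousOn_finsetSum _ fun i _ => ?_
      exact (((hdc i).comp hcont hIcc).clm_apply continuousOn_const))
  have hlhs : ∫ x in Icc a b, ∑ i, f' i x (Pi.single i 1) =
      ∫ u in halfRange, ∑ μ, fderivWithin ℝ (g μ) halfRange u (e3 μ) := by
    rw [← (PiLp.volume_preserving_toLp (Fin 3)).setIntegral_preimage_emb
      (MeasurableEquiv.toLp 2 (Fin 3 → ℝ)).measurableEmbedding]
    refine (setIntegral_eq_of_subset_of_forall_sdiff_eq_zero
      ((PiLp.volume_preserving_toLp (Fin 3)).measurable measurableSet_halfRange) hIcc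
      fun x hx => ?_).symm
    have hxK : Φ x ∉ K := by
      by_contra hxK
      apply hx.2
      have h1 := fun i => abs_lt.1 (hB0 _ hxK i)
      have h2 : 0 ≤ x 0 := by
        have := hx.1
        rw [mem_preimage, halfRange_eq] at this
        exact this
      refine ⟨fun i => ?_, fun i => ?_⟩
      · fin_cases i
        · exact h2
        · exact (h1 1).1.le
        · exact (h1 2).1.le
      · rw [hb]
        exact (h1 i).2.le
    refine Finset.sum_eq_zero fun μ _ => ?_
    change fderivWithin ℝ (g μ) halfRange (Φ x) (e3 μ) = 0
    rw [fderivWithin_eq_zero_of_notMem hK.isClosed (h0 μ) hxK]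
    rfl
  rw [← hlhs, hdiv]
  have hfront : ∀ i : Fin 3, ∀ x : Fin 2 → ℝ, g i (Φ (Fin.insertNth i (b i) x)) = 0 := by
    intro i x
    refine h0 i _ (hB1 _ i ?_)
    change B ≤ |Fin.insertNth (α := fun _ => ℝ) i (b i) x i|
    rw [Fin.insertNth_apply_same, hb]
    exact le_abs_self B
  have hback : ∀ i : Fin 3, i ≠ 0 → ∀ x : Fin 2 → ℝ, g i (Φ (Fin.insertNth i (a i) x)) = 0 := by
    intro i hi x
    refine h0 i _ (hB1 _ i ?_)
    change B ≤ |Fin.insertNth (α := fun _ => ℝ) i (a i) x i|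
    rw [Fin.insertNth_apply_same]
    have : a i = -B := by
      fin_cases i
      · exact absurd rfl hi
      · rfl
      · rfl
    rw [this, abs_neg]
    exact le_abs_self B
  rw [Finset.sum_eq_single_of_mem 0 (Finset.mem_univ _) fun i _ hi => by
    simp only [hfront, hback i hi, integral_zero, sub_zero]]
  simp only [hfront, integral_zero, zero_sub]
  congr 1
  rw [← (PiLp.volume_preserving_toLp (Fin 2)).integral_comp
      (MeasurableEquiv.toLp 2 (Fin 2 → ℝ)).measurableEmbedding]
  have hins : ∀ x : Fin 2 → ℝ, Φ (Fin.insertNth (α := fun _ => ℝ) 0 (a 0) x) = !₂[0, x 0, x 1] := by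
    intro x
    ext i
    fin_cases i <;> rfl
  rw [setIntegral_eq_integral_of_forall_compl_eq_zero fun x hx => ?_]
  · exact integral_congr_ae (Eventually.of_forall fun x => by
      simp only
      rw [hins])
  · refine h0 0 _ fun hK' => hx ?_
    rw [hins] at hK'
    have h1 := fun i => abs_lt.1 (hB0 _ hK' i)
    refine ⟨fun i => ?_, fun i => ?_⟩
    · fin_cases i
      · exact (h1 1).1.le
      · exact (h1 2).1.le
    · change _ ≤ b _
      rw [hb]
      fin_cases i
      · exact (h1 1).2.le
      · exact (h1 2).2.le

theorem measurable_face :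
    Measurable fun v : EuclideanSpace ℝ (Fin 2) => (!₂[0, v 0, v 1] : E3) := by
  refine Continuous.measurable ((PiLp.continuous_toLp 2 _).comp (continuous_pi fun i => ?_))
  fin_cases i
  · exact continuous_const
  · exact EuclideanSpace.proj (𝕜 := ℝ) (0 : Fin 2) |>.continuous
  · exact EuclideanSpace.proj (𝕜 := ℝ) (1 : Fin 2) |>.continuous

/-- The divergence theorem for vector fields with compact support in a relatively open subset of
the half space. -/
theorem integral_divergence_of_compact_support {g : Fin 3 → E3 → ℂ} {s K : Set E3}
    (hs : ∀ x ∈ s, s ∈ 𝓝[halfRange] x) (hsR : s ⊆ halfRange) (hK : IsCompact K) (hKs : K ⊆ s)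
    (hg : ∀ μ, ContDiffOn ℝ ∞ (g μ) s) (h0 : ∀ μ, ∀ u ∈ s, u ∉ K → g μ u = 0) :
    ∫ u in s, ∑ μ, fderivWithin ℝ (g μ) halfRange u (e3 μ) =
      -∫ v in {v : EuclideanSpace ℝ (Fin 2) | !₂[0, v 0, v 1] ∈ s}, g 0 !₂[0, v 0, v 1] := by
  have hsm : MeasurableSet s := measurableSet_of_mem_nhdsWithin measurableSet_halfRange hsR hs
  have h0' : ∀ μ u, u ∉ K → s.indicator (g μ) u = 0 := by
    intro μ u hu
    by_cases h : u ∈ s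
    · rw [indicator_of_mem h, h0 μ u h hu]
    · rw [indicator_of_notMem h]
  -- Extension by zero is smooth on the half space: near points of `K` it agrees with the original
  -- function, and elsewhere it vanishes on a neighbourhood.
  have hev : ∀ μ, ∀ u ∈ s, s.indicator (g μ) =ᶠ[𝓝[halfRange] u] g μ := fun μ u hu =>
    Filter.mem_of_superset (hs u hu) fun x hx => indicator_of_mem hx _
  have hsmooth : ∀ μ, ContDiffOn ℝ ∞ (s.indicator (g μ)) halfRange := by
    intro μ u hu
    by_cases h : u ∈ K
    · exact (((hg μ) u (hKs h)).mono_of_mem_nhdsWithin (hs u (hKs h))).congr_of_eventuallyEq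
        (hev μ u (hKs h)) (indicator_of_mem (hKs h) _)
    · exact (contDiffWithinAt_const (c := (0 : ℂ))).congr_of_eventuallyEq
        (mem_nhdsWithin_of_mem_nhds (Filter.mem_of_superset (hK.isClosed.isOpen_compl.mem_nhds h)
          (h0' μ))) (h0' μ u h)
  have h := integral_divergence_halfRange hK hsmooth h0'
  rw [setIntegral_eq_of_subset_of_forall_sdiff_eq_zero measurableSet_halfRange hsR
    (fun u hu => Finset.sum_eq_zero fun μ _ => by
      rw [fderivWithin_eq_zero_of_notMem hK.isClosed (h0' μ) fun h => hu.2 (hKs h)]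
      rfl)] at h
  rw [setIntegral_congr_fun hsm (g := fun u => ∑ μ, fderivWithin ℝ (g μ) halfRange u (e3 μ))
    (fun u hu => Finset.sum_congr rfl fun μ _ => by
      rw [(hev μ u hu).fderivWithin_eq (indicator_of_mem hu _)])] at h
  rw [h]
  congr 1
  exact integral_indicator (f := fun v => g 0 !₂[0, v 0, v 1]) (measurable_face hsm)

end RozanskyWitten
end

noncomputable section

namespace RozanskyWitten

open Filter Topology MeasureTheory

variable {N : ℕ}

/-! ### Stokes' theorem -/

section Forms

variable {S : Type*} [TopologicalSpace S] [ChartedSpace (EuclideanHalfSpace 3) S]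

local notation "Chart" => atlas (EuclideanHalfSpace 3) S

variable {f g : SForm N S} {K : Set S}

/-- The part of the domain of a chart on the boundary. -/
def bdTgt (c : Chart) : Set (EuclideanSpace ℝ (Fin 2)) := {v | !₂[0, v 0, v 1] ∈ tgt c}

/-- The integral of a form over the part of the boundary in the domain of a chart. -/
def bdInt (c : Chart) (f : SForm N S) : Grass N :=
  intC (bdTgt c) fun v => berezinBoundary (killNormal (loc f c !₂[0, v 0, v 1]))

theorem measurableSet_bdTgt (c : Chart) : MeasurableSet (bdTgt c) :=
  measurable_face (measurableSet_tgt c)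

theorem continuous_face :
    Continuous fun v : EuclideanSpace ℝ (Fin 2) => (!₂[0, v 0, v 1] : E3) := by
  refine (PiLp.continuous_toLp 2 _).comp (continuous_pi fun i => ?_)
  fin_cases i
  · exact continuous_const
  · exact EuclideanSpace.proj (𝕜 := ℝ) (0 : Fin 2) |>.continuous
  · exact EuclideanSpace.proj (𝕜 := ℝ) (1 : Fin 2) |>.continuous

theorem isCompact_preimage_face {A : Set E3} (hA : IsCompact A) :
    IsCompact {v : EuclideanSpace ℝ (Fin 2) | !₂[0, v 0, v 1] ∈ A} := by
  let π : E3 → EuclideanSpace ℝ (Fin 2) := fun u => !₂[u 1, u 2]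
  have hπ : Continuous π := by
    refine (PiLp.continuous_toLp 2 _).comp (continuous_pi fun i => ?_)
    fin_cases i
    · exact EuclideanSpace.proj (𝕜 := ℝ) (1 : Fin 3) |>.continuous
    · exact EuclideanSpace.proj (𝕜 := ℝ) (2 : Fin 3) |>.continuous
  refine (hA.image hπ).of_isClosed_subset (hA.isClosed.preimage continuous_face) fun v hv => ?_
  refine ⟨_, hv, ?_⟩
  ext i
  fin_cases i <;> rfl

theorem inv_mem_boundary [IsManifold (𝓡∂ 3) ∞ S] (c : Chart) {u : E3} (hu : u ∈ tgt c) (h0 : u 0 = 0) :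
    inv c u ∈ (𝓡∂ 3).boundary S := by
  refine ((𝓡∂ 3).isBoundaryPoint_iff_of_mem_atlas (n := ∞) (by simp) c.2 (inv_mem hu)).2 ?_
  change crd c (inv c u) ∈ frontier (tgt c)
  rw [crd_inv hu]
  refine ⟨subset_closure hu, fun h => ?_⟩
  have h2 := interior_mono (tgt_subset c) h
  rw [halfRange, interior_range_modelWithCornersEuclideanHalfSpace] at h2
  exact h2.ne' h0

variable [CompactSpace S]

theorem gint_bd (hf : IsSForm f) {c : Chart} (hK : IsClosed K) (hKc : K ⊆ c.1.source)
    (hfK : SuppIn f K) : GInt (bdTgt c) fun v => loc f c !₂[0, v 0, v 1] := by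
  have hKcomp := isCompact_crd_image c hK hKc
  have hKsub := crd_image_subset c hKc
  obtain ⟨V, hV, hFV⟩ := (hf.gsmooth c).fd
  refine ⟨⟨V, hV, fun v hv => hFV _ hv⟩, fun ℓ => ?_⟩
  have h1 : ContinuousOn (fun v : EuclideanSpace ℝ (Fin 2) => ℓ (loc f c !₂[0, v 0, v 1]))
      {v | !₂[0, v 0, v 1] ∈ crd c '' K} :=
    ((hf.gsmooth c).smooth ℓ).continuousOn.comp continuous_face.continuousOn fun v hv => hKsub hv
  refine (h1.integrableOn_compact (isCompact_preimage_face hKcomp)).of_forall_sdiff_eq_zero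
    (measurableSet_bdTgt c) fun v hv => ?_
  rw [hfK.loc_eq_zero hv.1 hv.2, map_zero]

/-- Stokes' theorem in a chart. -/
theorem chartInt_deRham [IsManifold (𝓡∂ 3) ∞ S] (hf : IsSForm f) {c : Chart} (hK : IsClosed K) (hKc : K ⊆ c.1.source)
    (hfK : SuppIn f K) : chartInt c (deRham f) = -bdInt c f := by
  refine eq_of_forall_dual fun ℓ => ?_
  have hsm := hf.gsmooth c
  -- Composing with a functional and the Berezin integral turns df into the divergence of the scalar
  -- vector field with components T^μ(f). Its normal component is the boundary integrand.
  let T : Fin 3 → Grass N →ₗ[ℂ] ℂ := fun μ => ℓ ∘ₗ berezinL ∘ₗ LinearMap.mulLeft ℂ (theta μ)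
  have hT : ∀ μ a, T μ a = ℓ (berezin (theta μ * a)) := fun μ a => rfl
  have h1 := (gint_loc hf.deRham hK hKc (hfK.deRham hK)).map (berezinL (N := N))
  have hbd := (gint_bd hf hK hKc hfK).map
    (berezinL (N := N) ∘ₗ LinearMap.mulLeft ℂ (theta 0))
  have hbd' : ∀ a : Grass N, (berezinL (N := N) ∘ₗ LinearMap.mulLeft ℂ (theta 0)) a =
      berezinBoundary (killNormal a) := fun a => berezin_theta_zero_mul a
  have e1 : ℓ (chartInt c (deRham f)) = ∫ u in tgt c, ∑ μ,
      fderivWithin ℝ (fun u => T μ (loc f c u)) halfRange u (e3 μ) := by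
    rw [chartInt]
    refine (h1.dual_intC (measurableSet_tgt c) ℓ).trans ?_
    refine setIntegral_congr_fun (measurableSet_tgt c) fun u hu => ?_
    simp only [berezinL_apply]
    rw [loc_deRham f hu, locD, ← berezinL_apply, map_sum, map_sum]
    refine Finset.sum_congr rfl fun μ _ => ?_
    exact (hf.gdiff hu).dual_pd (tgt_subset c hu)
      (uniqueDiffOn_halfRange _ (tgt_subset c hu)) (T μ)
  have e2 : ℓ (bdInt c f) = ∫ v in bdTgt c, T 0 (loc f c !₂[0, v 0, v 1]) := by
    rw [bdInt]
    simp only [hbd'] at hbd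
    rw [hbd.dual_intC (measurableSet_bdTgt c)]
    simp only [hT, berezin_theta_zero_mul]
  rw [map_neg, e1, e2]
  exact integral_divergence_of_compact_support (tgt_mem_nhdsWithin c) (tgt_subset c)
    (isCompact_crd_image c hK hKc) (crd_image_subset c hKc) (fun μ => hsm.smooth (T μ))
    fun μ u hu h => by rw [hfK.loc_eq_zero hu h, map_zero]

/-! #### The global integral -/

variable [IsManifold (𝓡∂ 3) ∞ S] [T2Space S]

/-- The functions of the partition of unity. -/
def rho (q : S) : SForm N S := funForm fun p => ((chartPartition S q p : ℝ) : ℂ)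

theorem isSForm_rho (q : S) : IsSForm (rho (N := N) q) := by
  refine isSForm_funForm fun c => ?_
  have h1 : ContMDiffOn 𝓘(ℝ, E3) (𝓡∂ 3) ∞ (inv c) (tgt c) := by
    have := contMDiffOn_extend_symm (chart_mem_maximalAtlas c)
    rwa [← c.1.extend_target'] at this
  have h2 := ((chartPartition S q).contMDiff.comp_contMDiffOn h1).contDiffOn
  exact Complex.ofRealCLM.contDiff.comp_contDiffOn h2

theorem chartPartition_isSubordinate :
    (chartPartition S).IsSubordinate fun q => (chartAt (EuclideanHalfSpace 3) q).source :=
  (SmoothPartitionOfUnity.exists_isSubordinate_chartAt_source (𝓡∂ 3) S).choose_spec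

/-- The supports of the functions of the partition of unity. -/
def rhoSupp (q : S) : Set S := tsupport (chartPartition S q)

theorem isClosed_rhoSupp (q : S) : IsClosed (rhoSupp q) := isClosed_tsupport _

theorem rhoSupp_subset (q : S) : rhoSupp q ⊆ (chartIn q).1.source :=
  chartPartition_isSubordinate q

theorem suppIn_rho (q : S) : SuppIn (rho (N := N) q) (rhoSupp q) := by
  intro c p _ hp
  rw [rho, funForm, image_eq_zero_of_notMem_tsupport hp, Complex.ofReal_zero, map_zero]

theorem finite_parts (S : Type*) [TopologicalSpace S] [ChartedSpace (EuclideanHalfSpace 3) S]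
    [CompactSpace S] [IsManifold (𝓡∂ 3) ∞ S] [T2Space S] :
    {q : S | (Function.support (chartPartition S q)).Nonempty}.Finite :=
  (chartPartition S).locallyFinite.finite_nonempty_of_compact

/-- The indices of the nonzero functions of the partition of unity. -/
def parts (S : Type*) [TopologicalSpace S] [ChartedSpace (EuclideanHalfSpace 3) S]
    [CompactSpace S] [IsManifold (𝓡∂ 3) ∞ S] [T2Space S] : Finset S := (finite_parts S).toFinset

theorem chartPartition_eq_zero {q : S} (hq : q ∉ parts S) (p : S) : chartPartition S q p = 0 := by
  by_contra h
  exact hq ((finite_parts S).mem_toFinset.2 ⟨p, h⟩)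

theorem rho_eq_zero {q : S} (hq : q ∉ parts S) : rho (N := N) q = 0 := by
  funext c p
  rw [rho, funForm, chartPartition_eq_zero hq, Complex.ofReal_zero, map_zero]
  rfl

theorem sum_rho : ∑ q ∈ parts S, rho (N := N) q = 1 := by
  funext c p
  have h := (chartPartition S).sum_eq_one (mem_univ p)
  rw [finsum_eq_sum_of_support_subset (s := parts S) _ fun q hq => by
    by_contra hn
    exact hq (chartPartition_eq_zero hn p)] at h
  simp only [Finset.sum_apply, rho, funForm]
  rw [← map_sum, ← Complex.ofReal_sum, h]
  simp

/-- Compactness leaves finitely many nonzero members of the partition of unity, so the global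
integral is a finite sum of chart integrals with compact supports. -/
theorem integral_eq_sum (f : SForm N S) :
    integral f = ∑ q ∈ parts S, chartInt (chartIn q) (rho q * f) := by
  have h : ∀ q : S, coefwise
      (fun g : EuclideanSpace ℝ (Fin 3) → ℂ => ∫ u in (extChartAt (𝓡∂ 3) q).target, g u)
      (fun u => ((chartPartition S q ((extChartAt (𝓡∂ 3) q).symm u) : ℝ) : ℂ) •
        berezin (f (chartIn q) ((extChartAt (𝓡∂ 3) q).symm u))) =
      chartInt (chartIn q) (rho q * f) := by
    intro q
    have : ∀ u, ((chartPartition S q ((extChartAt (𝓡∂ 3) q).symm u) : ℝ) : ℂ) •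
        berezin (f (chartIn q) ((extChartAt (𝓡∂ 3) q).symm u)) =
        berezin (loc (rho q * f) (chartIn q) u) := by
      intro u
      rw [← berezinL_apply, ← berezinL_apply, ← map_smul]
      congr 1
    simp only [this]
    rfl
  rw [integral]
  simp only [h]
  refine finsum_eq_sum_of_support_subset _ fun q hq => ?_
  by_contra hn
  refine hq (chartInt_eq_zero fun c p hp => ?_)
  rw [rho_eq_zero hn, zero_mul]

theorem berezinBoundary_killNormal_smul (r : ℂ) (a : Grass N) :
    berezinBoundary (killNormal (algebraMap ℂ (Grass N) r * a)) =
      r • berezinBoundary (killNormal a) := by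
  rw [← Algebra.smul_def, map_smul, berezinBoundary, map_smul, map_smul, berezinBoundary]

theorem boundaryIntegral_eq_sum (f : SForm N S) :
    boundaryIntegral (toBoundary f) = ∑ q ∈ parts S, bdInt (chartIn q) (rho q * f) := by
  classical
  rw [boundaryIntegral]
  have h : ∀ q : S, coefwise
      (fun g : EuclideanSpace ℝ (Fin 2) → ℂ =>
        ∫ v in {v : EuclideanSpace ℝ (Fin 2) | !₂[0, v 0, v 1] ∈ (extChartAt (𝓡∂ 3) q).target}, g v)
      (fun v => ((chartPartition S q ((extChartAt (𝓡∂ 3) q).symm !₂[0, v 0, v 1]) : ℝ) : ℂ) •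
        berezinBoundary
          (if h : (extChartAt (𝓡∂ 3) q).symm !₂[0, v 0, v 1] ∈ (𝓡∂ 3).boundary S then
            toBoundary f (chartIn q) ⟨_, h⟩ else 0)) = bdInt (chartIn q) (rho q * f) := by
    intro q
    refine intC_congr (measurableSet_bdTgt (chartIn q)) fun v hv => ?_
    have hmem : (extChartAt (𝓡∂ 3) q).symm !₂[0, v 0, v 1] ∈ (𝓡∂ 3).boundary S :=
      inv_mem_boundary (chartIn q) hv rfl
    simp only
    rw [dif_pos hmem]
    exact (berezinBoundary_killNormal_smul _ _).symm
  simp only [h]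
  refine finsum_eq_sum_of_support_subset _ fun q hq => ?_
  by_contra hn
  refine hq ?_
  change bdInt (chartIn q) (rho q * f) = 0
  rw [rho_eq_zero hn, zero_mul]
  unfold bdInt loc
  simp only [Pi.zero_apply, berezinBoundary, map_zero]
  exact intC_zero

theorem boundaryIntegral_of_boundary_eq_empty (h : (𝓡∂ 3).boundary S = ∅) (f : BForm N S) :
    boundaryIntegral f = 0 := by
  rw [boundaryIntegral]
  simp only [h, mem_empty_iff_false, dite_false, berezinBoundary, map_zero, smul_zero]
  refine finsum_eq_zero_of_forall_eq_zero fun q => ?_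
  exact intC_zero

theorem suppIn_rho_mul (q : S) (f : SForm N S) : SuppIn (rho q * f) (rhoSupp q) :=
  (suppIn_rho q).mul_right f

theorem integral_congr (h : SEq f g) : integral f = integral g := by
  rw [integral_eq_sum, integral_eq_sum]
  refine Finset.sum_congr rfl fun q _ => chartInt_congr fun c p hp => ?_
  rw [Pi.mul_apply, Pi.mul_apply, Pi.mul_apply, Pi.mul_apply, h c p hp]

theorem integral_zero : integral (0 : SForm N S) = 0 := by
  rw [integral_eq_sum]
  exact Finset.sum_eq_zero fun q _ => chartInt_eq_zero fun c p hp => by rw [mul_zero]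

theorem integral_add (hf : IsSForm f) (hg : IsSForm g) :
    integral (f + g) = integral f + integral g := by
  simp only [integral_eq_sum, mul_add, ← Finset.sum_add_distrib]
  exact Finset.sum_congr rfl fun q _ => chartInt_add ((isSForm_rho q).mul hf)
    ((isSForm_rho q).mul hg) (isClosed_rhoSupp q) (rhoSupp_subset q) (suppIn_rho_mul q f)
    (suppIn_rho_mul q g)

theorem integral_smul (a : ℂ) (hf : IsSForm f) : integral (a • f) = a • integral f := by
  simp only [integral_eq_sum, mul_smul_comm, Finset.smul_sum]
  exact Finset.sum_congr rfl fun q _ => chartInt_smul a ((isSForm_rho q).mul hf)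
    (isClosed_rhoSupp q) (rhoSupp_subset q) (suppIn_rho_mul q f)

theorem integral_neg (hf : IsSForm f) : integral (-f) = -integral f := by
  rw [← neg_one_smul ℂ f, integral_smul _ hf, neg_one_smul]

theorem integral_sum {ι : Type*} (A : Finset ι) {f : ι → SForm N S} (h : ∀ i ∈ A, IsSForm (f i)) :
    integral (∑ i ∈ A, f i) = ∑ i ∈ A, integral (f i) := by
  classical
  induction A using Finset.induction_on with
  | empty => exact integral_zero
  | insert i A hi ih =>
    have h1 := fun j hj => h j (Finset.mem_insert_of_mem (a := j) (b := i) hj)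
    rw [Finset.sum_insert hi, Finset.sum_insert hi,
      integral_add (h i (Finset.mem_insert_self _ _)) (isSForm_sum A h1), ih h1]

/-- Integration is linear over constant coefficients on the right. -/
theorem integral_mul_constForm {a : Grass N} (ha : IsConst a) (hf : IsSForm f) :
    integral (f * constForm a) = integral f * a := by
  simp only [integral_eq_sum, ← mul_assoc, Finset.sum_mul]
  exact Finset.sum_congr rfl fun q _ => chartInt_mul_const ha ((isSForm_rho q).mul hf)
    (isClosed_rhoSupp q) (rhoSupp_subset q) (suppIn_rho_mul q f)

theorem parity_integral (hf : IsSForm f) :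
    parity (integral f) = -integral (fun c p => parity (f c p)) := by
  simp only [integral_eq_sum, map_sum, ← Finset.sum_neg_distrib]
  refine Finset.sum_congr rfl fun q _ => ?_
  rw [parity_chartInt ((isSForm_rho q).mul hf) (isClosed_rhoSupp q) (rhoSupp_subset q)
    (suppIn_rho_mul q f)]
  congr 2
  funext c p
  change parity (algebraMap ℂ (Grass N) _ * _) = algebraMap ℂ (Grass N) _ * _
  rw [map_mul, AlgHom.commutes]

/-- A constant has no top-degree part in θ. This is what removes the integration constants of the
formal Hamiltonians. -/
theorem integral_constForm (a : Grass N) (ha : IsConst a) :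
    integral (constForm (S := S) a) = 0 := by
  rw [integral_eq_sum]
  refine Finset.sum_eq_zero fun q _ => ?_
  unfold chartInt
  have : ∀ u, berezin (loc (rho q * constForm a) (chartIn q) u) = 0 := by
    intro u
    change berezin (algebraMap ℂ (Grass N) _ * a) = 0
    rw [← Algebra.smul_def, ← berezinL_apply, map_smul, berezinL_apply, berezin, ha 0, map_zero,
      map_zero, smul_zero]
  simp only [this]
  exact intC_zero

/-- Stokes' theorem, with the boundary oriented by the inward normal placed first. -/
theorem integral_deRham (hS : IsOriented S) (hf : IsSForm f) :
    integral (deRham f) = -boundaryIntegral (toBoundary f) := by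
  have hclosed : ∀ q : S, IsSForm (deRham (rho q) * f) := fun q => (isSForm_rho q).deRham.mul hf
  have hd : ∀ q : S, SEq (rho q * deRham f) (deRham (rho q * f) + -(deRham (rho q) * f)) := by
    intro q c p hp
    have hp1 : parity (rho (N := N) q c p) = rho q c p := AlgHom.commutes _ _
    rw [Pi.add_apply, Pi.add_apply, deRham_mul (isSForm_rho q) hf hp, hp1, Pi.neg_apply,
      Pi.neg_apply, Pi.mul_apply, Pi.mul_apply, Pi.mul_apply, Pi.mul_apply]
    abel
  have hs1 : ∀ q : S, SuppIn (deRham (rho (N := N) q) * f) (rhoSupp q) := fun q =>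
    ((suppIn_rho q).deRham (isClosed_rhoSupp q)).mul_right f
  have h1 : ∀ q ∈ parts S, chartInt (chartIn q) (rho q * deRham f) =
      -bdInt (chartIn q) (rho q * f) - chartInt (chartIn q) (deRham (rho q) * f) := by
    intro q _
    have hq := (isSForm_rho q).mul hf
    rw [chartInt_congr (hd q), chartInt_add hq.deRham (hclosed q).neg (isClosed_rhoSupp q)
      (rhoSupp_subset q) ((suppIn_rho_mul q f).deRham (isClosed_rhoSupp q))
      (by rw [← neg_one_smul ℂ (deRham (rho q) * f)]; exact (hs1 q).smul _),
      chartInt_deRham hq (isClosed_rhoSupp q) (rhoSupp_subset q) (suppIn_rho_mul q f),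
      ← neg_one_smul ℂ (deRham (rho q) * f), chartInt_smul _ (hclosed q) (isClosed_rhoSupp q)
      (rhoSupp_subset q) (hs1 q), neg_one_smul, sub_eq_add_neg]
  -- The terms with dρ_q cancel because Σ dρ_q = d1 = 0, but they are integrals in different charts.
  -- Inserting Σ ρ_r = 1 localizes each to an overlap, where it can be moved to the chart of `r` and
  -- the sum over `q` performed first.
  have h2 : ∑ q ∈ parts S, chartInt (chartIn q) (deRham (rho (N := N) q) * f) = 0 := by
    have h3 : ∀ q ∈ parts S, chartInt (chartIn q) (deRham (rho (N := N) q) * f) =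
        ∑ r ∈ parts S, chartInt (chartIn r) (rho r * (deRham (rho q) * f)) := by
      intro q _
      have : deRham (rho (N := N) q) * f = ∑ r ∈ parts S, rho r * (deRham (rho q) * f) := by
        rw [← Finset.sum_mul, sum_rho, one_mul]
      conv_lhs => rw [this]
      rw [chartInt_sum (parts S) (fun r _ => (isSForm_rho r).mul (hclosed q)) (isClosed_rhoSupp q)
        (rhoSupp_subset q) fun r _ => (hs1 q).mul_left _]
      refine Finset.sum_congr rfl fun r _ => ?_
      have hint : SuppIn (rho r * (deRham (rho q) * f)) (rhoSupp q ∩ rhoSupp r) := by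
        intro c p hp hK
        by_cases hq : p ∈ rhoSupp q
        · exact suppIn_rho_mul r _ c p hp fun hr => hK ⟨hq, hr⟩
        · exact (hs1 q).mul_left _ c p hp hq
      exact chartInt_eq_chartInt hS ((isSForm_rho r).mul (hclosed q))
        ((isClosed_rhoSupp q).inter (isClosed_rhoSupp r))
        (inter_subset_left.trans (rhoSupp_subset q))
        (inter_subset_right.trans (rhoSupp_subset r)) hint
    rw [Finset.sum_congr rfl h3, Finset.sum_comm]
    refine Finset.sum_eq_zero fun r _ => ?_
    rw [← chartInt_sum (parts S) (fun q _ => (isSForm_rho r).mul (hclosed q)) (isClosed_rhoSupp r)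
      (rhoSupp_subset r) fun q _ => suppIn_rho_mul r _]
    refine chartInt_eq_zero fun c p hp => ?_
    have h0 : ∑ q ∈ parts S, deRham (rho (N := N) q) c p = 0 := by
      have h4 := deRham_sum (parts S) (fun q _ => isSForm_rho (N := N) q) c p hp
      rw [sum_rho, Finset.sum_apply, Finset.sum_apply] at h4
      rw [← h4]
      exact deRham_constForm 1 c p hp
    rw [← Finset.mul_sum, ← Finset.sum_mul, Pi.mul_apply, Pi.mul_apply, Pi.mul_apply, Pi.mul_apply,
      Finset.sum_apply, Finset.sum_apply, h0, zero_mul, mul_zero]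
    rfl
  rw [integral_eq_sum, boundaryIntegral_eq_sum, Finset.sum_congr rfl h1,
    Finset.sum_sub_distrib, h2, sub_zero, Finset.sum_neg_distrib]

end Forms

end RozanskyWitten
end

noncomputable section

namespace RozanskyWitten

open Filter Topology MeasureTheory

variable {N : ℕ}

/-! ### The odd symplectic form on the space of fields -/

section Fields

variable {S : Type*} [TopologicalSpace S] [ChartedSpace (EuclideanHalfSpace 3) S]

local notation "Chart" => atlas (EuclideanHalfSpace 3) S

/-- Odd vectors tangent to the space of fields. -/
def IsOddTangent (Q : SField N S) : Prop := ∀ i, IsSForm (Q i) ∧ IsOddForm (Q i)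

theorem IsOddForm.add {f g : SForm N S} (hf : IsOddForm f) (hg : IsOddForm g) :
    IsOddForm (f + g) := fun c p hp => (hf c p hp).add (hg c p hp)

theorem IsOddForm.neg {f : SForm N S} (hf : IsOddForm f) : IsOddForm (-f) :=
  fun c p hp => (hf c p hp).neg

theorem isOddForm_sum {ι : Type*} (A : Finset ι) {f : ι → SForm N S}
    (h : ∀ i ∈ A, IsOddForm (f i)) : IsOddForm (∑ i ∈ A, f i) := fun c p hp => by
  rw [Finset.sum_apply, Finset.sum_apply]
  exact isOdd_sum A _ fun i hi => h i hi c p hp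

theorem IsOddTangent.add {Q P : SField N S} (hQ : IsOddTangent Q) (hP : IsOddTangent P) :
    IsOddTangent (Q + P) :=
  fun i => ⟨(hQ i).1.add (hP i).1, (hQ i).2.add (hP i).2⟩

theorem isSForm_density (Ω : Matrix (Fin N) (Fin N) ℂ) {Q ξ : SField N S}
    (hQ : ∀ i, IsSForm (Q i)) (hξ : ∀ i, IsSForm (ξ i)) :
    IsSForm (∑ i, ∑ j, Ω i j • (Q i * ξ j)) :=
  isSForm_sum _ fun i _ => isSForm_sum _ fun j _ => ((hQ i).mul (hξ j)).smul _

theorem deRham_density (Ω : Matrix (Fin N) (Fin N) ℂ) {Q ξ : SField N S}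
    (hQ : ∀ i, IsSForm (Q i)) (hξ : ∀ i, IsSForm (ξ i)) :
    SEq (deRham (∑ i, ∑ j, Ω i j • (Q i * ξ j))) (∑ i, ∑ j, Ω i j • deRham (Q i * ξ j)) := by
  intro c p hp
  rw [deRham_sum Finset.univ (f := fun i => ∑ j, Ω i j • (Q i * ξ j)) (fun i _ =>
    isSForm_sum _ fun j _ => ((hQ i).mul (hξ j)).smul _) c p hp, Finset.sum_apply, Finset.sum_apply,
    Finset.sum_apply, Finset.sum_apply]
  refine Finset.sum_congr rfl fun i _ => ?_
  rw [deRham_sum Finset.univ (f := fun j => Ω i j • (Q i * ξ j)) (fun j _ =>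
    ((hQ i).mul (hξ j)).smul _) c p hp, Finset.sum_apply, Finset.sum_apply, Finset.sum_apply,
    Finset.sum_apply]
  exact Finset.sum_congr rfl fun j _ => deRham_smul _ ((hQ i).mul (hξ j)) c p hp

theorem deRham_constForm_mul {t : Grass N} (ht : IsEven t) (htc : IsConst t) {f : SForm N S}
    (hf : IsSForm f) : SEq (deRham (constForm t * f)) (constForm t * deRham f) := by
  intro c p hp
  rw [deRham_mul (isSForm_constForm htc) hf hp, deRham_constForm t c p hp, Pi.zero_apply,
    Pi.zero_apply, zero_mul, zero_add, Pi.mul_apply, Pi.mul_apply]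
  congr 1

theorem isSuperfield_add_scale {X ξ : SField N S} (hX : IsSuperfield X) (hξ : IsTangent ξ)
    {t : Grass N} (ht : IsEven t) (htc : IsConst t) (htt : t * t = 0) :
    IsSuperfield (X + scale t ξ) := by
  refine ⟨fun i => ⟨(hX.1 i).1.add ((isSForm_constForm htc).mul (hξ i).1), fun c p hp =>
    ((hX.1 i).2 c p hp).add (ht.mul ((hξ i).2 c p hp))⟩, fun i c p hp => ?_⟩
  have h0 : ExteriorAlgebra.algebraMapInv t = 0 := by
    have := congrArg (ExteriorAlgebra.algebraMapInv (R := ℂ) (M := Gen N →₀ ℂ)) htt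
    rw [map_mul, map_zero] at this
    exact mul_self_eq_zero.1 this
  change ExteriorAlgebra.algebraMapInv (X i c p + t * ξ i c p) = 0
  rw [map_add, map_mul, h0, hX.2 i c p hp, zero_mul, add_zero]

theorem isTangent_scale {P : SField N S} (hP : IsOddTangent P) {a : Grass N} (ha : IsOdd a)
    (hac : IsConst a) : IsTangent (scale a P) :=
  fun i => ⟨(isSForm_constForm hac).mul (hP i).1, fun c p hp => ha.mul_odd ((hP i).2 c p hp)⟩

theorem isOddTangent_deRham [IsManifold (𝓡∂ 3) ∞ S] {X : SField N S} (hX : IsSuperfield X) :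
    IsOddTangent fun i => -deRham (X i) :=
  fun i => ⟨(hX.1 i).1.deRham.neg, ((hX.1 i).2.deRham (hX.1 i).1).neg⟩

variable [IsManifold (𝓡∂ 3) ∞ S] [CompactSpace S] [T2Space S]

theorem integral_const_mul_even {t : Grass N} (ht : IsEven t) (htc : IsConst t) {f : SForm N S}
    (hf : IsSForm f) : integral (constForm t * f) = t * integral f := by
  have h : constForm t * f = f * constForm t := by
    funext c p
    exact ht.comm _
  rw [h, integral_mul_constForm htc hf, ht.comm]

/-- The integral of an even form is odd. -/
theorem isOdd_integral {f : SForm N S} (hf : IsSForm f) (he : IsEvenForm f) :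
    IsOdd (integral f) := by
  rw [IsOdd, parity_integral hf]
  congr 1
  exact integral_congr fun c p hp => he c p hp

section Bilinear

variable (Ω : Matrix (Fin N) (Fin N) ℂ) {Q P ξ : SField N S}

theorem bvForm_add_left (hQ : ∀ i, IsSForm (Q i)) (hP : ∀ i, IsSForm (P i))
    (hξ : ∀ i, IsSForm (ξ i)) : bvForm Ω (Q + P) ξ = bvForm Ω Q ξ + bvForm Ω P ξ := by
  rw [bvForm, bvForm, bvForm, ← integral_add (isSForm_density Ω hQ hξ) (isSForm_density Ω hP hξ)]
  congr 1
  simp only [Pi.add_apply, add_mul, smul_add, Finset.sum_add_distrib]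

variable {Ω}

/-- The antisymmetry of Ω and the sign from exchanging odd components cancel. -/
theorem bvForm_symm (hΩ : ∀ i j, Ω i j = -Ω j i) (hQ : IsOddTangent Q) (hP : IsOddTangent P) :
    bvForm Ω Q P = bvForm Ω P Q := by
  refine integral_congr fun c p hp => ?_
  simp only [Finset.sum_apply, Pi.smul_apply, Pi.mul_apply]
  rw [Finset.sum_comm]
  refine Finset.sum_congr rfl fun j _ => Finset.sum_congr rfl fun i _ => ?_
  rw [hΩ i j, ((hQ i).2 c p hp).anticomm ((hP j).2 c p hp), smul_neg, neg_smul, neg_neg]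

/-- The constant changes sign when it passes the odd component on its way out to the right, and
again when it passes the integral, which is odd because its density is even. -/
theorem bvForm_scale_right (hQ : IsOddTangent Q) (hP : IsOddTangent P) {a : Grass N}
    (ha : IsOdd a) (hac : IsConst a) : bvForm Ω Q (scale a P) = a * bvForm Ω Q P := by
  have hd := isSForm_density Ω (fun i => (hQ i).1) (fun i => (hP i).1)
  have he : IsEvenForm (∑ i, ∑ j, Ω i j • (Q i * P j)) := by
    intro c p hp
    simp only [Finset.sum_apply, Pi.smul_apply, Pi.mul_apply]
    exact isEven_sum _ _ fun i _ => isEven_sum _ _ fun j _ =>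
      (((hQ i).2 c p hp).mul_odd ((hP j).2 c p hp)).smul _
  have h1 : bvForm Ω Q (scale a P) =
      integral ((-1 : ℂ) • ((∑ i, ∑ j, Ω i j • (Q i * P j)) * constForm a)) := by
    refine integral_congr fun c p hp => ?_
    simp only [Finset.sum_apply, Pi.smul_apply, Pi.mul_apply, scale, constForm, Finset.sum_mul,
      Finset.smul_sum, neg_one_smul]
    refine Finset.sum_congr rfl fun i _ => Finset.sum_congr rfl fun j _ => ?_
    rw [ha.anticomm ((hP j).2 c p hp), mul_neg, smul_neg, smul_mul_assoc, mul_assoc]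
  rw [h1, integral_smul _ (hd.mul (isSForm_constForm hac)), integral_mul_constForm hac hd,
    neg_one_smul, ← ha.anticomm (isOdd_integral hd he), bvForm]

/-- The value of the odd symplectic form on a Hamiltonian vector field only depends on the
function. -/
theorem IsHamiltonian.bvForm_eq {F : Functional N S} {Q Q' : SField N S → SField N S}
    (h : IsHamiltonian Ω F Q) (h' : IsHamiltonian Ω F Q') {X : SField N S} (hX : IsSuperfield X)
    (hP : IsOddTangent P) : bvForm Ω (Q X) P = bvForm Ω (Q' X) P := by
  -- Variations only test even tangent vectors. An odd vector is reached by multiplying it by an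
  -- arbitrary auxiliary odd constant and cancelling that constant afterwards.
  have hev : ∀ ξ, IsTangent ξ → bvForm Ω (Q X) ξ = bvForm Ω (Q' X) ξ := fun ξ hξ =>
    eq_of_forall_even_const fun t ht htc htt =>
      add_left_cancel ((h.eq X hX ξ hξ t ht htc htt).symm.trans (h'.eq X hX ξ hξ t ht htc htt))
  rw [← sub_eq_zero]
  refine eq_zero_of_eta_mul 0 fun a _ => ?_
  have hao : IsOdd (eta (N := N) a) := isOdd_gen _
  have hac : IsConst (eta (N := N) a) := isConst_gen _
  rw [mul_sub, ← bvForm_scale_right (h.odd X hX) hP hao hac,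
    ← bvForm_scale_right (h'.odd X hX) hP hao hac, hev _ (isTangent_scale hP hao hac), sub_self]

/-- The chosen Hamiltonian vector fields are exchanged for given ones in one slot at a time, with
symmetry bringing each slot to the left. -/
theorem bvBracket_eq (hΩ : ∀ i j, Ω i j = -Ω j i) {F G : Functional N S}
    {Q P : SField N S → SField N S} (hF : IsHamiltonian Ω F Q) (hG : IsHamiltonian Ω G P)
    {X : SField N S} (hX : IsSuperfield X) : bvBracket Ω F G X = bvForm Ω (Q X) (P X) := by
  have h : (∃ Q, IsHamiltonian Ω F Q) ∧ (∃ Q, IsHamiltonian Ω G Q) := ⟨⟨Q, hF⟩, ⟨P, hG⟩⟩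
  rw [bvBracket, dif_pos h, h.1.choose_spec.bvForm_eq hF hX (h.2.choose_spec.odd X hX),
    bvForm_symm hΩ (hF.odd X hX) (h.2.choose_spec.odd X hX),
    h.2.choose_spec.bvForm_eq hG hX (hF.odd X hX), bvForm_symm hΩ (hG.odd X hX) (hF.odd X hX)]

end Bilinear

/-! ### The kinetic term -/

section Kinetic

variable {Ω : Matrix (Fin N) (Fin N) ℂ} {X ξ : SField N S}

/-- The variation of the kinetic term. -/
def kinVar (Ω : Matrix (Fin N) (Fin N) ℂ) (X ξ : SField N S) : Grass N :=
  integral ((1 / 2 : ℂ) • ∑ i, ∑ j, Ω i j • (ξ i * deRham (X j) + X i * deRham (ξ j)))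

theorem isVariation_actionKin (hX : IsSuperfield X) (hξ : IsTangent ξ) :
    IsVariation (actionKin Ω) X ξ (kinVar Ω X ξ) := by
  intro t ht htc htt
  have hD : ∀ j, SEq (deRham ((X + scale t ξ) j)) (deRham (X j) + constForm t * deRham (ξ j)) := by
    intro j c p hp
    refine (deRham_add (hX.1 j).1 ((isSForm_constForm htc).mul (hξ j).1) c p hp).trans ?_
    rw [Pi.add_apply, Pi.add_apply, deRham_constForm_mul ht htc (hξ j).1 c p hp]
    rfl
  have hv : IsSForm ((1 / 2 : ℂ) • ∑ i, ∑ j, Ω i j • (ξ i * deRham (X j) + X i * deRham (ξ j))) :=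
    (isSForm_sum _ fun i _ => isSForm_sum _ fun j _ => ((((hξ i).1.mul (hX.1 j).1.deRham).add
      ((hX.1 i).1.mul (hξ j).1.deRham)).smul _)).smul _
  have hk : IsSForm ((1 / 2 : ℂ) • ∑ i, ∑ j, Ω i j • (X i * deRham (X j))) :=
    (isSForm_density Ω (fun i => (hX.1 i).1) fun j => (hX.1 j).1.deRham).smul _
  rw [kinVar, ← integral_const_mul_even ht htc hv, actionKin, actionKin,
    ← integral_add hk ((isSForm_constForm htc).mul hv)]
  refine integral_congr fun c p hp => ?_
  simp only [Finset.sum_apply, Pi.smul_apply, Pi.mul_apply, Pi.add_apply, constForm]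
  rw [mul_smul_comm, ← smul_add, Finset.mul_sum, ← Finset.sum_add_distrib]
  congr 1
  refine Finset.sum_congr rfl fun i _ => ?_
  rw [Finset.mul_sum, ← Finset.sum_add_distrib]
  refine Finset.sum_congr rfl fun j _ => ?_
  have h1 := hD j c p hp
  rw [Pi.add_apply] at h1
  rw [h1]
  change Ω i j • ((X i c p + t * ξ i c p) * (deRham (X j) c p + t * deRham (ξ j) c p)) = _
  rw [mul_smul_comm, ← smul_add]
  congr 1
  -- The quadratic term in the variation carries t² = 0.
  have h2 : t * ξ i c p * (t * deRham (ξ j) c p) = 0 := by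
    rw [ht.comm (ξ i c p), mul_assoc, ← mul_assoc t, htt, zero_mul, mul_zero]
  have h3 : X i c p * (t * deRham (ξ j) c p) = t * (X i c p * deRham (ξ j) c p) := by
    rw [← mul_assoc, ← ht.comm, mul_assoc]
  rw [add_mul, mul_add, mul_add, h2, h3, mul_add]
  noncomm_ring

/-- By antisymmetry of Ω, the density -Ω dX ξ differs from the varied kinetic density exactly by
-d(½ Ω X ξ). Stokes with the inward-first orientation turns this into the boundary term with a plus
sign. -/
theorem bvForm_deRham_eq (hS : IsOriented S) (hΩ : ∀ i j, Ω i j = -Ω j i) (hX : IsSuperfield X)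
    (hξ : IsTangent ξ) : bvForm Ω (fun i => -deRham (X i)) ξ =
      kinVar Ω X ξ + boundaryPrimitive Ω (boundaryField X) (boundaryField ξ) := by
  have hb : boundaryPrimitive Ω (boundaryField X) (boundaryField ξ) =
      boundaryIntegral (toBoundary ((1 / 2 : ℂ) • ∑ i, ∑ j, Ω i j • (X i * ξ j))) := by
    rw [boundaryPrimitive]
    congr 1
    funext c p
    simp only [toBoundary, boundaryField, Finset.sum_apply, Pi.smul_apply, Pi.mul_apply, map_smul,
      map_sum, map_mul]
  have hd : IsSForm (∑ i, ∑ j, Ω i j • (X i * ξ j)) :=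
    isSForm_density Ω (fun i => (hX.1 i).1) fun j => (hξ j).1
  have hv : IsSForm ((1 / 2 : ℂ) • ∑ i, ∑ j, Ω i j • (ξ i * deRham (X j) + X i * deRham (ξ j))) :=
    (isSForm_sum _ fun i _ => isSForm_sum _ fun j _ => ((((hξ i).1.mul (hX.1 j).1.deRham).add
      ((hX.1 i).1.mul (hξ j).1.deRham)).smul _)).smul _
  have hst := integral_deRham hS (hd.smul (1 / 2))
  rw [hb, ← neg_neg (boundaryIntegral _), ← hst, ← integral_neg (hd.smul _).deRham, kinVar,
    ← integral_add hv (hd.smul _).deRham.neg]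
  refine integral_congr fun c p hp => ?_
  have hD : deRham ((1 / 2 : ℂ) • ∑ i, ∑ j, Ω i j • (X i * ξ j)) c p =
      (1 / 2 : ℂ) • ∑ i, ∑ j, Ω i j •
        (deRham (X i) c p * ξ j c p + X i c p * deRham (ξ j) c p) := by
    rw [deRham_smul _ hd c p hp, Pi.smul_apply, Pi.smul_apply,
      deRham_density Ω (fun i => (hX.1 i).1) (fun j => (hξ j).1) c p hp]
    simp only [Finset.sum_apply, Pi.smul_apply]
    congr 1
    refine Finset.sum_congr rfl fun i _ => Finset.sum_congr rfl fun j _ => ?_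
    rw [deRham_mul (hX.1 i).1 (hξ j).1 hp, (hX.1 i).2 c p hp]
  have hsw : ∑ i, ∑ j, Ω i j • (ξ i c p * deRham (X j) c p) =
      -∑ i, ∑ j, Ω i j • (deRham (X i) c p * ξ j c p) := by
    rw [Finset.sum_comm, ← Finset.sum_neg_distrib]
    refine Finset.sum_congr rfl fun i _ => ?_
    rw [← Finset.sum_neg_distrib]
    refine Finset.sum_congr rfl fun j _ => ?_
    rw [hΩ j i, ((hξ j).2 c p hp).comm, neg_smul]
  simp only [Pi.add_apply, Pi.neg_apply, hD]
  simp only [Finset.sum_apply, Pi.smul_apply, Pi.mul_apply, Pi.add_apply, Pi.neg_apply, neg_mul,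
    smul_neg, smul_add, Finset.sum_add_distrib, Finset.sum_neg_distrib, hsw]
  module

end Kinetic

end Fields

end RozanskyWitten
end

noncomputable section

namespace RozanskyWitten

open Filter Topology MeasureTheory

variable {N : ℕ}

/-! ### Derivatives with respect to the target -/

/-- The odd constants `dx^j` and `dx̄^j`. -/
def odx (a : Fin N ⊕ Fin N) : Grass N :=
  match a with
  | Sum.inl j => dx j
  | Sum.inr j => dxbar j

theorem isOdd_odx (a : Fin N ⊕ Fin N) : IsOdd (odx a) := by
  rcases a with j | j <;> exact isOdd_gen _

theorem isConst_odx (a : Fin N ⊕ Fin N) : IsConst (odx a) := by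
  rcases a with j | j <;> exact isConst_gen _

section Dolbeault

variable {x : Fin N → ℂ} {F G : (Fin N → ℂ) → Grass N} (a : Fin N ⊕ Fin N)

theorem GDiff.differentiableAt (hF : GDiff univ F x) (ℓ : Module.Dual ℂ (Grass N)) :
    DifferentiableAt ℝ (fun y => ℓ (F y)) x :=
  differentiableWithinAt_univ.1 (hF.diff ℓ)

theorem GDiff.dual_wirt (hF : GDiff univ F x) (ℓ : Module.Dual ℂ (Grass N)) :
    ℓ (coefwise (wirt a x) F) = wirt a x (fun y => ℓ (F y)) := by
  obtain ⟨V, hV, hFV⟩ := hF.fd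
  rw [nhdsWithin_univ] at hFV
  let Λ : Module.Dual ℂ (Grass N) →ₗ[ℂ] ℂ :=
    { toFun := fun ℓ => wirt a x (fun y => ℓ (F y))
      map_add' := fun ℓ ℓ' => wirt_add a (hF.differentiableAt ℓ) (hF.differentiableAt ℓ')
      map_smul' := fun c ℓ => wirt_const_mul a c (hF.differentiableAt ℓ) }
  refine dual_coefwise (s := {y | F y ∈ V}) hV (fun y hy => hy) (fun g g' h => ?_) Λ
    (fun _ => rfl) ℓ
  exact wirt_congr a (Filter.mem_of_superset hFV h)

theorem coefwise_wirt_add (hF : GDiff univ F x) (hG : GDiff univ G x) :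
    coefwise (wirt a x) (fun y => F y + G y) = coefwise (wirt a x) F + coefwise (wirt a x) G := by
  refine eq_of_forall_dual fun ℓ => ?_
  rw [(hF.add hG).dual_wirt, map_add, hF.dual_wirt, hG.dual_wirt]
  simp only [map_add]
  exact wirt_add a (hF.differentiableAt ℓ) (hG.differentiableAt ℓ)

theorem coefwise_wirt_const (w : Grass N) : coefwise (wirt a x) (fun _ => w) = 0 := by
  refine eq_of_forall_dual fun ℓ => ?_
  rw [(gdiff_const w).dual_wirt, wirt_const, map_zero]

theorem GDiff.finset_sum {ι : Type*} (A : Finset ι) {F : ι → (Fin N → ℂ) → Grass N}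
    (h : ∀ i ∈ A, GDiff univ (F i) x) : GDiff univ (fun y => ∑ i ∈ A, F i y) x := by
  classical
  induction A using Finset.induction_on with
  | empty => simpa using gdiff_const 0
  | insert i A hi ih =>
    simp only [Finset.sum_insert hi]
    exact (h i (Finset.mem_insert_self _ _)).add
      (ih fun j hj => h j (Finset.mem_insert_of_mem hj))

theorem coefwise_wirt_sum {ι : Type*} (A : Finset ι) {F : ι → (Fin N → ℂ) → Grass N}
    (h : ∀ i ∈ A, GDiff univ (F i) x) :
    coefwise (wirt a x) (fun y => ∑ i ∈ A, F i y) = ∑ i ∈ A, coefwise (wirt a x) (F i) := by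
  refine eq_of_forall_dual fun ℓ => ?_
  rw [(GDiff.finset_sum A h).dual_wirt, map_sum]
  simp only [map_sum]
  rw [wirt_sum a A _ fun i hi => (h i hi).differentiableAt ℓ]
  exact Finset.sum_congr rfl fun i hi => ((h i hi).dual_wirt a ℓ).symm

theorem gdiff_smul_const {g : (Fin N → ℂ) → ℂ} (hg : DifferentiableAt ℝ g x) (w : Grass N) :
    GDiff univ (fun y => g y • w) x :=
  (gdiff_scalar hg.differentiableWithinAt).map (LinearMap.toSpanSingleton ℂ (Grass N) w)

theorem coefwise_wirt_smul_const {g : (Fin N → ℂ) → ℂ} (hg : DifferentiableAt ℝ g x)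
    (w : Grass N) : coefwise (wirt a x) (fun y => g y • w) = wirt a x g • w := by
  refine eq_of_forall_dual fun ℓ => ?_
  rw [(gdiff_smul_const hg w).dual_wirt]
  simp only [map_smul, smul_eq_mul]
  rw [wirt_mul a hg (differentiableAt_const _), wirt_const, mul_zero, add_zero]

end Dolbeault

/-- The Dolbeault differential in the directions `s`. -/
def dolb (s : Fin N → Fin N ⊕ Fin N) (F : (Fin N → ℂ) → Grass N) (x : Fin N → ℂ) : Grass N :=
  ∑ k, odx (s k) * coefwise (wirt (s k) x) F

theorem dHol_eq_dolb (F : (Fin N → ℂ) → Grass N) (x : Fin N → ℂ) :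
    dHol F x = dolb Sum.inl F x := rfl

theorem dAnti_eq_dolb (F : (Fin N → ℂ) → Grass N) (x : Fin N → ℂ) :
    dAnti F x = dolb Sum.inr F x := rfl

theorem dolb_const (s : Fin N → Fin N ⊕ Fin N) (w : Grass N) (x : Fin N → ℂ) :
    dolb s (fun _ => w) x = 0 :=
  Finset.sum_eq_zero fun k _ => by rw [coefwise_wirt_const, mul_zero]

theorem dolb_add (s : Fin N → Fin N ⊕ Fin N) {F G : (Fin N → ℂ) → Grass N} {x : Fin N → ℂ}
    (hF : GDiff univ F x) (hG : GDiff univ G x) :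
    dolb s (fun y => F y + G y) x = dolb s F x + dolb s G x := by
  simp only [dolb, coefwise_wirt_add _ hF hG, mul_add, Finset.sum_add_distrib]

/-! ### Functionals given by formal power series -/

section Potential

variable {S : Type*} [TopologicalSpace S] [ChartedSpace (EuclideanHalfSpace 3) S]

local notation "Chart" => atlas (EuclideanHalfSpace 3) S

theorem evalField_C (X : SField N S) (c : ℂ) :
    evalField (MvPowerSeries.C c) X = constForm (algebraMap ℂ (Grass N) c) := by
  funext d p
  exact evalSeries_C _ c

theorem evalSeries_monomial {A : Type*} [Ring A] [Algebra ℂ A] (n : Fin N →₀ ℕ) (a : Fin N → A) :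
    evalSeries (MvPowerSeries.monomial n 1) a = mono a n := by
  classical
  rw [evalSeries, finsum_eq_single _ n]
  · rw [MvPowerSeries.coeff_monomial_same, one_smul]
    rfl
  · intro m hm
    rw [MvPowerSeries.coeff_monomial_ne hm, zero_smul]

variable [IsManifold (𝓡∂ 3) ∞ S] [CompactSpace S] [T2Space S] {X : SField N S}

/-- The functional `∫ f(X)`. -/
def pot (X : SField N S) (f : MvPowerSeries (Fin N) ℂ) : Grass N := integral (evalField f X)

/-- The set of multi-indices depends on the field only, not on the series, so derivatives in the
target parameters act on finitely many scalar coefficients. -/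
theorem IsSuperfield.exists_pot_eq (hX : IsSuperfield X) :
    ∃ A : Finset (Fin N →₀ ℕ), ∀ f, pot X f =
      ∑ n ∈ A, MvPowerSeries.coeff n f • pot X (MvPowerSeries.monomial n 1) := by
  obtain ⟨K, hK⟩ := hX.exists_isNilTuple
  refine ⟨Finset.Iic (constIndex N K), fun f => ?_⟩
  have h1 : ∀ n, IsSForm (evalField (MvPowerSeries.monomial n 1) X) := fun n =>
    hX.isSForm_evalField _
  have h2 : SEq (evalField f X) (∑ n ∈ Finset.Iic (constIndex N K),
      MvPowerSeries.coeff n f • evalField (MvPowerSeries.monomial n 1) X) := by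
    intro c p hp
    simp only [Finset.sum_apply, Pi.smul_apply, evalField, evalSeries_monomial]
    exact (hK c p hp).evalSeries_eq_sum f
  rw [pot, integral_congr h2, integral_sum _ fun n _ => (h1 n).smul _]
  exact Finset.sum_congr rfl fun n _ => integral_smul _ (h1 n)

theorem IsSuperfield.pot_add (hX : IsSuperfield X) (f g : MvPowerSeries (Fin N) ℂ) :
    pot X (f + g) = pot X f + pot X g := by
  obtain ⟨A, hA⟩ := hX.exists_pot_eq
  simp only [hA (f + g), hA f, hA g, map_add, add_smul, Finset.sum_add_distrib]

theorem pot_C (c : ℂ) : pot X (MvPowerSeries.C c) = 0 := by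
  rw [pot, evalField_C]
  refine integral_constForm _ fun μ => ?_
  rw [dtheta_eq_contract, contract_algebraMap]

theorem IsSuperfield.isOdd_pot (hX : IsSuperfield X) (f : MvPowerSeries (Fin N) ℂ) :
    IsOdd (pot X f) :=
  isOdd_integral (hX.isSForm_evalField f) (hX.isEvenForm_evalField f)

/-- The first-order Taylor formula applies pointwise because both the tangent values and `t` are
central, and the even constant `t` leaves the integral on the left. -/
theorem isVariation_pot (hX : IsSuperfield X) {ξ : SField N S} (hξ : IsTangent ξ)
    (f : MvPowerSeries (Fin N) ℂ) : IsVariation (fun X => pot X f) X ξ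
      (integral (∑ l, evalField (MvPowerSeries.pderiv ℂ l f) X * ξ l)) := by
  intro t ht htc htt
  obtain ⟨K, hK⟩ := hX.exists_isNilTuple
  have hv : IsSForm (∑ l, evalField (MvPowerSeries.pderiv ℂ l f) X * ξ l) :=
    isSForm_sum _ fun l _ => (hX.isSForm_evalField _).mul (hξ l).1
  simp only [pot]
  rw [← integral_const_mul_even ht htc hv, ← integral_add (hX.isSForm_evalField f)
    ((isSForm_constForm htc).mul hv)]
  refine integral_congr fun c p hp => ?_
  have h := (hK c p hp).evalSeries_add_mul (x := fun i => ξ i c p)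
    (fun i b => ((hξ i).2 c p hp).comm b) (fun b => ht.comm b) htt f
  simp only [Pi.add_apply, Pi.mul_apply, Finset.sum_apply]
  exact h

theorem IsSuperfield.gdiff_pot (hX : IsSuperfield X) {U : Set (Fin N → ℂ)} (hU : IsOpen U)
    {x : Fin N → ℂ} (hx : x ∈ U) {H : (Fin N → ℂ) → MvPowerSeries (Fin N) ℂ}
    (hH : SmoothFam U H) (w : Grass N) (a : Fin N ⊕ Fin N) :
    GDiff univ (fun y => pot X (H y) * w) x ∧
    coefwise (wirt a x) (fun y => pot X (H y) * w) = pot X (famDeriv a H x) * w := by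
  obtain ⟨A, hA⟩ := hX.exists_pot_eq
  have hd : ∀ n, DifferentiableAt ℝ (fun y => MvPowerSeries.coeff n (H y)) x := fun n =>
    differentiableAt_of_contDiffOn hU hx (hH n)
  have h1 : (fun y => pot X (H y) * w) = fun y => ∑ n ∈ A,
      MvPowerSeries.coeff n (H y) • (pot X (MvPowerSeries.monomial n 1) * w) := by
    funext y
    rw [hA, Finset.sum_mul]
    exact Finset.sum_congr rfl fun n _ => smul_mul_assoc _ _ _
  have h2 : ∀ n ∈ A, GDiff univ (fun y => MvPowerSeries.coeff n (H y) •
      (pot X (MvPowerSeries.monomial n 1) * w)) x := fun n _ => gdiff_smul_const (hd n) _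
  rw [h1]
  refine ⟨GDiff.finset_sum A h2, ?_⟩
  rw [coefwise_wirt_sum a A h2, hA (famDeriv a H x), Finset.sum_mul]
  refine Finset.sum_congr rfl fun n _ => ?_
  rw [coefwise_wirt_smul_const a (hd n), coeff_famDeriv, smul_mul_assoc]

/-! ### The action of the Grothendieck connection -/

section Action

variable {Ω : Matrix (Fin N) (Fin N) ℂ} {φ : (Fin N → ℂ) → Fin N → MvPowerSeries (Fin N) ℂ}
  {U : Set (Fin N → ℂ)} {x : Fin N → ℂ} (s s' : Fin N → Fin N ⊕ Fin N)

/-- The action `∫ R̂^i_a(x; X) Ω_{il} X^l dx^a`, in the directions `s`. -/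
def connAction (Ω : Matrix (Fin N) (Fin N) ℂ)
    (φ : (Fin N → ℂ) → Fin N → MvPowerSeries (Fin N) ℂ) (s : Fin N → Fin N ⊕ Fin N)
    (x : Fin N → ℂ) : Functional N S := fun X =>
  integral (∑ j, ∑ i, ∑ l,
    Ω i l • (evalField (hamNormalize (conn φ (s j) x i)) X * X l * constForm (odx (s j))))

omit [IsManifold (𝓡∂ 3) ∞ S] [CompactSpace S] [T2Space S] in
/-- The vector field `R^i_a(x; X) dx^a`, in the directions `s`. -/
def connVF (φ : (Fin N → ℂ) → Fin N → MvPowerSeries (Fin N) ℂ) (s : Fin N → Fin N ⊕ Fin N)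
    (x : Fin N → ℂ) (X : SField N S) : SField N S :=
  fun i => ∑ j, evalField (conn φ (s j) x i) X * constForm (odx (s j))

/-- Recognizes the action as a sum of integrated Hamiltonians with odd coefficients on the right;
all later computations use this form. -/
theorem connAction_eq (hX : IsSuperfield X) :
    connAction Ω φ s x X = ∑ j, pot X (connHam Ω φ (s j) x) * odx (s j) := by
  obtain ⟨K, hK⟩ := hX.exists_isNilTuple
  have h1 : ∀ j, IsSForm (evalField (connHam Ω φ (s j) x) X * constForm (odx (s j))) := fun j =>
    (hX.isSForm_evalField _).mul (isSForm_constForm (isConst_odx _))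
  have h2 : connAction Ω φ s x X =
      integral (∑ j, evalField (connHam Ω φ (s j) x) X * constForm (odx (s j))) := by
    refine integral_congr fun c p hp => ?_
    simp only [Finset.sum_apply, Pi.smul_apply, Pi.mul_apply]
    refine Finset.sum_congr rfl fun j _ => ?_
    have h3 : evalField (connHam Ω φ (s j) x) X c p =
        ∑ l, (∑ i, Ω i l • evalField (hamNormalize (conn φ (s j) x i)) X c p) * X l c p := by
      rw [evalField, connHam, (hK c p hp).evalSeries_sum]
      refine Finset.sum_congr rfl fun l _ => ?_
      rw [(hK c p hp).evalSeries_mul, (hK c p hp).evalSeries_X]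
      congr 1
      have h4 : hamNormalize (∑ i, Ω i l • conn φ (s j) x i) =
          ∑ i, Ω i l • hamNormalize (conn φ (s j) x i) := by
        change hamNormalizeL _ = _
        rw [map_sum]
        exact Finset.sum_congr rfl fun i _ => map_smul hamNormalizeL _ _
      rw [h4, (hK c p hp).evalSeries_sum]
      exact Finset.sum_congr rfl fun i _ => (hK c p hp).evalSeries_smul _ _
    rw [h3, Finset.sum_comm]
    simp only [Finset.sum_mul, smul_mul_assoc]
  rw [h2, integral_sum _ fun j _ => h1 j]
  exact Finset.sum_congr rfl fun j _ =>
    integral_mul_constForm (isConst_odx _) (hX.isSForm_evalField _)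

omit [T2Space S] in
theorem isOddTangent_connVF (hX : IsSuperfield X) : IsOddTangent (connVF φ s x X) :=
  fun _ => ⟨isSForm_sum _ fun _ _ => (hX.isSForm_evalField _).mul
    (isSForm_constForm (isConst_odx _)), isOddForm_sum _ fun _ _ c p hp =>
      (hX.isEvenForm_evalField _ c p hp).mul_odd (isOdd_odx _)⟩

variable (hφ : IsFormalExp U φ) (hU : IsOpen U) (hx : x ∈ U) (hΩ : ∀ i j, Ω i j = -Ω j i)
  (hφΩ : PreservesForm Ω U φ)

include hφ hU hx

/-- The minus sign comes from moving dx^k past the integral of an even density, which is odd. -/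
theorem dolb_connAction (hX : IsSuperfield X) :
    GDiff univ (fun y => connAction Ω φ s' y X) x ∧
    dolb s (fun y => connAction Ω φ s' y X) x =
      -∑ k, ∑ j, pot X (famDeriv (s k) (connHam Ω φ (s' j)) x) * (odx (s k) * odx (s' j)) := by
  have h := fun k j => hX.gdiff_pot hU hx (hφ.smoothFam_connHam (Ω := Ω) (s' j) hU) (odx (s' j)) (s k)
  simp only [connAction_eq s' hX]
  refine ⟨?_, ?_⟩
  · refine GDiff.finset_sum _ fun j _ => ?_
    exact (hX.gdiff_pot hU hx (hφ.smoothFam_connHam (Ω := Ω) (s' j) hU) (odx (s' j)) (s' j)).1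
  · rw [dolb, ← Finset.sum_neg_distrib]
    refine Finset.sum_congr rfl fun k _ => ?_
    rw [coefwise_wirt_sum _ _ fun j _ => (h k j).1, Finset.mul_sum, ← Finset.sum_neg_distrib]
    refine Finset.sum_congr rfl fun j _ => ?_
    rw [(h k j).2, ← mul_assoc, (isOdd_odx _).anticomm (hX.isOdd_pot _), neg_mul, mul_assoc]

include hΩ hφΩ

theorem sum_pderiv_connHam (hX : IsSuperfield X) {c : Chart} {p : S} (hp : p ∈ c.1.source)
    (a : Fin N ⊕ Fin N) (l : Fin N) :
    evalField (MvPowerSeries.pderiv ℂ l (connHam Ω φ a x)) X c p =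
      ∑ i, Ω i l • evalField (conn φ a x i) X c p := by
  obtain ⟨K, hK⟩ := hX.exists_isNilTuple
  rw [hφ.pderiv_connHam a hU hx hΩ hφΩ, evalField, (hK c p hp).evalSeries_sum]
  exact Finset.sum_congr rfl fun i _ => (hK c p hp).evalSeries_smul _ _

theorem isVariation_connAction (hX : IsSuperfield X) {ξ : SField N S} (hξ : IsTangent ξ) :
    IsVariation (connAction Ω φ s x) X ξ (bvForm Ω (connVF φ s x X) ξ) := by
  intro t ht htc htt
  have hv : ∀ j, IsSForm (∑ l, evalField (MvPowerSeries.pderiv ℂ l (connHam Ω φ (s j) x)) X * ξ l) :=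
    fun j => isSForm_sum _ fun l _ => (hX.isSForm_evalField _).mul (hξ l).1
  have hb : bvForm Ω (connVF φ s x X) ξ =
      ∑ j, integral (∑ l, evalField (MvPowerSeries.pderiv ℂ l (connHam Ω φ (s j) x)) X * ξ l) *
        odx (s j) := by
    have h1 : bvForm Ω (connVF φ s x X) ξ = integral (∑ j,
        (∑ l, evalField (MvPowerSeries.pderiv ℂ l (connHam Ω φ (s j) x)) X * ξ l) *
          constForm (odx (s j))) := by
      refine integral_congr fun c p hp => ?_
      simp only [Finset.sum_apply, Pi.smul_apply, Pi.mul_apply, connVF, constForm,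
        sum_pderiv_connHam hφ hU hx hΩ hφΩ hX hp, Finset.sum_mul, Finset.smul_sum]
      rw [Finset.sum_comm]
      conv_lhs => enter [2, l]; rw [Finset.sum_comm]
      rw [Finset.sum_comm]
      refine Finset.sum_congr rfl fun j _ => Finset.sum_congr rfl fun l _ =>
        Finset.sum_congr rfl fun i _ => ?_
      -- The tangent vector is even, so it passes dx^a without a sign and the constant can leave the
      -- integral on the right.
      rw [mul_assoc, ← ((hξ l).2 c p hp).comm, smul_mul_assoc, smul_mul_assoc, mul_assoc]
    rw [h1, integral_sum _ fun j _ => (hv j).mul (isSForm_constForm (isConst_odx _))]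
    exact Finset.sum_congr rfl fun j _ => integral_mul_constForm (isConst_odx _) (hv j)
  rw [connAction_eq s (isSuperfield_add_scale hX hξ ht htc htt), connAction_eq s hX, hb,
    Finset.mul_sum, ← Finset.sum_add_distrib]
  refine Finset.sum_congr rfl fun j _ => ?_
  have h := isVariation_pot hX hξ (connHam Ω φ (s j) x) t ht htc htt
  simp only at h
  rw [h, add_mul, mul_assoc]

theorem isHamiltonian_connVF : IsHamiltonian (S := S) Ω (connAction Ω φ s x) (connVF φ s x) :=
  ⟨fun _ hX => isOddTangent_connVF s hX, fun _ hX _ hξ =>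
    isVariation_connAction s hφ hU hx hΩ hφΩ hX hξ⟩

/-- By the chain rule Ω_{il} R_a^i dX^l is the exact form d(h_a(X)). The sign of -d is absorbed when
dX passes the odd dx^a. -/
theorem bvForm_connVF_deRham (hS : IsOriented S) (hbd : (𝓡∂ 3).boundary S = ∅)
    (hX : IsSuperfield X) : bvForm Ω (connVF φ s x X) (fun i => -deRham (X i)) = 0 := by
  have h1 : bvForm Ω (connVF φ s x X) (fun i => -deRham (X i)) = integral (∑ j,
      deRham (evalField (connHam Ω φ (s j) x) X) * constForm (odx (s j))) := by
    refine integral_congr fun c p hp => ?_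
    have hD : ∀ j, deRham (evalField (connHam Ω φ (s j) x) X) c p =
        ∑ l, (∑ i, Ω i l • evalField (conn φ (s j) x i) X c p) * deRham (X l) c p := by
      intro j
      rw [hX.deRham_evalField _ c p hp]
      simp only [Finset.sum_apply, Pi.mul_apply, sum_pderiv_connHam hφ hU hx hΩ hφΩ hX hp]
    simp only [Finset.sum_apply, Pi.smul_apply, Pi.mul_apply, Pi.neg_apply, connVF, constForm, hD,
      Finset.sum_mul, Finset.smul_sum]
    rw [Finset.sum_comm]
    conv_lhs => enter [2, l]; rw [Finset.sum_comm]
    rw [Finset.sum_comm]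
    refine Finset.sum_congr rfl fun j _ => Finset.sum_congr rfl fun l _ =>
      Finset.sum_congr rfl fun i _ => ?_
    rw [mul_assoc, mul_neg, (isOdd_odx _).anticomm (((hX.1 l).2.deRham (hX.1 l).1) c p hp), neg_neg,
      smul_mul_assoc, smul_mul_assoc, mul_assoc]
  rw [h1, integral_sum _ fun j _ => (hX.isSForm_evalField _).deRham.mul
    (isSForm_constForm (isConst_odx _))]
  refine Finset.sum_eq_zero fun j _ => ?_
  rw [integral_mul_constForm (isConst_odx _) (hX.isSForm_evalField _).deRham,
    integral_deRham hS (hX.isSForm_evalField _), boundaryIntegral_of_boundary_eq_empty hbd,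
    neg_zero, zero_mul]

/-- The Maurer–Cartan equation for the connection actions. -/
theorem bvForm_connVF (hX : IsSuperfield X) :
    bvForm Ω (connVF φ s x X) (connVF φ s' x X) =
      -(dolb s (fun y => connAction Ω φ s' y X) x + dolb s' (fun y => connAction Ω φ s y X) x) := by
  obtain ⟨K, hK⟩ := hX.exists_isNilTuple
  have h1 : bvForm Ω (connVF φ s x X) (connVF φ s' x X) = integral (∑ k, ∑ j,
      evalField (∑ i, ∑ l, Ω i l • (conn φ (s k) x i * conn φ (s' j) x l)) X *
        constForm (odx (s k) * odx (s' j))) := by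
    refine integral_congr fun c p hp => ?_
    have hev : ∀ k j, evalField (∑ i, ∑ l, Ω i l • (conn φ (s k) x i * conn φ (s' j) x l)) X c p =
        ∑ i, ∑ l, Ω i l • (evalField (conn φ (s k) x i) X c p *
          evalField (conn φ (s' j) x l) X c p) := by
      intro k j
      rw [evalField, (hK c p hp).evalSeries_sum]
      refine Finset.sum_congr rfl fun i _ => ?_
      rw [(hK c p hp).evalSeries_sum]
      refine Finset.sum_congr rfl fun l _ => ?_
      rw [(hK c p hp).evalSeries_smul, (hK c p hp).evalSeries_mul]
      rfl
    simp only [Finset.sum_apply, Pi.smul_apply, Pi.mul_apply, connVF, constForm, hev,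
      Finset.sum_mul, Finset.mul_sum, Finset.smul_sum]
    have hcomm : ∀ f : Fin N → Fin N → Fin N → Fin N → Grass N,
        ∑ i, ∑ l, ∑ k, ∑ j, f i l k j = ∑ k, ∑ j, ∑ i, ∑ l, f i l k j := by
      intro f
      simp only [← Finset.sum_product']
      exact Finset.sum_nbij' (fun q => ⟨q.2.2.1, q.2.2.2, q.1, q.2.1⟩)
        (fun q => ⟨q.2.2.1, q.2.2.2, q.1, q.2.1⟩) (by simp) (by simp) (by simp) (by simp) (by simp)
    rw [hcomm, Finset.sum_comm]
    refine Finset.sum_congr rfl fun k _ => Finset.sum_congr rfl fun j _ =>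
      Finset.sum_congr rfl fun i _ => Finset.sum_congr rfl fun l _ => ?_
    rw [smul_mul_assoc]
    congr 1
    rw [mul_assoc, mul_assoc, ← mul_assoc (odx (s k)),
      ← (hX.isEvenForm_evalField (conn φ (s' j) x l) c p hp).comm (odx (s k)), mul_assoc]
  have hc : ∀ k j, IsConst (odx (s k) * odx (s' j)) := fun k j =>
    (isConst_odx _).mul (isConst_odx _)
  -- The integration constant in `IsFormalExp.connHam_flat` integrates to zero over the source, so
  -- the Maurer–Cartan equation holds exactly for the integrated Hamiltonians.
  have hfl : ∀ k j, pot X (∑ i, ∑ l, Ω i l • (conn φ (s k) x i * conn φ (s' j) x l)) =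
      pot X (famDeriv (s k) (connHam Ω φ (s' j)) x) -
        pot X (famDeriv (s' j) (connHam Ω φ (s k)) x) := by
    intro k j
    obtain ⟨c, hc⟩ := hφ.connHam_flat (s k) (s' j) hU hx hΩ hφΩ
    have h2 := congrArg (pot X) (sub_eq_iff_eq_add.1 hc)
    rw [hX.pot_add, hX.pot_add, pot_C, add_zero] at h2
    rw [h2, add_sub_cancel_right]
  rw [h1, integral_sum _ fun k _ => isSForm_sum _ fun j _ => (hX.isSForm_evalField _).mul
    (isSForm_constForm (hc k j)), (dolb_connAction s s' hφ hU hx hX).2,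
    (dolb_connAction s' s hφ hU hx hX).2, neg_add, neg_neg, neg_neg,
    Finset.sum_comm (f := fun k j => pot X (famDeriv (s' k) (connHam Ω φ (s j)) x) *
      (odx (s' k) * odx (s j))), ← Finset.sum_add_distrib]
  refine Finset.sum_congr rfl fun k _ => ?_
  rw [integral_sum _ fun j _ => (hX.isSForm_evalField _).mul (isSForm_constForm (hc k j)),
    ← Finset.sum_add_distrib]
  refine Finset.sum_congr rfl fun j _ => ?_
  rw [integral_mul_constForm (hc k j) (hX.isSForm_evalField _)]
  change pot X _ * _ = _
  -- Antisymmetry of the differentials turns the difference of the two mixed derivatives into a sum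
  -- of two Dolbeault terms.
  rw [hfl, sub_mul, (isOdd_odx (s' j)).anticomm (isOdd_odx (s k)), mul_neg, sub_eq_add_neg]

end Action

end Potential

end RozanskyWitten
end

noncomputable section

namespace RozanskyWitten

variable {N : ℕ}

/-! ### The kinetic term on a closed source -/

section Closed

variable {S : Type*} [TopologicalSpace S] [ChartedSpace (EuclideanHalfSpace 3) S]
  [IsManifold (𝓡∂ 3) ∞ S] [CompactSpace S] [T2Space S]
  {Ω : Matrix (Fin N) (Fin N) ℂ} {X : SField N S}

theorem isHamiltonian_actionKin (hS : IsOriented S) (hbd : (𝓡∂ 3).boundary S = ∅)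
    (hΩ : ∀ i j, Ω i j = -Ω j i) :
    IsHamiltonian (S := S) Ω (actionKin Ω) fun X i => -deRham (X i) := by
  refine ⟨fun X hX => isOddTangent_deRham hX, fun X hX ξ hξ => ?_⟩
  rw [bvForm_deRham_eq hS hΩ hX hξ, boundaryPrimitive,
    boundaryIntegral_of_boundary_eq_empty hbd, add_zero]
  exact isVariation_actionKin hX hξ

/-- The two signs cancel, and Ω dX dX = d(Ω X dX) by d² = 0, so Stokes applies. -/
theorem bvForm_deRham_deRham (hS : IsOriented S) (hbd : (𝓡∂ 3).boundary S = ∅)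
    (hX : IsSuperfield X) : bvForm Ω (fun i => -deRham (X i)) (fun i => -deRham (X i)) = 0 := by
  have hd : IsSForm (∑ i, ∑ j, Ω i j • (X i * deRham (X j))) :=
    isSForm_density Ω (fun i => (hX.1 i).1) fun j => (hX.1 j).1.deRham
  have h : bvForm Ω (fun i => -deRham (X i)) (fun i => -deRham (X i)) =
      integral (deRham (∑ i, ∑ j, Ω i j • (X i * deRham (X j)))) := by
    refine integral_congr fun c p hp => ?_
    rw [deRham_density Ω (fun i => (hX.1 i).1) (fun j => (hX.1 j).1.deRham) c p hp]
    simp only [Finset.sum_apply, Pi.smul_apply, neg_mul_neg, Pi.mul_apply]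
    refine Finset.sum_congr rfl fun i _ => Finset.sum_congr rfl fun j _ => ?_
    rw [deRham_mul (hX.1 i).1 (hX.1 j).1.deRham hp, deRham_deRham (hX.1 j).1 c p hp, Pi.zero_apply,
      Pi.zero_apply, mul_zero, add_zero]
  rw [h, integral_deRham hS hd, boundaryIntegral_of_boundary_eq_empty hbd, neg_zero]

end Closed

end RozanskyWitten
end

/-! ### The master equation and its boundary modification -/

theorem mainTheorem4
    {S : Type*} [TopologicalSpace S] [ChartedSpace (EuclideanHalfSpace 3) S]
    [IsManifold (𝓡∂ 3) ∞ S] [CompactSpace S] [T2Space S] (hS : IsOriented S)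
    {N : ℕ} {M : Type*} [TopologicalSpace M] [ChartedSpace (Fin N → ℂ) M]
    [IsManifold 𝓘(ℂ, Fin N → ℂ) ω M] (σ : HolomorphicSymplecticForm N M)
    (e : OpenPartialHomeomorph M (Fin N → ℂ))
    (he : e ∈ IsManifold.maximalAtlas 𝓘(ℂ, Fin N → ℂ) ω M)
    (Ω : Matrix (Fin N) (Fin N) ℂ)
    (hΩ : ∀ x ∈ e.target, ∀ i j, formCoord σ.form e i j x = Ω i j)
    (φ : (Fin N → ℂ) → Fin N → MvPowerSeries (Fin N) ℂ)
    (hφ : IsFormalExp e.target φ) (hφΩ : PreservesForm Ω e.target φ) :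
    -- closed source: the master equation and its components by form degree on the target
    ((𝓡∂ 3).boundary S = ∅ → ∀ x ∈ e.target,
      (∃ Q, IsHamiltonian (S := S) Ω (actionKin Ω) Q) ∧
      (∃ Q, IsHamiltonian (S := S) Ω (actionR Ω φ x) Q) ∧
      (∃ Q, IsHamiltonian (S := S) Ω (actionRbar Ω φ x) Q) ∧
      IsHamiltonian (S := S) Ω (globalAction Ω φ x) (globalVF φ x) ∧
      ∀ X : SField N S, IsSuperfield X →
        dM (fun x' => globalAction Ω φ x' X) x
          + (1 / 2 : ℂ) • bvBracket Ω (globalAction Ω φ x) (globalAction Ω φ x) X = 0 ∧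
        bvBracket Ω (actionKin Ω) (actionKin Ω) X = 0 ∧
        dHol (fun _ => actionKin Ω X) x + bvBracket Ω (actionR Ω φ x) (actionKin Ω) X = 0 ∧
        dAnti (fun _ => actionKin Ω X) x + bvBracket Ω (actionRbar Ω φ x) (actionKin Ω) X = 0 ∧
        dHol (fun x' => actionR Ω φ x' X) x
          + (1 / 2 : ℂ) • bvBracket Ω (actionR Ω φ x) (actionR Ω φ x) X = 0 ∧
        (dHol (fun x' => actionRbar Ω φ x' X) x
            + (1 / 2 : ℂ) • bvBracket Ω (actionR Ω φ x) (actionRbar Ω φ x) X)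
          + (dAnti (fun x' => actionR Ω φ x' X) x
            + (1 / 2 : ℂ) • bvBracket Ω (actionRbar Ω φ x) (actionR Ω φ x) X) = 0 ∧
        dAnti (fun x' => actionRbar Ω φ x' X) x
          + (1 / 2 : ℂ) • bvBracket Ω (actionRbar Ω φ x) (actionRbar Ω φ x) X = 0) ∧
    -- source with boundary: `ι_Q̃ ω = δ S̃ + π^* α`
    (∀ x ∈ e.target, ∀ X : SField N S, IsSuperfield X → ∀ ξ : SField N S, IsTangent ξ →
      ∃ d : Grass N, IsVariation (globalAction Ω φ x) X ξ d ∧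
        bvForm Ω (globalVF φ x X) ξ
          = d + boundaryPrimitive Ω (boundaryField X) (boundaryField ξ)) := by
  -- The antisymmetry of the constant matrix is read off from the alternating form at a point of the
  -- chart.
  have hΩ' : ∀ x ∈ e.target, ∀ i j, Ω i j = -Ω j i := by
    intro x hx i j
    rw [← hΩ x hx i j, ← hΩ x hx j i]
    exact ((σ.alt (e.symm x)).neg_eq _ _).symm
  have hU := e.open_target
  have hvar : ∀ x ∈ e.target, ∀ X : SField N S, IsSuperfield X → ∀ ξ : SField N S, IsTangent ξ →
      IsVariation (globalAction Ω φ x) X ξ (kinVar Ω X ξ + bvForm Ω (connVF φ Sum.inl x X) ξ +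
        bvForm Ω (connVF φ Sum.inr x X) ξ) := by
    intro x hx X hX ξ hξ t ht htc htt
    have h1 := isVariation_actionKin (Ω := Ω) hX hξ t ht htc htt
    have h2 := isVariation_connAction Sum.inl hφ hU hx (hΩ' x hx) hφΩ hX hξ t ht htc htt
    have h3 := isVariation_connAction Sum.inr hφ hU hx (hΩ' x hx) hφΩ hX hξ t ht htc htt
    -- The holomorphic and antiholomorphic actions are, by definition, the two instances of the same
    -- construction.
    change actionKin Ω _ + connAction Ω φ Sum.inl x _ + connAction Ω φ Sum.inr x _ =
      actionKin Ω _ + connAction Ω φ Sum.inl x _ + connAction Ω φ Sum.inr x _ + _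
    rw [h1, h2, h3, mul_add, mul_add]
    abel
  have hsum : ∀ (x) (X : SField N S), IsSuperfield X → ∀ ξ : SField N S,
      (∀ i, IsSForm (ξ i)) → bvForm Ω (globalVF φ x X) ξ = bvForm Ω (fun i => -deRham (X i)) ξ +
        bvForm Ω (connVF φ Sum.inl x X) ξ + bvForm Ω (connVF φ Sum.inr x X) ξ := by
    intro x X hX ξ hξ
    have h1 := isOddTangent_deRham hX
    have h2 := isOddTangent_connVF (φ := φ) (x := x) Sum.inl hX
    have h3 := isOddTangent_connVF (φ := φ) (x := x) Sum.inr hX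
    rw [← bvForm_add_left Ω (fun i => (h1 i).1) (fun i => (h2 i).1) hξ,
      ← bvForm_add_left Ω (fun i => ((h1.add h2) i).1) (fun i => (h3 i).1) hξ]
    rfl
  have hodd : ∀ x (X : SField N S), IsSuperfield X → IsOddTangent (globalVF φ x X) :=
    fun x X hX => ((isOddTangent_deRham hX).add (isOddTangent_connVF Sum.inl hX)).add
      (isOddTangent_connVF Sum.inr hX)
  refine ⟨fun hbd x hx => ?_, fun x hx X hX ξ hξ => ?_⟩
  · have hK := isHamiltonian_actionKin hS hbd (hΩ' x hx)
    have hR : IsHamiltonian Ω (actionR Ω φ x) (connVF (S := S) φ Sum.inl x) :=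
      isHamiltonian_connVF Sum.inl hφ hU hx (hΩ' x hx) hφΩ
    have hRb : IsHamiltonian Ω (actionRbar Ω φ x) (connVF (S := S) φ Sum.inr x) :=
      isHamiltonian_connVF Sum.inr hφ hU hx (hΩ' x hx) hφΩ
    have hG : IsHamiltonian (S := S) Ω (globalAction Ω φ x) (globalVF φ x) := by
      refine ⟨hodd x, fun X hX ξ hξ => ?_⟩
      rw [hsum x X hX ξ fun i => (hξ i).1, bvForm_deRham_eq hS (hΩ' x hx) hX hξ,
        boundaryPrimitive, boundaryIntegral_of_boundary_eq_empty hbd, add_zero]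
      exact hvar x hx X hX ξ hξ
    refine ⟨⟨_, hK⟩, ⟨_, hR⟩, ⟨_, hRb⟩, hG, fun X hX => ?_⟩
    have hKo := isOddTangent_deRham hX
    have bKK : bvForm Ω (fun i => -deRham (X i)) (fun i => -deRham (X i)) = 0 :=
      bvForm_deRham_deRham hS hbd hX
    have bRK : ∀ s, bvForm Ω (connVF φ s x X) (fun i => -deRham (X i)) = 0 := fun s =>
      bvForm_connVF_deRham s hφ hU hx (hΩ' x hx) hφΩ hS hbd hX
    have bKR : ∀ s, bvForm Ω (fun i => -deRham (X i)) (connVF φ s x X) = 0 := fun s => by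
      rw [bvForm_symm (hΩ' x hx) hKo (isOddTangent_connVF s hX), bRK]
    have bRR := fun s s' => bvForm_connVF s s' hφ hU hx (hΩ' x hx) hφΩ hX
    have hcR : ∀ y, actionR Ω φ y X = connAction Ω φ Sum.inl y X := fun _ => rfl
    have hcRb : ∀ y, actionRbar Ω φ y X = connAction Ω φ Sum.inr y X := fun _ => rfl
    have hdG : ∀ s, dolb s (fun y => globalAction Ω φ y X) x =
        dolb s (fun y => connAction Ω φ Sum.inl y X) x +
          dolb s (fun y => connAction Ω φ Sum.inr y X) x := by
      intro s
      have g1 := (dolb_connAction (Ω := Ω) s Sum.inl hφ hU hx hX).1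
      have g2 := (dolb_connAction (Ω := Ω) s Sum.inr hφ hU hx hX).1
      change dolb s (fun y => actionKin Ω X + connAction Ω φ Sum.inl y X +
        connAction Ω φ Sum.inr y X) x = _
      rw [dolb_add s ((gdiff_const _).add g1) g2, dolb_add s (gdiff_const _) g1, dolb_const,
        zero_add]
    have hGG : bvForm Ω (globalVF φ x X) (globalVF φ x X) =
        bvForm Ω (connVF φ Sum.inl x X) (connVF φ Sum.inl x X) +
        bvForm Ω (connVF φ Sum.inl x X) (connVF φ Sum.inr x X) +
        bvForm Ω (connVF φ Sum.inr x X) (connVF φ Sum.inl x X) +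
        bvForm Ω (connVF φ Sum.inr x X) (connVF φ Sum.inr x X) := by
      -- Additivity was established in the left slot only; symmetry carries it to the right slot.
      have hsym : ∀ P, IsOddTangent P → bvForm Ω P (globalVF φ x X) =
          bvForm Ω (fun i => -deRham (X i)) P + bvForm Ω (connVF φ Sum.inl x X) P +
            bvForm Ω (connVF φ Sum.inr x X) P := fun P hP => by
        rw [bvForm_symm (hΩ' x hx) hP (hodd x X hX), hsum x X hX P fun i => (hP i).1]
      rw [hsum x X hX _ fun i => (hodd x X hX i).1, hsym _ hKo,
        hsym _ (isOddTangent_connVF Sum.inl hX), hsym _ (isOddTangent_connVF Sum.inr hX), bKK,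
        bRK, bRK, bKR, bKR]
      abel
    rw [bvBracket_eq (hΩ' x hx) hG hG hX, bvBracket_eq (hΩ' x hx) hK hK hX,
      bvBracket_eq (hΩ' x hx) hR hK hX, bvBracket_eq (hΩ' x hx) hRb hK hX,
      bvBracket_eq (hΩ' x hx) hR hR hX, bvBracket_eq (hΩ' x hx) hR hRb hX,
      bvBracket_eq (hΩ' x hx) hRb hR hX, bvBracket_eq (hΩ' x hx) hRb hRb hX, hGG, bKK, bRK, bRK]
    simp only [dM, dHol_eq_dolb, dAnti_eq_dolb, hdG, hcR, hcRb, bRR, dolb_const]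
    -- After substitution every bracket is minus a sum of two Dolbeault terms. On the diagonal these
    -- coincide, and the factor ½ cancels the derivative; in mixed degree the two halves add up to
    -- cancel both derivatives.
    refine ⟨?_, trivial, add_zero _, add_zero _, ?_, ?_, ?_⟩ <;> module
  · exact ⟨_, hvar x hx X hX ξ hξ, by
      rw [hsum x X hX ξ fun i => (hξ i).1, bvForm_deRham_eq hS (hΩ' x hx) hX hξ]
      abel⟩
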